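/- Let $F$ be a probability distribution on $\mathbb{R}$, the law of a real random variable $X$, and write $F(x)=P[X\le x]$ for its distribution function. Let $F^{n*}$ be the $n$-fold convolution of $F$ ($F^{0*}=\delta_0$) and let $U=\sum_{n=0}^{\infty}F^{n*}$ be the renewal measure, with values in $[0,\infty]$. Call $F$ transient if $U\{[-y,y]\}<\infty$ for every $y>0$, and arithmetic if $X/h_0\in\mathbb{Z}$ almost surely for some $h_0>0$. For $x\ge 0$ put $$H(x)=P[X>x]+P[X<-x],\qquad K(x)=P[X>x]-P[X<-x],\qquad A(x)=\int_0^x K(t)\,dt,$$ and $$r_+(x)=\int_x^{\infty}\frac{1-F(t)}{A(t)^2}\,dt\quad(x\ge 0),\qquad r_-(x)=\int_{|x|}^{\infty}\frac{F(-t)}{A(t)^2}\,dt\quad(x\in\mathbb{R}).$$ Theorem. Suppose that $E|X|=\infty$ and that (Ha) $\displaystyle \frac{A(x)}{xH(x)}\to\infty$ as $x\to\infty$. Then $F$ is transient if and only if (Hb) $\displaystyle \int_{x_0}^{\infty}\frac{H(x)}{A(x)^2}\,dx<\infty$ for some $x_0>0$. If $F$ is transient and non-arithmetic, then for each $h>0$,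 $$\frac{U((x,x+h])}{h}=r_+(x)\{1+o(1)\}\quad\text{as }x\to+\infty,$$ $$\frac{U((x,x+h])}{h}=r_-(x)+o\big(r_+(|x|)\big)\quad\text{as }x\to-\infty.$$ -/

import Mathlib

open MeasureTheory ProbabilityTheory Filter Asymptotics Topology
open scoped ENNReal

noncomputable section

namespace RelStableRenewal

/-- The `n`-fold convolution `F^{n*}` of a measure on `ℝ`: the law of `S_n = X_1 + ⋯ + X_n`
with `X_j` independent of law `F`, and `S_0 = 0`. -/
def convPow (F : Measure ℝ) : ℕ → Measure ℝ
  | 0 => Measure.dirac 0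
  | n + 1 => (convPow F n).conv F

/-- The renewal (Green) measure `U = ∑_{n ≥ 0} F^{n*}`, with values in `[0, ∞]`. -/
def renewalMeasure (F : Measure ℝ) : Measure ℝ :=
  Measure.sum (convPow F)

/-- `F` is transient if `U[-y, y] < ∞` for all `y > 0`. -/
def IsTransient (F : Measure ℝ) : Prop :=
  ∀ y : ℝ, 0 < y → renewalMeasure F (Set.Icc (-y) y) < ∞

/-- `F` is arithmetic if, for some `h₀ > 0`, `X / h₀` is almost surely an integer. -/
def IsArithmetic (F : Measure ℝ) : Prop :=
  ∃ h₀ : ℝ, 0 < h₀ ∧ ∀ᵐ x ∂F, ∃ k : ℤ, x / h₀ = k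

/-- `H(x) = 1 - F(x) + F(-x-0) = P[X > x] + P[X < -x]`. -/
def tailSum (F : Measure ℝ) (x : ℝ) : ℝ :=
  (1 - cdf F x) + F.real (Set.Iio (-x))

/-- `K(x) = 1 - F(x) - F(-x-0) = P[X > x] - P[X < -x]`. -/
def tailDiff (F : Measure ℝ) (x : ℝ) : ℝ :=
  (1 - cdf F x) - F.real (Set.Iio (-x))

/-- `A(x) = ∫_0^x K(t) dt`. -/
def truncMean (F : Measure ℝ) (x : ℝ) : ℝ :=
  ∫ t in (0 : ℝ)..x, tailDiff F t

/-- Condition (Ha): `A(x) / (x H(x)) → ∞` as `x → ∞`. -/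
def CondHa (F : Measure ℝ) : Prop :=
  Tendsto (fun x : ℝ => truncMean F x / (x * tailSum F x)) atTop atTop

/-- Condition (Hb): `∫_{x₀}^∞ H(x) / A(x)² dx < ∞` for some `x₀ > 0`. The integrand is taken
in `[0, ∞]`, so that it is `∞` wherever `A` vanishes and `H` does not. -/
def CondHb (F : Measure ℝ) : Prop :=
  ∃ x₀ : ℝ, 0 < x₀ ∧
    ∫⁻ x in Set.Ioi x₀, ENNReal.ofReal (tailSum F x) / ENNReal.ofReal (truncMean F x ^ 2) < ∞

/-- `r₊(x) = ∫_x^∞ (1 - F(t)) / A(t)² dt`. -/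
def rPlus (F : Measure ℝ) (x : ℝ) : ℝ :=
  ∫ t in Set.Ioi x, (1 - cdf F t) / truncMean F t ^ 2

/-- `r₋(x) = ∫_{|x|}^∞ F(-t) / A(t)² dt`. -/
def rMinus (F : Measure ℝ) (x : ℝ) : ℝ :=
  ∫ t in Set.Ioi |x|, cdf F (-t) / truncMean F t ^ 2

end RelStableRenewal

end

namespace RelStableRenewal

/-! ### Tails, the truncated mean and truncated moments. -/

section Tails

/-! Write φ for the characteristic function of F and R(x) = ∫_x^∞ H/A². By (Ha), |A'| = |K| ≤ H =
o(A(x)/x), so A is slowly varying, and E min(|X|, x)² = o(x A(x)). Hence 1 - φ(θ) ∼ -iθA(1/θ) as θ ↓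
0, with a real part of smaller order. That real part is recovered after integration: Re (1 - φ)⁻¹ ∼
(1 - Re φ(θ)) / (θA(1/θ))², and the substitution t = 1/θ with Tonelli turns the integral of the
latter over (0, 1/x) into E ∫_x^∞ (1 - cos(X/t)) A(t)⁻² dt. Since ∫_0^∞ (1 - cos(y/t)) dt = πy/2 and
A varies slowly, the inner integral is about (π/2) ∫_x^{|X|} A⁻² when |X| > x and negligible
otherwise. The outcome is π/2 · R(x), up to o(R(x)) + o(1/A(x)) (`CondHa.resolventMass_bounds`), so
(Hb) says that Re (1 - φ)⁻¹ is integrable at 0.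

Transience gives this integrability by testing U against a kernel whose transform is a triangle on
[-1, 1], with Abel summation and Fatou (`CondHa.condHb_of_isTransient`). Conversely, (Hb) and E|X| =
∞ force A → ∞, and then Fourier inversion holds for U smoothed by a Fejér kernel
(`CondHa.lintegral_fejer_renewal`), which bounds U on compact sets.

For the asymptotics the inversion integral at w is cut at θ = B/|w|. Above the cut, a shift by half
a period shows that the contribution is O(B^{-1/2}/A(|w|)) (`CondHa.norm_outer_integral_le`). Below
it, the cosine part yields (π/2) R(|w|) and the sine part yields ±(π/2)/A(|w|), the sign being that
of w (`CondHa.inner_integral_asymp`). Because A → ∞, 1/A(x) = ∫_x^∞ K/A², so (R + 1/A)/2 is r₊ and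
(R - 1/A)/2 is r₋: the two signs produce the two half-lines. All errors are o(1/A) or o(R), hence
o(r₊).

The smoothing is removed by letting the bandwidth a of the kernel grow. This is possible because r₊
and r₋ barely change under bounded shifts, and because for non-arithmetic F the function 1 - φ has
no zero other than 0. -/

lemma setIntegral_indicator_Iio (g : ℝ → ℝ) (a b Y : ℝ) :
    ∫ t in Set.Ioc a b, (Set.Iio Y).indicator g t = ∫ t in Set.Ioc a (min b Y), g t := by
  rw [setIntegral_indicator measurableSet_Iio]
  have h1 : (Set.Ioc a b ∩ Set.Iio Y : Set ℝ) =ᵐ[volume] (Set.Ioc a b ∩ Set.Iic Y : Set ℝ) :=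
    (ae_eq_refl _).inter Iio_ae_eq_Iic
  rw [setIntegral_congr_set h1, Set.Ioc_inter_Iic]

/-- Layer-cake formula for the expectation of an increasing function of a truncated variable. -/
lemma integral_layerCake (F : Measure ℝ) [IsProbabilityMeasure F] {Y g : ℝ → ℝ}
    (hY : Measurable Y) {a b : ℝ} (hg : IntegrableOn g (Set.Ioc a b)) :
    ∫ y, (∫ t in Set.Ioc a (min b (Y y)), g t) ∂F
      = ∫ t in Set.Ioc a b, g t * F.real {y | t < Y y} := by
  have hmeas : MeasurableSet {p : ℝ × ℝ | p.2 < Y p.1} :=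
    measurableSet_lt measurable_snd (hY.comp measurable_fst)
  have hint : Integrable (Function.uncurry fun y t => (Set.Iio (Y y)).indicator g t)
      (F.prod (volume.restrict (Set.Ioc a b))) := by
    have h1 : Integrable (fun p : ℝ × ℝ => g p.2) (F.prod (volume.restrict (Set.Ioc a b))) :=
      hg.integrable.comp_snd F
    exact h1.indicator hmeas
  simp_rw [← setIntegral_indicator_Iio g a b]
  rw [integral_integral_swap hint]
  refine integral_congr_ae (Eventually.of_forall fun t => ?_)
  have h2 : ∀ y, (Set.Iio (Y y)).indicator g t = {y | t < Y y}.indicator (fun _ => g t) y := by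
    intro y; simp [Set.indicator_apply]
  simp_rw [h2]
  rw [integral_indicator (measurableSet_lt measurable_const hY)]
  simp [mul_comm]

variable (F : Measure ℝ) [IsProbabilityMeasure F]

lemma one_sub_cdf (x : ℝ) : 1 - cdf F x = F.real (Set.Ioi x) := by
  rw [cdf_eq_real, ← Set.compl_Iic, measureReal_compl measurableSet_Iic]
  simp

lemma tailSum_eq {x : ℝ} (hx : 0 ≤ x) : tailSum F x = F.real {y | x < |y|} := by
  have : {y : ℝ | x < |y|} = Set.Ioi x ∪ Set.Iio (-x) := by
    ext y; simp only [Set.mem_ofPred_eq, lt_abs, Set.mem_union, Set.mem_Ioi, Set.mem_Iio]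
    constructor <;> rintro (h | h) <;> [left; right; left; right] <;> linarith
  rw [this, measureReal_union _ measurableSet_Iio, tailSum, one_sub_cdf]
  rw [Set.disjoint_left]; intro y hy hy'; simp only [Set.mem_Ioi, Set.mem_Iio] at *; linarith

lemma tailDiff_eq (x : ℝ) : tailDiff F x = F.real {y | x < y} - F.real {y | x < -y} := by
  have : Set.Iio (-x) = {y : ℝ | x < -y} := by ext y; simp [lt_neg]
  rw [tailDiff, one_sub_cdf, this]; rfl

lemma tailSum_nonneg (x : ℝ) : 0 ≤ tailSum F x := by
  rw [tailSum, one_sub_cdf]; positivity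

lemma tailSum_anti : Antitone (tailSum F) := by
  intro x y hxy
  rw [tailSum, tailSum, one_sub_cdf, one_sub_cdf]
  exact add_le_add (measureReal_mono (Set.Ioi_subset_Ioi hxy))
    (measureReal_mono (Set.Iio_subset_Iio (by linarith)))

lemma tailSum_le_one {x : ℝ} (hx : 0 ≤ x) : tailSum F x ≤ 1 := by
  rw [tailSum_eq F hx]; exact measureReal_le_one

lemma abs_tailDiff_le (x : ℝ) : |tailDiff F x| ≤ tailSum F x := by
  have h1 : 0 ≤ 1 - cdf F x := by rw [one_sub_cdf]; positivity
  have h2 : 0 ≤ F.real (Set.Iio (-x)) := by positivity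
  rw [tailDiff, tailSum, abs_le]; constructor <;> linarith

lemma measurable_tailSum : Measurable (tailSum F) := (tailSum_anti F).measurable

lemma antitone_one_sub_cdf : Antitone (fun x => 1 - cdf F x) := by
  intro x y hxy
  have := monotone_cdf F hxy
  simp only; linarith

lemma antitone_lower : Antitone (fun x => F.real (Set.Iio (-x))) := by
  intro x y hxy
  exact measureReal_mono (Set.Iio_subset_Iio (by linarith))

lemma measurable_tailDiff : Measurable (tailDiff F) :=
  (antitone_one_sub_cdf F).measurable.sub (antitone_lower F).measurable

lemma abs_tailDiff_le_one (x : ℝ) : |tailDiff F x| ≤ 1 := by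
  have h1 : 0 ≤ 1 - cdf F x := by rw [one_sub_cdf]; positivity
  have h2 : 0 ≤ F.real (Set.Iio (-x)) := by positivity
  have h3 : 1 - cdf F x ≤ 1 := by rw [one_sub_cdf]; exact measureReal_le_one
  have h4 : F.real (Set.Iio (-x)) ≤ 1 := measureReal_le_one
  rw [tailDiff, abs_le]; constructor <;> linarith

lemma intervalIntegrable_tailDiff (a b : ℝ) : IntervalIntegrable (tailDiff F) volume a b :=
  ((antitone_one_sub_cdf F).intervalIntegrable).sub ((antitone_lower F).intervalIntegrable)

lemma intervalIntegrable_tailSum (a b : ℝ) : IntervalIntegrable (tailSum F) volume a b :=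
  (tailSum_anti F).intervalIntegrable

lemma continuous_truncMean : Continuous (truncMean F) :=
  intervalIntegral.continuous_primitive (fun a b => intervalIntegrable_tailDiff F a b) 0

lemma truncMean_sub (a b : ℝ) : truncMean F b - truncMean F a = ∫ t in a..b, tailDiff F t :=
  intervalIntegral.integral_interval_sub_left (intervalIntegrable_tailDiff F _ _)
    (intervalIntegrable_tailDiff F _ _)

/-- The lower tail is one minus the distribution function of -X, so both tails are right continuous.
Atoms still make K jump, which is why A is differentiated only from the right. -/
lemma tailDiff_right_continuous (x : ℝ) :
    ContinuousWithinAt (tailDiff F) (Set.Ici x) x := by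
  have hG : ∀ x, F.real (Set.Iio (-x)) = 1 - cdf (F.map (fun y => -y)) x := by
    intro x
    have : IsProbabilityMeasure (F.map (fun y : ℝ => -y)) :=
      Measure.isProbabilityMeasure_map measurable_neg.aemeasurable
    rw [one_sub_cdf, map_measureReal_apply measurable_neg measurableSet_Ioi]
    congr 1; ext y; simp [lt_neg]
  have : tailDiff F = fun x => (1 - cdf F x) - (1 - cdf (F.map (fun y => -y)) x) := by
    ext x; rw [tailDiff, hG]
  rw [this]
  exact (continuousWithinAt_const.sub ((cdf F).right_continuous x)).sub
    (continuousWithinAt_const.sub ((cdf (F.map fun y => -y)).right_continuous x))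

lemma hasDerivWithinAt_truncMean (x : ℝ) :
    HasDerivWithinAt (truncMean F) (tailDiff F x) (Set.Ici x) x :=
  intervalIntegral.integral_hasDerivWithinAt_right (intervalIntegrable_tailDiff F 0 x)
    (s := Set.Ici x) (t := Set.Ioi x)
    ((measurable_tailDiff F).stronglyMeasurable.stronglyMeasurableAtFilter)
    ((tailDiff_right_continuous F x).mono Set.Ioi_subset_Ici_self)

/-- The truncated second moment `E[min(|X|, x)²]`. -/
noncomputable def truncSq (x : ℝ) : ℝ := ∫ y, (min x |y|) ^ 2 ∂F

/-- The truncated first absolute moment `E[min(|X|, x)]`. -/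
noncomputable def truncAbs (x : ℝ) : ℝ := ∫ y, min x |y| ∂F

lemma integrable_min_abs {x : ℝ} (hx : 0 ≤ x) : Integrable (fun y => min x |y|) F :=
  Integrable.of_bound (by fun_prop) x (Eventually.of_forall fun y => by
    rw [Real.norm_of_nonneg (le_min hx (abs_nonneg y))]; exact min_le_left _ _)

lemma integrable_min_abs_sq {x : ℝ} (hx : 0 ≤ x) : Integrable (fun y => (min x |y|) ^ 2) F :=
  Integrable.of_bound (by fun_prop) (x ^ 2) (Eventually.of_forall fun y => by
    rw [Real.norm_of_nonneg (by positivity)]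
    exact pow_le_pow_left₀ (le_min hx (abs_nonneg y)) (min_le_left _ _) 2)

lemma truncAbs_eq {x : ℝ} (hx : 0 ≤ x) : truncAbs F x = ∫ t in (0 : ℝ)..x, tailSum F t := by
  have h := integral_layerCake F (Y := fun y => |y|) (g := fun _ => 1) (by fun_prop) (a := 0)
    (b := x) (by simp)
  rw [truncAbs, intervalIntegral.integral_of_le hx]
  convert h using 1
  · refine integral_congr_ae (Eventually.of_forall fun y => ?_)
    have : 0 ≤ min x |y| := le_min hx (abs_nonneg y)
    simp [this]
  · refine setIntegral_congr_fun measurableSet_Ioc fun t ht => ?_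
    simp [tailSum_eq F ht.1.le]

lemma truncSq_eq {x : ℝ} (hx : 0 ≤ x) :
    truncSq F x = ∫ t in (0 : ℝ)..x, 2 * t * tailSum F t := by
  have h := integral_layerCake F (Y := fun y => |y|) (g := fun t => 2 * t) (by fun_prop) (a := 0)
    (b := x) (Continuous.integrableOn_Ioc (by fun_prop))
  rw [truncSq, intervalIntegral.integral_of_le hx]
  convert h using 1
  · refine integral_congr_ae (Eventually.of_forall fun y => ?_)
    have : 0 ≤ min x |y| := le_min hx (abs_nonneg y)
    simp only
    rw [← intervalIntegral.integral_of_le this, intervalIntegral.integral_const_mul, integral_id]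
    ring
  · refine setIntegral_congr_fun measurableSet_Ioc fun t ht => ?_
    simp [tailSum_eq F ht.1.le]

lemma integrable_clamp {x : ℝ} (hx : 0 ≤ x) : Integrable (fun y => max (-x) (min x y)) F :=
  Integrable.of_bound (by fun_prop) x (Eventually.of_forall fun y => by
    rw [Real.norm_eq_abs, abs_le]
    exact ⟨le_max_left _ _, max_le (by linarith) (min_le_left _ _)⟩)

/-- The layer-cake formula for the positive and the negative part of X. In this form A can be
compared with E sin(X/x), that is, with Im φ(1/x). -/
lemma truncMean_eq {x : ℝ} (hx : 0 ≤ x) : truncMean F x = ∫ y, max (-x) (min x y) ∂F := by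
  have h1 := integral_layerCake F (Y := fun y => y) (g := fun _ => 1) (by fun_prop) (a := 0)
    (b := x) (by simp)
  have h2 := integral_layerCake F (Y := fun y => -y) (g := fun _ => 1) (by fun_prop) (a := 0)
    (b := x) (by simp)
  have i1 : IntegrableOn (fun t => 1 * F.real {y | t < y}) (Set.Ioc 0 x) := by
    have : (fun t => 1 * F.real {y | t < y}) = fun t => 1 - cdf F t := by
      ext t; rw [one_sub_cdf, one_mul]; rfl
    rw [this]
    exact ((antitone_one_sub_cdf F).intervalIntegrable (a := 0) (b := x)).1
  have i2 : IntegrableOn (fun t => 1 * F.real {y | t < -y}) (Set.Ioc 0 x) := by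
    have : (fun t => 1 * F.real {y | t < -y}) = fun t => F.real (Set.Iio (-t)) := by
      ext t; rw [one_mul]; congr 1; ext y; simp [lt_neg]
    rw [this]
    exact ((antitone_lower F).intervalIntegrable (a := 0) (b := x)).1
  rw [truncMean, intervalIntegral.integral_of_le hx]
  simp_rw [tailDiff_eq]
  have h3 := integral_sub i1 i2
  simp only [one_mul] at h3 h1 h2
  rw [h3, ← h1, ← h2]
  have e : ∀ c : ℝ, ∫ t in Set.Ioc 0 c, (1 : ℝ) = max 0 c := by
    intro c; simp [Measure.real, ENNReal.toReal_ofReal', max_comm]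
  simp_rw [e]
  rw [← integral_sub]
  · refine integral_congr_ae (Eventually.of_forall fun y => ?_)
    simp only
    rcases le_total 0 y with hy | hy
    · have : min x (-y) ≤ 0 := le_trans (min_le_right _ _) (by linarith)
      have h4 : 0 ≤ min x y := le_min hx hy
      rw [max_eq_left this, max_eq_right h4, max_eq_right (by linarith)]; ring
    · have : min x y ≤ 0 := le_trans (min_le_right _ _) (by linarith)
      have h4 : 0 ≤ min x (-y) := le_min hx (by linarith)
      rw [max_eq_left this, max_eq_right h4, min_eq_right (a := x) (b := y) (by linarith)]
      rcases le_total x (-y) with h | h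
      · rw [min_eq_left h, max_eq_left (by linarith)]; ring
      · rw [min_eq_right h, max_eq_right (by linarith)]; ring
  · refine Integrable.of_bound (by fun_prop) x (Eventually.of_forall fun y => ?_)
    rw [Real.norm_of_nonneg (le_max_left _ _)]; exact max_le hx (min_le_left _ _)
  · refine Integrable.of_bound (by fun_prop) x (Eventually.of_forall fun y => ?_)
    rw [Real.norm_of_nonneg (le_max_left _ _)]; exact max_le hx (min_le_left _ _)

end Tails

end RelStableRenewal


namespace RelStableRenewal

/-! ### Consequences of (Ha): slow variation of A and size of the truncated moments. -/

section SlowVariation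

variable {F : Measure ℝ} [IsProbabilityMeasure F]

omit [IsProbabilityMeasure F] in
lemma CondHa.mul_tailSum_le [IsProbabilityMeasure F] (hHa : CondHa F) {η : ℝ} (hη : 0 < η) :
    ∃ x₀ : ℝ, 1 ≤ x₀ ∧ ∀ x, x₀ ≤ x → 0 < truncMean F x ∧ 0 < tailSum F x ∧
      x * tailSum F x ≤ η * truncMean F x := by
  obtain ⟨x₁, hx₁⟩ := eventually_atTop.1 (hHa.eventually_ge_atTop (1 / η))
  refine ⟨max 1 x₁, le_max_left _ _, fun x hx => ?_⟩
  have hx1 : 1 ≤ x := (le_max_left _ _).trans hx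
  have h := hx₁ x ((le_max_right _ _).trans hx)
  have hη' : 0 < 1 / η := by positivity
  have hH := tailSum_nonneg F x
  -- The quotient in (Ha) is 0 when H vanishes, so a large quotient also forces H > 0.
  have hne : x * tailSum F x ≠ 0 := by
    intro h0; rw [h0, div_zero] at h; linarith
  have hpos : 0 < x * tailSum F x := lt_of_le_of_ne (by positivity) (Ne.symm hne)
  have h2 : 1 / η * (x * tailSum F x) ≤ truncMean F x := (le_div_iff₀ hpos).1 h
  refine ⟨lt_of_lt_of_le (by positivity) h2, pos_of_mul_pos_right hpos (by linarith), ?_⟩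
  calc x * tailSum F x = η * (1 / η * (x * tailSum F x)) := by field_simp
    _ ≤ _ := by gcongr

/-- Potter bounds: |(log A)'| ≤ H/A ≤ η/t far out, and integration gives |log A(y) - log A(x)| ≤ η
log(y/x). The mean value inequality for right derivatives is needed because K jumps. -/
lemma CondHa.potter (hHa : CondHa F) {η : ℝ} (hη : 0 < η) :
    ∃ x₀ : ℝ, 1 ≤ x₀ ∧ (∀ x, x₀ ≤ x → 0 < truncMean F x) ∧
      ∀ x y, x₀ ≤ x → x ≤ y → truncMean F y ≤ (y / x) ^ η * truncMean F x ∧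
        truncMean F x ≤ (y / x) ^ η * truncMean F y := by
  obtain ⟨x₀, h1, h⟩ := hHa.mul_tailSum_le hη
  refine ⟨x₀, h1, fun x hx => (h x hx).1, fun x y hx hxy => ?_⟩
  have hxp : 0 < x := by linarith
  have hyp : 0 < y := by linarith
  have hA : ∀ t ∈ Set.Icc x y, 0 < truncMean F t := fun t ht => (h t (hx.trans ht.1)).1
  have hcont : ContinuousOn (fun t => Real.log (truncMean F t)) (Set.Icc x y) :=
    (continuous_truncMean F).continuousOn.log fun t ht => (hA t ht).ne'
  have hder : ∀ t ∈ Set.Ico x y, HasDerivWithinAt (fun t => Real.log (truncMean F t))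
      (tailDiff F t / truncMean F t) (Set.Ici t) t := fun t ht =>
    (hasDerivWithinAt_truncMean F t).log (hA t ⟨ht.1, ht.2.le⟩).ne'
  have hbd : ∀ t ∈ Set.Ico x y, |tailDiff F t / truncMean F t| ≤ η * t⁻¹ := by
    intro t ht
    have hAt := hA t ⟨ht.1, ht.2.le⟩
    have htp : 0 < t := hxp.trans_le ht.1
    rw [abs_div, abs_of_pos hAt, div_le_iff₀ hAt, mul_comm η, mul_assoc]
    refine (abs_tailDiff_le F t).trans ?_
    rw [inv_mul_eq_div, le_div_iff₀ htp, mul_comm]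
    exact (h t (hx.trans ht.1)).2.2
  have hBc : ContinuousOn (fun t => η * Real.log t - η * Real.log x) (Set.Icc x y) :=
    ((continuousOn_id.log fun t ht => (hxp.trans_le ht.1).ne').const_smul η).sub
      continuousOn_const
  have hBd : ∀ t ∈ Set.Ico x y, HasDerivWithinAt (fun t => η * Real.log t - η * Real.log x)
      (η * t⁻¹) (Set.Ici t) t := fun t ht =>
    (((Real.hasDerivAt_log (hxp.trans_le ht.1).ne').const_mul η).sub_const _).hasDerivWithinAt
  have hy : y ∈ Set.Icc x y := ⟨hxy, le_rfl⟩
  have hAx := hA x ⟨le_rfl, hxy⟩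
  have hAy := hA y hy
  have u1 := image_le_of_deriv_right_le_deriv_boundary
    (f := fun t => Real.log (truncMean F t) - Real.log (truncMean F x))
    (hcont.sub continuousOn_const) (fun t ht => (hder t ht).sub_const _)
    (by simp) hBc hBd (fun t ht => (le_abs_self _).trans (hbd t ht)) hy
  have u2 := image_le_of_deriv_right_le_deriv_boundary
    (f := fun t => -(Real.log (truncMean F t) - Real.log (truncMean F x)))
    (hcont.sub continuousOn_const).neg (fun t ht => ((hder t ht).sub_const _).neg)
    (by simp) hBc hBd (fun t ht => (neg_le_abs _).trans (hbd t ht)) hy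
  have e : (y / x) ^ η = Real.exp (η * Real.log y - η * Real.log x) := by
    rw [Real.rpow_def_of_pos (by positivity), Real.log_div hyp.ne' hxp.ne']; ring_nf
  rw [e]
  constructor
  · calc truncMean F y = Real.exp (Real.log (truncMean F y)) := (Real.exp_log hAy).symm
      _ ≤ Real.exp ((η * Real.log y - η * Real.log x) + Real.log (truncMean F x)) :=
        Real.exp_le_exp.2 (by linarith)
      _ = _ := by rw [Real.exp_add, Real.exp_log hAx]
  · calc truncMean F x = Real.exp (Real.log (truncMean F x)) := (Real.exp_log hAx).symm
      _ ≤ Real.exp ((η * Real.log y - η * Real.log x) + Real.log (truncMean F y)) :=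
        Real.exp_le_exp.2 (by linarith)
      _ = _ := by rw [Real.exp_add, Real.exp_log hAy]

/-- Bernoulli's inequality for the exponent 2κ ≤ 1 at the base u^(1/2). It trades a small exponent
for a small factor times a fixed power, which serves as an integrable weight later. -/
lemma rpow_sub_one_le {u κ : ℝ} (hu : 1 ≤ u) (hκ : 0 ≤ κ) (hκ' : κ ≤ 1 / 2) :
    u ^ κ - 1 ≤ 2 * κ * u ^ (1 / 2 : ℝ) := by
  have h1 : (1 : ℝ) ≤ u ^ (1 / 2 : ℝ) := Real.one_le_rpow hu (by norm_num)
  have h := rpow_one_add_le_one_add_mul_self (s := u ^ (1 / 2 : ℝ) - 1) (by linarith)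
    (p := 2 * κ) (by linarith) (by linarith)
  rw [add_sub_cancel, ← Real.rpow_mul (by linarith)] at h
  have e : (1 / 2 : ℝ) * (2 * κ) = κ := by ring
  rw [e] at h
  nlinarith

lemma abs_sub_one_le_of_rpow {u κ ρ : ℝ} (hu : 1 ≤ u) (hκ : 0 ≤ κ) (hκ' : κ ≤ 1 / 2)
    (h1 : ρ ≤ u ^ κ) (h2 : 1 ≤ u ^ κ * ρ) : |ρ - 1| ≤ 2 * κ * u ^ (1 / 2 : ℝ) := by
  have h := rpow_sub_one_le hu hκ hκ'
  have h3 : 1 ≤ u ^ κ := Real.one_le_rpow hu hκ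
  rw [abs_le]
  constructor
  · nlinarith [sq_nonneg (u ^ κ - 1)]
  · linarith

/-- Uniform two-sided slow variation of the truncated mean, for its first and second powers. -/
lemma CondHa.slowVariation (hHa : CondHa F) {ε : ℝ} (hε : 0 < ε) :
    ∃ x₀ : ℝ, 1 ≤ x₀ ∧ (∀ x, x₀ ≤ x → 0 < truncMean F x) ∧ ∀ s t, x₀ ≤ s → x₀ ≤ t →
      |truncMean F s / truncMean F t - 1| ≤ ε * ((s / t) ^ (1 / 2 : ℝ) + (t / s) ^ (1 / 2 : ℝ)) ∧
      |truncMean F s ^ 2 / truncMean F t ^ 2 - 1| ≤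
        ε * ((s / t) ^ (1 / 2 : ℝ) + (t / s) ^ (1 / 2 : ℝ)) := by
  -- For A² the exponent doubles to κ = 2η, which must stay below 1/2, and the resulting factor 2κ =
  -- 4η must stay below ε.
  set η := min (1 / 4) (ε / 4) with hηdef
  have hη : 0 < η := by positivity
  have hη1 : η ≤ 1 / 4 := min_le_left _ _
  have hη2 : η ≤ ε / 4 := min_le_right _ _
  obtain ⟨x₀, h1, hpos, h⟩ := hHa.potter hη
  refine ⟨x₀, h1, hpos, fun s t hs ht => ?_⟩
  have hsp : 0 < s := by linarith
  have htp : 0 < t := by linarith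
  have hAs := hpos s hs
  have hAt := hpos t ht
  have key : ∃ u : ℝ, 1 ≤ u ∧ u ^ (1 / 2 : ℝ) ≤ (s / t) ^ (1 / 2 : ℝ) + (t / s) ^ (1 / 2 : ℝ) ∧
      truncMean F s / truncMean F t ≤ u ^ η ∧
      1 ≤ u ^ η * (truncMean F s / truncMean F t) := by
    have n1 : 0 ≤ (s / t) ^ (1 / 2 : ℝ) := by positivity
    have n2 : 0 ≤ (t / s) ^ (1 / 2 : ℝ) := by positivity
    rcases le_total s t with hst | hst
    · refine ⟨t / s, (one_le_div hsp).2 hst, by linarith, ?_, ?_⟩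
      · rw [div_le_iff₀ hAt]; exact (h s t hs hst).2
      · rw [← mul_div_assoc, one_le_div hAt]; exact (h s t hs hst).1
    · refine ⟨s / t, (one_le_div htp).2 hst, by linarith, ?_, ?_⟩
      · rw [div_le_iff₀ hAt]; exact (h t s ht hst).1
      · rw [← mul_div_assoc, one_le_div hAt]; exact (h t s ht hst).2
  obtain ⟨u, hu1, hu2, hu3, hu4⟩ := key
  have hup : 0 ≤ u := by linarith
  have hρ : 0 < truncMean F s / truncMean F t := by positivity
  have n3 : 0 ≤ u ^ (1 / 2 : ℝ) := by positivity
  constructor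
  · refine (abs_sub_one_le_of_rpow hu1 hη.le (by linarith) hu3 hu4).trans ?_
    exact mul_le_mul (by linarith) hu2 n3 hε.le
  · rw [← div_pow]
    have e : u ^ (2 * η) = (u ^ η) ^ 2 := by
      rw [← Real.rpow_natCast, ← Real.rpow_mul hup]; congr 1; push_cast; ring
    refine (abs_sub_one_le_of_rpow hu1 (κ := 2 * η) (by linarith) (by linarith) ?_ ?_).trans ?_
    · rw [e]; exact pow_le_pow_left₀ hρ.le hu3 2
    · rw [e, ← mul_pow]; exact one_le_pow₀ hu4
    · exact mul_le_mul (by linarith) hu2 n3 hε.le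

/-- A form of Potter's bounds with the fixed exponent `1 / 4`, together with the bound on `H`. -/
lemma CondHa.potter_quarter (hHa : CondHa F) :
    ∃ x₀ : ℝ, 1 ≤ x₀ ∧ (∀ x, x₀ ≤ x → 0 < truncMean F x ∧ 0 < tailSum F x ∧
        x * tailSum F x ≤ truncMean F x) ∧
      ∀ x y, x₀ ≤ x → x ≤ y → truncMean F y ≤ (y / x) ^ (1 / 4 : ℝ) * truncMean F x ∧
        truncMean F x ≤ (y / x) ^ (1 / 4 : ℝ) * truncMean F y := by
  obtain ⟨a, ha, h1⟩ := hHa.mul_tailSum_le one_pos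
  obtain ⟨b, hb, h2, h3⟩ := hHa.potter (η := 1 / 4) (by norm_num)
  refine ⟨max a b, ha.trans (le_max_left _ _), fun x hx => ?_, fun x y hx hxy => ?_⟩
  · simpa using h1 x ((le_max_left _ _).trans hx)
  · exact h3 x y ((le_max_right _ _).trans hx) hxy

/-- From s H(s) ≤ A(s) ≤ (s/t)^(1/4) A(t) the integrand is at most A(t) t^(-1/4) s^(-3/4);
integrating the power produces the factor 4. -/
lemma integral_tailSum_le_of_potter {x₀ : ℝ} (h1 : 1 ≤ x₀)
    (hH : ∀ x, x₀ ≤ x → 0 < truncMean F x ∧ 0 < tailSum F x ∧ x * tailSum F x ≤ truncMean F x)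
    (hP : ∀ x y, x₀ ≤ x → x ≤ y → truncMean F y ≤ (y / x) ^ (1 / 4 : ℝ) * truncMean F x ∧
        truncMean F x ≤ (y / x) ^ (1 / 4 : ℝ) * truncMean F y) {t x : ℝ} (ht : x₀ ≤ t)
    (htx : t ≤ x) :
    ∫ s in t..x, tailSum F s ≤ 4 * (truncMean F t * (x / t) ^ (1 / 4 : ℝ)) := by
  have htp : 0 < t := by linarith
  have hxp : 0 < x := by linarith
  have hb : ∀ s ∈ Set.Icc t x,
      tailSum F s ≤ truncMean F t * t ^ (-(1 / 4) : ℝ) * s ^ (-(3 / 4) : ℝ) := by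
    intro s hs
    have hsp : 0 < s := by linarith [hs.1]
    have e1 := (hH s (ht.trans hs.1)).2.2
    have e2 := (hP t s ht hs.1).1
    have e3 : tailSum F s ≤ (s / t) ^ (1 / 4 : ℝ) * truncMean F t / s := by
      rw [le_div_iff₀ hsp]; linarith
    refine e3.trans (le_of_eq ?_)
    rw [Real.div_rpow hsp.le htp.le, Real.rpow_neg htp.le]
    have : s ^ (-(3 / 4) : ℝ) = s ^ (1 / 4 : ℝ) / s := by
      rw [← Real.rpow_sub_one hsp.ne']; norm_num
    rw [this]; field_simp
  have hi : IntervalIntegrable (fun s : ℝ => s ^ (-(3 / 4) : ℝ)) volume t x :=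
    intervalIntegral.intervalIntegrable_rpow' (by norm_num)
  refine (intervalIntegral.integral_mono_on htx (intervalIntegrable_tailSum F _ _)
    (hi.const_mul _) hb).trans ?_
  rw [intervalIntegral.integral_const_mul, integral_rpow (Or.inl (by norm_num))]
  have hA := (hH t ht).1
  have e : (-(3 / 4) + 1 : ℝ) = 1 / 4 := by norm_num
  rw [e, Real.div_rpow hxp.le htp.le, Real.rpow_neg htp.le]
  have h4 : 0 < t ^ (1 / 4 : ℝ) := by positivity
  rw [div_eq_mul_inv _ (1 / 4 : ℝ), ← sub_nonneg]
  field_simp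
  nlinarith

/-- Crude power bounds on A, E min(|X|, x) and 1/A. They suffice at frequencies away from 0, where
only compactness is available. -/
lemma CondHa.truncMean_le_rpow (hHa : CondHa F) :
    ∃ C x₀ : ℝ, 0 < C ∧ 1 ≤ x₀ ∧ ∀ x, x₀ ≤ x → 0 < truncMean F x ∧
      truncMean F x ≤ C * x ^ (1 / 4 : ℝ) ∧ truncAbs F x ≤ C * x ^ (1 / 4 : ℝ) ∧
      1 ≤ C * x ^ (1 / 4 : ℝ) * truncMean F x := by
  obtain ⟨x₀, h1, hH, hP⟩ := hHa.potter_quarter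
  have hA := (hH x₀ le_rfl).1
  set A₀ := truncMean F x₀
  refine ⟨A₀ + (x₀ + 4 * A₀) + A₀⁻¹, x₀, by positivity, h1, fun x hx => ?_⟩
  have hx0 : 0 < x₀ := by linarith
  have hxp : 0 < x := by linarith
  have hx1 : 1 ≤ x ^ (1 / 4 : ℝ) := Real.one_le_rpow (h1.trans hx) (by norm_num)
  have hq : (x / x₀) ^ (1 / 4 : ℝ) ≤ x ^ (1 / 4 : ℝ) :=
    Real.rpow_le_rpow (by positivity) (div_le_self hxp.le h1) (by norm_num)
  have hAinv : 0 < A₀⁻¹ := by positivity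
  obtain ⟨p1, p2⟩ := hP x₀ x le_rfl hx
  have hAx := (hH x hx).1
  refine ⟨hAx, ?_, ?_, ?_⟩
  · calc truncMean F x ≤ (x / x₀) ^ (1 / 4 : ℝ) * A₀ := p1
      _ ≤ x ^ (1 / 4 : ℝ) * A₀ := by gcongr
      _ ≤ _ := by nlinarith
  · rw [truncAbs_eq F hxp.le, ← intervalIntegral.integral_add_adjacent_intervals
      (intervalIntegrable_tailSum F 0 x₀) (intervalIntegrable_tailSum F x₀ x)]
    have q1 := integral_tailSum_le_of_potter h1 hH hP le_rfl hx
    have q2 : ∫ s in (0 : ℝ)..x₀, tailSum F s ≤ ∫ s in (0 : ℝ)..x₀, (1 : ℝ) :=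
      intervalIntegral.integral_mono_on hx0.le (intervalIntegrable_tailSum F _ _)
        (by simp) fun s hs => tailSum_le_one F hs.1
    simp only [intervalIntegral.integral_const, sub_zero, smul_eq_mul, mul_one] at q2
    have q3 : A₀ * (x / x₀) ^ (1 / 4 : ℝ) ≤ A₀ * x ^ (1 / 4 : ℝ) := by gcongr
    nlinarith
  · have : 1 ≤ A₀⁻¹ * x ^ (1 / 4 : ℝ) * truncMean F x := by
      rw [mul_assoc, inv_mul_eq_div, one_le_div hA]
      exact p2.trans (by gcongr)
    refine this.trans ?_
    gcongr
    linarith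

/-- The truncated second moment is negligible with respect to `x A(x)`. -/
lemma CondHa.truncSq_le (hHa : CondHa F) {ε : ℝ} (hε : 0 < ε) :
    ∃ x₀ : ℝ, 1 ≤ x₀ ∧ ∀ x, x₀ ≤ x → truncSq F x ≤ ε * x * truncMean F x := by
  obtain ⟨a, ha, h1⟩ := hHa.mul_tailSum_le (η := ε / 8) (by positivity)
  obtain ⟨b, hb, h2, hP⟩ := hHa.potter (η := 1 / 2) (by norm_num)
  obtain ⟨C, c, hC, hc, h3⟩ := hHa.truncMean_le_rpow
  set m := max a b with hm
  have hma : a ≤ m := le_max_left _ _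
  have hmb : b ≤ m := le_max_right _ _
  have hm1 : 1 ≤ m := ha.trans hma
  have hlim : Tendsto (fun x : ℝ => x ^ (3 / 4 : ℝ)) atTop atTop :=
    tendsto_rpow_atTop (by norm_num)
  obtain ⟨d, hd⟩ := eventually_atTop.1 (hlim.eventually_ge_atTop (2 * C * m ^ 2 / ε))
  refine ⟨max (max m c) d, hm1.trans ((le_max_left _ _).trans (le_max_left _ _)), fun x hx => ?_⟩
  have hxm : m ≤ x := ((le_max_left _ _).trans (le_max_left _ _)).trans hx
  have hxc : c ≤ x := ((le_max_right _ _).trans (le_max_left _ _)).trans hx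
  have hxd : d ≤ x := (le_max_right _ _).trans hx
  have hm0 : 0 < m := by linarith
  have hxp : 0 < x := by linarith
  obtain ⟨hAx, -, -, h4⟩ := h3 x hxc
  have hi : ∀ u v, IntervalIntegrable (fun t => 2 * t * tailSum F t) volume u v := fun u v =>
    (intervalIntegrable_tailSum F u v).continuousOn_mul (by fun_prop)
  rw [truncSq_eq F hxp.le, ← intervalIntegral.integral_add_adjacent_intervals (hi 0 m) (hi m x)]
  have q1 : ∫ t in (0 : ℝ)..m, 2 * t * tailSum F t ≤ ∫ t in (0 : ℝ)..m, 2 * t := by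
    refine intervalIntegral.integral_mono_on hm0.le (hi _ _)
      (Continuous.intervalIntegrable (by fun_prop) _ _) fun s hs => ?_
    nlinarith [tailSum_le_one F hs.1, hs.1, tailSum_nonneg F s]
  rw [intervalIntegral.integral_const_mul, integral_id] at q1
  have hir : IntervalIntegrable (fun s : ℝ => s ^ (-(1 / 2) : ℝ)) volume m x :=
    intervalIntegral.intervalIntegrable_rpow' (by norm_num)
  -- Here 2tH(t) ≤ (ε/4) A(t) and A(t) ≤ (x/t)^(1/2) A(x), so this range contributes at most (ε/2) x
  -- A(x).
  have q2 : ∫ t in m..x, 2 * t * tailSum F t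
      ≤ ∫ t in m..x, (ε / 4 * truncMean F x * x ^ (1 / 2 : ℝ)) * t ^ (-(1 / 2) : ℝ) := by
    refine intervalIntegral.integral_mono_on hxm (hi _ _) (hir.const_mul _) fun t ht => ?_
    have htp : 0 < t := by linarith [ht.1]
    have e1 := (h1 t (hma.trans ht.1)).2.2
    have e2 := (hP t x (hmb.trans ht.1) ht.2).2
    rw [Real.div_rpow hxp.le htp.le] at e2
    rw [Real.rpow_neg htp.le]
    calc 2 * t * tailSum F t ≤ ε / 4 * truncMean F t := by linarith
      _ ≤ ε / 4 * (x ^ (1 / 2 : ℝ) / t ^ (1 / 2 : ℝ) * truncMean F x) := by gcongr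
      _ = _ := by ring
  rw [intervalIntegral.integral_const_mul, integral_rpow (Or.inl (by norm_num))] at q2
  have e : (-(1 / 2) + 1 : ℝ) = 1 / 2 := by norm_num
  rw [e] at q2
  have e5 : x ^ (1 / 2 : ℝ) * x ^ (1 / 2 : ℝ) = x := by
    rw [← Real.rpow_add hxp]; norm_num
  have hmr : 0 ≤ m ^ (1 / 2 : ℝ) := by positivity
  have hxr : 0 ≤ x ^ (1 / 2 : ℝ) := by positivity
  have q3 : ε / 4 * truncMean F x * x ^ (1 / 2 : ℝ) *
      ((x ^ (1 / 2 : ℝ) - m ^ (1 / 2 : ℝ)) / (1 / 2)) ≤ ε / 2 * x * truncMean F x := by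
    have : ε / 4 * truncMean F x * x ^ (1 / 2 : ℝ) *
      ((x ^ (1 / 2 : ℝ) - m ^ (1 / 2 : ℝ)) / (1 / 2)) =
      ε / 2 * truncMean F x * (x ^ (1 / 2 : ℝ) * x ^ (1 / 2 : ℝ)) -
      ε / 2 * truncMean F x * x ^ (1 / 2 : ℝ) * m ^ (1 / 2 : ℝ) := by ring
    rw [this, e5]
    have : 0 ≤ ε / 2 * truncMean F x * x ^ (1 / 2 : ℝ) * m ^ (1 / 2 : ℝ) := by positivity
    linarith
  -- The fixed initial range is absorbed because x A(x) ≥ x^(3/4)/C tends to infinity.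
  have q4 : m ^ 2 ≤ ε / 2 * x * truncMean F x := by
    have e6 := hd x hxd
    have e7 : x ^ (3 / 4 : ℝ) * x ^ (1 / 4 : ℝ) = x := by
      rw [← Real.rpow_add hxp]; norm_num
    rw [div_le_iff₀ hε] at e6
    have : C * m ^ 2 ≤ C * (ε / 2 * x * truncMean F x) := by
      calc C * m ^ 2 ≤ C * m ^ 2 * (C * x ^ (1 / 4 : ℝ) * truncMean F x) :=
            le_mul_of_one_le_right (by positivity) h4
        _ = (2 * C * m ^ 2) * (C * x ^ (1 / 4 : ℝ) * truncMean F x) / 2 := by ring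
        _ ≤ (x ^ (3 / 4 : ℝ) * ε) * (C * x ^ (1 / 4 : ℝ) * truncMean F x) / 2 := by gcongr
        _ = C * (ε / 2 * (x ^ (3 / 4 : ℝ) * x ^ (1 / 4 : ℝ)) * truncMean F x) := by ring
        _ = _ := by rw [e7]
    exact le_of_mul_le_mul_left this hC
  linarith

end SlowVariation

end RelStableRenewal


namespace RelStableRenewal

/-! ### The characteristic function near the origin. -/

section CharFun

variable (F : Measure ℝ) [IsProbabilityMeasure F]

lemma norm_exp_mul_I_sub_one_le (v : ℝ) : ‖Complex.exp (v * Complex.I) - 1‖ ≤ min |v| 2 := by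
  refine le_min ?_ ?_
  · rw [mul_comm]; exact Real.norm_exp_I_mul_ofReal_sub_one_le
  · refine (norm_sub_le _ _).trans ?_
    rw [Complex.norm_exp_ofReal_mul_I]; norm_num

lemma one_sub_cos_le (u : ℝ) : 1 - Real.cos u ≤ 2 * (min 1 |u|) ^ 2 := by
  rcases le_total 1 |u| with h | h
  · rw [min_eq_left h]; linarith [Real.neg_one_le_cos u]
  · rw [min_eq_right h, sq_abs]; nlinarith [Real.one_sub_sq_div_two_le_cos (x := u), sq_nonneg u]

/-- The sine agrees with the clamp to [-1, 1] up to second order, so after scaling Im φ(1/x) differs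
from A(x)/x by a multiple of the truncated second moment, which is negligible. -/
lemma abs_sin_sub_clamp_le (u : ℝ) :
    |Real.sin u - max (-1) (min 1 u)| ≤ 2 * (min 1 |u|) ^ 2 := by
  wlog hu : 0 ≤ u generalizing u
  · have h := this (-u) (by linarith)
    rw [abs_neg, Real.sin_neg] at h
    rw [← abs_neg]
    convert h using 2
    have : max (-1 : ℝ) (min 1 (-u)) = - max (-1) (min 1 u) := by
      rw [← min_neg_neg, neg_neg, ← max_neg_neg, min_max_distrib_left]
      norm_num
    rw [this]; ring
  rw [abs_of_nonneg hu]
  rcases le_total 1 u with h | h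
  · rw [min_eq_left h, max_eq_right (by norm_num), abs_le]
    constructor <;> nlinarith [Real.neg_one_le_sin u, Real.sin_le_one u]
  · rw [min_eq_right h, max_eq_right (by linarith)]
    rcases hu.eq_or_lt with rfl | hu'
    · simp
    rw [abs_le]
    have h1 := Real.sin_gt_sub_cube hu'
    have h0 : 0 ≤ u ^ 3 := by positivity
    have h2 := Real.sin_lt hu'
    have h3 : u ^ 3 ≤ u ^ 2 := by nlinarith [sq_nonneg u]
    constructor <;> nlinarith [sq_nonneg u]

lemma integrable_exp_mul_I (θ : ℝ) : Integrable (fun y : ℝ => Complex.exp (θ * y * Complex.I)) F :=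
  Integrable.of_bound (by fun_prop) 1 (Eventually.of_forall fun y => by
    rw [← Complex.ofReal_mul, Complex.norm_exp_ofReal_mul_I])

lemma re_charFun (θ : ℝ) : (charFun F θ).re = ∫ y, Real.cos (θ * y) ∂F := by
  rw [charFun_apply_real, ← RCLike.re_eq_complex_re, ← integral_re (integrable_exp_mul_I F θ)]
  refine integral_congr_ae (Eventually.of_forall fun y => ?_)
  simp only [RCLike.re_eq_complex_re]
  rw [← Complex.ofReal_mul, Complex.exp_ofReal_mul_I_re]

lemma im_charFun (θ : ℝ) : (charFun F θ).im = ∫ y, Real.sin (θ * y) ∂F := by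
  rw [charFun_apply_real, ← RCLike.im_eq_complex_im, ← integral_im (integrable_exp_mul_I F θ)]
  refine integral_congr_ae (Eventually.of_forall fun y => ?_)
  simp only [RCLike.im_eq_complex_im]
  rw [← Complex.ofReal_mul, Complex.exp_ofReal_mul_I_im]

lemma integrable_cos_mul (θ : ℝ) : Integrable (fun y => Real.cos (θ * y)) F :=
  Integrable.of_bound (by fun_prop) 1 (Eventually.of_forall fun y => Real.abs_cos_le_one _)

lemma integrable_sin_mul (θ : ℝ) : Integrable (fun y => Real.sin (θ * y)) F :=
  Integrable.of_bound (by fun_prop) 1 (Eventually.of_forall fun y => Real.abs_sin_le_one _)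

lemma one_sub_re_charFun (θ : ℝ) :
    1 - (charFun F θ).re = ∫ y, (1 - Real.cos (θ * y)) ∂F := by
  rw [integral_sub (integrable_const _) (integrable_cos_mul F θ), re_charFun]; simp

lemma one_sub_re_charFun_nonneg (θ : ℝ) : 0 ≤ 1 - (charFun F θ).re := by
  rw [one_sub_re_charFun]
  exact integral_nonneg fun y => by simp only [Pi.zero_apply]; linarith [Real.cos_le_one (θ * y)]

lemma min_one_abs_inv_mul {x : ℝ} (hx : 0 < x) (y : ℝ) : min 1 |x⁻¹ * y| = x⁻¹ * min x |y| := by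
  rw [abs_mul, abs_of_pos (inv_pos.2 hx), mul_min_of_nonneg _ _ (inv_pos.2 hx).le,
    inv_mul_cancel₀ hx.ne']

lemma one_sub_re_charFun_le {x : ℝ} (hx : 0 < x) :
    1 - (charFun F x⁻¹).re ≤ 2 * truncSq F x / x ^ 2 := by
  rw [one_sub_re_charFun]
  have : 2 * truncSq F x / x ^ 2 = ∫ y, 2 / x ^ 2 * (min x |y|) ^ 2 ∂F := by
    rw [integral_const_mul, truncSq]; ring
  rw [this]
  refine integral_mono ((integrable_const _).sub (integrable_cos_mul F _))
    ((integrable_min_abs_sq F hx.le).const_mul _) fun y => ?_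
  simp only
  refine (one_sub_cos_le _).trans (le_of_eq ?_)
  rw [min_one_abs_inv_mul hx]; field_simp

lemma abs_im_charFun_sub_le {x : ℝ} (hx : 0 < x) :
    |x * (charFun F x⁻¹).im - truncMean F x| ≤ 2 * truncSq F x / x := by
  rw [im_charFun, truncMean_eq F hx.le, ← integral_const_mul,
    ← integral_sub ((integrable_sin_mul F _).const_mul _) (integrable_clamp F hx.le)]
  have : 2 * truncSq F x / x = ∫ y, 2 / x * (min x |y|) ^ 2 ∂F := by
    rw [integral_const_mul, truncSq]; ring
  rw [this, ← Real.norm_eq_abs]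
  refine norm_integral_le_of_norm_le ((integrable_min_abs_sq F hx.le).const_mul _)
    (Eventually.of_forall fun y => ?_)
  have h := abs_sin_sub_clamp_le (x⁻¹ * y)
  rw [min_one_abs_inv_mul hx] at h
  have e : max (-x) (min x y) = x * max (-1) (min 1 (x⁻¹ * y)) := by
    rw [mul_max_of_nonneg _ _ hx.le, mul_min_of_nonneg _ _ hx.le, mul_inv_cancel_left₀ hx.ne']
    simp
  rw [e, ← mul_sub, norm_mul, Real.norm_of_nonneg hx.le, Real.norm_eq_abs]
  calc x * |Real.sin (x⁻¹ * y) - max (-1) (min 1 (x⁻¹ * y))|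
      ≤ x * (2 * (x⁻¹ * min x |y|) ^ 2) := by gcongr
    _ = _ := by field_simp

lemma charFun_add_sub (θ h : ℝ) : charFun F (θ + h) - charFun F θ =
    ∫ y, Complex.exp (θ * y * Complex.I) * (Complex.exp (h * y * Complex.I) - 1) ∂F := by
  rw [charFun_apply_real, charFun_apply_real,
    ← integral_sub (integrable_exp_mul_I F _) (integrable_exp_mul_I F _)]
  refine integral_congr_ae (Eventually.of_forall fun y => ?_)
  simp only
  rw [mul_sub, ← Complex.exp_add]
  push_cast
  ring_nf

lemma min_mul_two_le {h : ℝ} (hh : 0 < h) (y : ℝ) : min |h * y| 2 ≤ 2 * h * min h⁻¹ |y| := by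
  have : 2 * h * min h⁻¹ |y| = 2 * min 1 |h * y| := by
    have := min_one_abs_inv_mul (inv_pos.2 hh) y
    rw [inv_inv] at this
    rw [this]; ring
  rw [this]
  rcases le_total 1 |h * y| with h1 | h1
  · rw [min_eq_left h1]; simp
  · rw [min_eq_right h1]; exact (min_le_left _ _).trans (by linarith [abs_nonneg (h * y)])

lemma norm_charFun_add_sub_le (θ : ℝ) {h : ℝ} (hh : 0 < h) :
    ‖charFun F (θ + h) - charFun F θ‖ ≤ 2 * h * truncAbs F h⁻¹ := by
  rw [charFun_add_sub, truncAbs, ← integral_const_mul]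
  refine norm_integral_le_of_norm_le ((integrable_min_abs F (inv_pos.2 hh).le).const_mul _)
    (Eventually.of_forall fun y => ?_)
  rw [norm_mul, ← Complex.ofReal_mul, ← Complex.ofReal_mul, Complex.norm_exp_ofReal_mul_I, one_mul]
  exact (norm_exp_mul_I_sub_one_le _).trans (min_mul_two_le hh y)

/-- For |y| ≤ t the increment is ihy up to second order; for |y| > t it is bounded by min(h|y|, 2).
Subtracting the clamp before taking norms makes hA(t) the main term of the increment of φ, instead
of h E min(|X|, 1/h), which (Ha) does not bound by a multiple of hA. -/
lemma norm_increment_sub_clamp_le {t h : ℝ} (ht : 0 < t) (hh : 0 < h) (hth : h * t ≤ 1) (y : ℝ) :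
    ‖Complex.exp ((t⁻¹ : ℝ) * y * Complex.I) * (Complex.exp (h * y * Complex.I) - 1)
        - Complex.I * h * (max (-t) (min t y) : ℝ)‖
      ≤ 3 * h * ((min t |y|) ^ 2 / t + (min h⁻¹ |y| - min t |y|)) := by
  have hth' : t ≤ h⁻¹ := by rw [le_inv_comm₀ ht hh]; rwa [← one_div, le_div_iff₀ ht]
  rcases le_total |y| t with hy | hy
  · have hy' := abs_le.1 hy
    rw [min_eq_right hy'.2, max_eq_right hy'.1, min_eq_right hy, min_eq_right (hy.trans hth')]
    have e : Complex.exp ((t⁻¹ : ℝ) * y * Complex.I) * (Complex.exp (h * y * Complex.I) - 1)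
        - Complex.I * h * y =
        Complex.exp ((t⁻¹ * y : ℝ) * Complex.I) *
          (Complex.exp ((h * y : ℝ) * Complex.I) - 1 - (h * y : ℝ) * Complex.I)
        + (h * y : ℝ) * Complex.I * (Complex.exp ((t⁻¹ * y : ℝ) * Complex.I) - 1) := by
      push_cast; ring
    rw [e]
    refine (norm_add_le _ _).trans ?_
    have hn : ‖((h * y : ℝ) : ℂ) * Complex.I‖ = h * |y| := by
      rw [norm_mul, Complex.norm_I, mul_one, Complex.norm_real, Real.norm_eq_abs, abs_mul,
        abs_of_pos hh]
    have hle : h * |y| ≤ 1 := (mul_le_mul_of_nonneg_left hy hh.le).trans hth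
    have h1 := Complex.norm_exp_sub_one_sub_id_le (x := ((h * y : ℝ) : ℂ) * Complex.I)
      (by rw [hn]; exact hle)
    have h2 := (norm_exp_mul_I_sub_one_le (t⁻¹ * y)).trans (min_le_left _ _)
    rw [abs_mul, abs_of_pos (inv_pos.2 ht)] at h2
    rw [norm_mul, norm_mul, Complex.norm_exp_ofReal_mul_I, one_mul, hn]
    rw [hn] at h1
    have h3 : h * |y| * (h * |y|) ≤ h * |y| * (t⁻¹ * |y|) := by
      gcongr
      rw [← one_div, le_div_iff₀ ht]; exact hth
    have h4 : 0 ≤ h * |y| * (t⁻¹ * |y|) := by positivity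
    have h5 : 3 * h * (|y| ^ 2 / t + (|y| - |y|)) = 3 * (h * |y| * (t⁻¹ * |y|)) := by
      field_simp; ring
    rw [h5]
    have h6 : h * |y| * ‖Complex.exp (((t⁻¹ * y : ℝ) : ℂ) * Complex.I) - 1‖
      ≤ h * |y| * (t⁻¹ * |y|) := by gcongr
    nlinarith
  · rw [min_eq_left hy]
    have e : t ^ 2 / t + (min h⁻¹ |y| - t) = min h⁻¹ |y| := by field_simp; ring
    rw [e]
    refine (norm_sub_le _ _).trans ?_
    have hm : t ≤ min h⁻¹ |y| := le_min hth' hy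
    have h1 := (norm_exp_mul_I_sub_one_le (h * y)).trans (min_mul_two_le hh y)
    rw [norm_mul, ← Complex.ofReal_mul, ← Complex.ofReal_mul, Complex.norm_exp_ofReal_mul_I,
      one_mul, norm_mul, norm_mul, Complex.norm_I, one_mul, Complex.norm_real, Complex.norm_real,
      Real.norm_of_nonneg hh.le, Real.norm_eq_abs]
    have h2 : |max (-t) (min t y)| ≤ t :=
      abs_le.2 ⟨le_max_left _ _, max_le (by linarith) (min_le_left _ _)⟩
    have h3 : h * |max (-t) (min t y)| ≤ h * min h⁻¹ |y| := by gcongr; exact h2.trans hm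
    linarith

lemma norm_charFun_inv_add_sub_le {t h : ℝ} (ht : 0 < t) (hh : 0 < h) (hth : h * t ≤ 1) :
    ‖charFun F (t⁻¹ + h) - charFun F t⁻¹‖ ≤
      h * (|truncMean F t| + 3 * (truncSq F t / t + ∫ s in t..h⁻¹, tailSum F s)) := by
  have hi : 0 < h⁻¹ := inv_pos.2 hh
  have e : charFun F (t⁻¹ + h) - charFun F t⁻¹ =
      (∫ y, (Complex.exp ((t⁻¹ : ℝ) * y * Complex.I) * (Complex.exp (h * y * Complex.I) - 1)
        - Complex.I * h * (max (-t) (min t y) : ℝ)) ∂F) + Complex.I * h * truncMean F t := by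
    rw [integral_sub, ← charFun_add_sub, integral_const_mul, integral_complex_ofReal,
      ← truncMean_eq F ht.le]
    · ring
    · refine Integrable.of_bound (by fun_prop) 2 (Eventually.of_forall fun y => ?_)
      rw [norm_mul, ← Complex.ofReal_mul, ← Complex.ofReal_mul, Complex.norm_exp_ofReal_mul_I,
        one_mul]
      exact (norm_exp_mul_I_sub_one_le _).trans (min_le_right _ _)
    · exact (integrable_clamp F ht.le).ofReal.const_mul _
  rw [e]
  refine (norm_add_le _ _).trans ?_
  have h1 : ‖Complex.I * h * truncMean F t‖ = h * |truncMean F t| := by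
    rw [norm_mul, norm_mul, Complex.norm_I, one_mul, Complex.norm_real, Complex.norm_real,
      Real.norm_of_nonneg hh.le, Real.norm_eq_abs]
  have i1 := (integrable_min_abs_sq F ht.le).div_const t
  have i2 := (integrable_min_abs F hi.le).sub (integrable_min_abs F ht.le)
  have h2 := norm_integral_le_of_norm_le ((i1.add i2).const_mul (3 * h))
    (Eventually.of_forall fun y => norm_increment_sub_clamp_le ht hh hth y)
  have i3 : ∫ s in t..h⁻¹, tailSum F s = truncAbs F h⁻¹ - truncAbs F t := by
    rw [truncAbs_eq F hi.le, truncAbs_eq F ht.le, intervalIntegral.integral_interval_sub_left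
      (intervalIntegrable_tailSum F _ _) (intervalIntegrable_tailSum F _ _)]
  have h3 : ∫ y, 3 * h * (((min t |y|) ^ 2 / t + (min h⁻¹ |y| - min t |y|))) ∂F =
      3 * h * (truncSq F t / t + ∫ s in t..h⁻¹, tailSum F s) := by
    rw [integral_const_mul]
    have := integral_add i1 i2
    simp only [Pi.sub_apply] at this
    rw [this, integral_div, integral_sub (integrable_min_abs F hi.le)
      (integrable_min_abs F ht.le), i3]
    rfl
  rw [h1]
  refine (add_le_add_left (h2.trans_eq h3) _).trans (le_of_eq ?_)
  ring

variable {F}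

/-- Modulus of continuity of the characteristic function, close to the origin. -/
lemma CondHa.norm_charFun_increment_le (hHa : CondHa F) :
    ∃ C δ : ℝ, 0 < C ∧ 0 < δ ∧ ∀ θ h, 0 < h → h ≤ θ → θ ≤ δ → 0 < truncMean F θ⁻¹ ∧
      ‖charFun F (θ + h) - charFun F θ‖ ≤ C * h * truncMean F θ⁻¹ * (θ / h) ^ (1 / 4 : ℝ) := by
  obtain ⟨x₀, h1, hH, hP⟩ := hHa.potter_quarter
  obtain ⟨x₁, h2, hV⟩ := hHa.truncSq_le one_pos
  have hm : 0 < max x₀ x₁ := by positivity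
  -- 16 = 1 + 3(1 + 4): the main term, the second moment, and the tail integral with its factor 4.
  refine ⟨16, (max x₀ x₁)⁻¹, by norm_num, inv_pos.2 hm, fun θ h hh hhθ hθ => ?_⟩
  have hθp : 0 < θ := hh.trans_le hhθ
  have hθi : max x₀ x₁ ≤ θ⁻¹ := by rwa [le_inv_comm₀ hm hθp]
  have ht0 : x₀ ≤ θ⁻¹ := (le_max_left _ _).trans hθi
  have hA := (hH _ ht0).1
  refine ⟨hA, ?_⟩
  have hti : 0 < θ⁻¹ := inv_pos.2 hθp
  have hle : θ⁻¹ ≤ h⁻¹ := inv_anti₀ hh hhθ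
  have b1 := norm_charFun_inv_add_sub_le F hti hh (by rw [← div_eq_mul_inv, div_le_one hθp]; exact hhθ)
  rw [inv_inv, abs_of_pos hA] at b1
  have b2 := hV _ ((le_max_right _ _).trans hθi)
  have b3 := integral_tailSum_le_of_potter h1 hH hP ht0 hle
  have e : h⁻¹ / θ⁻¹ = θ / h := by field_simp
  rw [e] at b3
  have b4 : truncSq F θ⁻¹ / θ⁻¹ ≤ truncMean F θ⁻¹ := by rw [div_le_iff₀ hti]; linarith
  have b5 : 1 ≤ (θ / h) ^ (1 / 4 : ℝ) :=
    Real.one_le_rpow ((one_le_div hh).2 hhθ) (by norm_num)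
  refine b1.trans ?_
  have b6 : truncMean F θ⁻¹ ≤ truncMean F θ⁻¹ * (θ / h) ^ (1 / 4 : ℝ) :=
    le_mul_of_one_le_right hA.le b5
  calc h * (truncMean F θ⁻¹ + 3 * (truncSq F θ⁻¹ / θ⁻¹ + ∫ s in θ⁻¹..h⁻¹, tailSum F s))
      ≤ h * (16 * (truncMean F θ⁻¹ * (θ / h) ^ (1 / 4 : ℝ))) := by gcongr; linarith
    _ = _ := by ring

/-- `1 - φ(θ) ∼ -i θ A(1/θ)` as `θ ↓ 0`. -/
lemma CondHa.one_sub_charFun_asymp (hHa : CondHa F) {ε : ℝ} (hε : 0 < ε) :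
    ∃ δ : ℝ, 0 < δ ∧ ∀ θ, 0 < θ → θ ≤ δ → 0 < truncMean F θ⁻¹ ∧
      ‖1 - charFun F θ + Complex.I * (θ * truncMean F θ⁻¹ : ℝ)‖ ≤ ε * (θ * truncMean F θ⁻¹) := by
  obtain ⟨x₀, h1, hpos, -⟩ := hHa.potter one_pos
  obtain ⟨x₁, h2, hV⟩ := hHa.truncSq_le (ε := ε / 4) (by positivity)
  have hm : 0 < max x₀ x₁ := by positivity
  refine ⟨(max x₀ x₁)⁻¹, inv_pos.2 hm, fun θ hθ hθδ => ?_⟩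
  have hθi : max x₀ x₁ ≤ θ⁻¹ := by rwa [le_inv_comm₀ hm hθ]
  have hA := hpos _ ((le_max_left _ _).trans hθi)
  refine ⟨hA, ?_⟩
  have hti : 0 < θ⁻¹ := inv_pos.2 hθ
  have b1 := one_sub_re_charFun_le F hti
  have b2 := abs_im_charFun_sub_le F hti
  have b3 := hV _ ((le_max_right _ _).trans hθi)
  rw [inv_inv] at b1 b2
  refine (Complex.norm_le_abs_re_add_abs_im _).trans ?_
  have e1 : (1 - charFun F θ + Complex.I * (θ * truncMean F θ⁻¹ : ℝ)).re = 1 - (charFun F θ).re := by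
    simp
  have e2 : (1 - charFun F θ + Complex.I * (θ * truncMean F θ⁻¹ : ℝ)).im =
      -(θ * (θ⁻¹ * (charFun F θ).im - truncMean F θ⁻¹)) := by
    simp; field_simp; ring
  rw [e1, e2, abs_neg, abs_mul, abs_of_pos hθ, abs_of_nonneg (one_sub_re_charFun_nonneg F θ)]
  have b4 : 2 * truncSq F θ⁻¹ / θ⁻¹ ^ 2 ≤ ε / 2 * (θ * truncMean F θ⁻¹) := by
    calc 2 * truncSq F θ⁻¹ / θ⁻¹ ^ 2 ≤ 2 * (ε / 4 * θ⁻¹ * truncMean F θ⁻¹) / θ⁻¹ ^ 2 := by gcongr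
      _ = _ := by field_simp; ring
  have b5 : θ * |θ⁻¹ * (charFun F θ).im - truncMean F θ⁻¹| ≤ ε / 2 * (θ * truncMean F θ⁻¹) := by
    calc _ ≤ θ * (2 * (ε / 4 * θ⁻¹ * truncMean F θ⁻¹) / θ⁻¹) := by
          gcongr; exact b2.trans (by gcongr)
      _ = _ := by field_simp; ring
  linarith

end CharFun

end RelStableRenewal


namespace RelStableRenewal

/-! ### Frequencies away from the origin. -/

section Outer

lemma norm_bounds_of_near {D : ℂ} {a ε : ℝ} (ha : 0 < a) (hε : ε ≤ 1 / 2)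
    (h : ‖D + Complex.I * (a : ℝ)‖ ≤ ε * a) : a / 2 ≤ ‖D‖ ∧ ‖D‖ ≤ 2 * a ∧ |‖D‖ - a| ≤ ε * a := by
  have hn : ‖-(Complex.I * (a : ℂ))‖ = a := by
    rw [norm_neg, norm_mul, Complex.norm_I, one_mul, Complex.norm_real, Real.norm_of_nonneg ha.le]
  have h1 := abs_norm_sub_norm_le D (-(Complex.I * (a : ℂ)))
  rw [sub_neg_eq_add, hn] at h1
  have h2 := h1.trans h
  have h3 := abs_le.1 h2
  refine ⟨by nlinarith, by nlinarith, h2⟩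

lemma norm_inv_sub_le_of_near {D : ℂ} {a ε : ℝ} (ha : 0 < a) (hε : ε ≤ 1 / 2)
    (h : ‖D + Complex.I * (a : ℝ)‖ ≤ ε * a) : ‖D⁻¹ - Complex.I * (a⁻¹ : ℝ)‖ ≤ 2 * ε * a⁻¹ := by
  obtain ⟨h1, -, -⟩ := norm_bounds_of_near ha hε h
  have hD : D ≠ 0 := by rw [← norm_pos_iff]; linarith
  have hac : (a : ℂ) ≠ 0 := by exact_mod_cast ha.ne'
  have e : D⁻¹ - Complex.I * (a⁻¹ : ℝ) = -Complex.I * (D + Complex.I * (a : ℝ)) * (D⁻¹ * (a : ℂ)⁻¹) := by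
    push_cast
    field_simp
    ring_nf
    simp
  rw [e, norm_mul, norm_mul, norm_neg, Complex.norm_I, one_mul, norm_mul, norm_inv, norm_inv,
    Complex.norm_real, Real.norm_of_nonneg ha.le]
  have h2 : ‖D‖⁻¹ ≤ 2 * a⁻¹ := by
    rw [show 2 * a⁻¹ = (a / 2)⁻¹ by field_simp]; exact inv_anti₀ (by positivity) h1
  have h0 : 0 ≤ ε * a := (norm_nonneg _).trans h
  calc _ ≤ (ε * a) * (2 * a⁻¹ * a⁻¹) := by gcongr
    _ = _ := by field_simp

/-- Re D⁻¹ = Re D / |D|², and |D| is known up to a relative error ε. The error is relative to Re D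
itself, which may be far smaller than |D|; a bound on D⁻¹ in norm would lose this. -/
lemma abs_re_inv_sub_le_of_near {D : ℂ} {a ε : ℝ} (ha : 0 < a) (hε : ε ≤ 1 / 2) (hre : 0 ≤ D.re)
    (h : ‖D + Complex.I * (a : ℝ)‖ ≤ ε * a) :
    |D⁻¹.re - D.re / a ^ 2| ≤ 12 * ε * (D.re / a ^ 2) := by
  obtain ⟨h1, h2, h3⟩ := norm_bounds_of_near ha hε h
  have hD : 0 < ‖D‖ := by linarith
  rw [Complex.inv_re, Complex.normSq_eq_norm_sq]
  have e : D.re / ‖D‖ ^ 2 - D.re / a ^ 2 = (a - ‖D‖) * (a + ‖D‖) / ‖D‖ ^ 2 * (D.re / a ^ 2) := by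
    field_simp; ring
  rw [e, abs_mul, abs_of_nonneg (a := D.re / a ^ 2) (by positivity), abs_div, abs_mul,
    abs_sub_comm, abs_of_pos (a := a + ‖D‖) (by positivity), abs_of_pos (a := ‖D‖ ^ 2) (by positivity)]
  gcongr
  rw [div_le_iff₀ (by positivity)]
  have h0 : 0 ≤ ε * a := (norm_nonneg _).trans h
  have hε0 : 0 ≤ ε := nonneg_of_mul_nonneg_left h0 ha
  calc |‖D‖ - a| * (a + ‖D‖) ≤ (ε * a) * (a + 2 * a) := by gcongr
    _ = 12 * ε * (a / 2) ^ 2 := by ring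
    _ ≤ _ := by gcongr

variable {F : Measure ℝ} [IsProbabilityMeasure F]

lemma exists_norm_inv_le {a δ : ℝ} (hδ : 0 < δ) (hφ : ∀ θ, 0 < θ → θ ≤ a → charFun F θ ≠ 1) :
    ∃ M : ℝ, 0 < M ∧ ∀ θ, δ ≤ θ → θ ≤ a → ‖(1 - charFun F θ)⁻¹‖ ≤ M := by
  have hc : ContinuousOn (fun θ => ‖(1 - charFun F θ)⁻¹‖) (Set.Icc δ a) := by
    refine (ContinuousOn.inv₀ (continuous_const.sub continuous_charFun).continuousOn ?_).norm
    intro θ hθ h0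
    exact hφ θ (hδ.trans_le hθ.1) hθ.2 (sub_eq_zero.1 h0).symm
  obtain ⟨M, hM⟩ := isCompact_Icc.bddAbove_image hc
  refine ⟨max M 1, by positivity, fun θ h1 h2 => ?_⟩
  exact (hM ⟨θ, ⟨h1, h2⟩, rfl⟩).trans (le_max_left _ _)

/-- Near 0, |1 - φ(θ)| ≥ θA(1/θ)/2, and Potter replaces A(1/θ) by A(x) at the cost (xθ)^(1/4). On
the rest of (0, a] the inverse is bounded by compactness and A(x) = O(x^(1/4)). -/
lemma CondHa.norm_inv_le (hHa : CondHa F) {a : ℝ} (ha : 0 < a)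
    (hφ : ∀ θ, 0 < θ → θ ≤ a → charFun F θ ≠ 1) :
    ∃ C x₀ : ℝ, 0 < C ∧ 1 ≤ x₀ ∧ ∀ x θ, x₀ ≤ x → x⁻¹ ≤ θ → θ ≤ a → 0 < truncMean F x ∧
      ‖(1 - charFun F θ)⁻¹‖ ≤ C * x ^ (1 / 4 : ℝ) * θ ^ (-(3 / 4) : ℝ) / truncMean F x := by
  obtain ⟨x₀, h1, hH, hP⟩ := hHa.potter_quarter
  obtain ⟨δ, hδ, hnear⟩ := hHa.one_sub_charFun_asymp (ε := 1 / 2) (by norm_num)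
  obtain ⟨C, x₁, hC, hx₁, hgr⟩ := hHa.truncMean_le_rpow
  have hx0p : 0 < x₀ := by linarith
  set δ' := min δ x₀⁻¹ with hδ'
  have hδ'p : 0 < δ' := by positivity
  obtain ⟨M, hM, hMb⟩ := exists_norm_inv_le hδ'p hφ
  refine ⟨2 + M * C * a ^ (3 / 4 : ℝ), max x₀ x₁, by positivity, h1.trans (le_max_left _ _),
    fun x θ hx hxθ hθa => ?_⟩
  have hxp : 0 < x := hx0p.trans_le ((le_max_left _ _).trans hx)
  have hθp : 0 < θ := (inv_pos.2 hxp).trans_le hxθ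
  obtain ⟨hAx, hA1, -, -⟩ := hgr x ((le_max_right _ _).trans hx)
  refine ⟨hAx, ?_⟩
  have hθ34 : 0 < θ ^ (-(3 / 4) : ℝ) := by positivity
  have hx14 : 0 < x ^ (1 / 4 : ℝ) := by positivity
  rw [le_div_iff₀ hAx]
  rcases le_total θ δ' with hθ | hθ
  · obtain ⟨hA, hn⟩ := hnear θ hθp (hθ.trans (min_le_left _ _))
    obtain ⟨h3, -, -⟩ := norm_bounds_of_near (by positivity) le_rfl hn
    have hθi : x₀ ≤ θ⁻¹ := by
      rw [le_inv_comm₀ hx0p hθp]; exact hθ.trans (min_le_right _ _)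
    have hθx : θ⁻¹ ≤ x := by rwa [inv_le_comm₀ hθp hxp]
    have h4 := (hP θ⁻¹ x hθi hθx).1
    rw [norm_inv]
    have h5 : ‖1 - charFun F θ‖⁻¹ ≤ (θ * truncMean F θ⁻¹ / 2)⁻¹ := inv_anti₀ (by positivity) h3
    have e : x / θ⁻¹ = x * θ := by field_simp
    rw [e, Real.mul_rpow hxp.le hθp.le] at h4
    have e2 : θ ^ (1 / 4 : ℝ) = θ ^ (-(3 / 4) : ℝ) * θ := by
      rw [← Real.rpow_add_one hθp.ne']; norm_num
    rw [e2] at h4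
    calc ‖1 - charFun F θ‖⁻¹ * truncMean F x
        ≤ (θ * truncMean F θ⁻¹ / 2)⁻¹ * (x ^ (1 / 4 : ℝ) * (θ ^ (-(3 / 4) : ℝ) * θ) * truncMean F θ⁻¹) := by
          gcongr
      _ = 2 * x ^ (1 / 4 : ℝ) * θ ^ (-(3 / 4) : ℝ) := by
          generalize truncMean F θ⁻¹ = T at hA ⊢
          field_simp
      _ ≤ _ := by
          gcongr
          have : 0 ≤ M * C * a ^ (3 / 4 : ℝ) := by positivity
          linarith
  · have h3 := hMb θ hθ hθa
    have h4 : 1 ≤ a ^ (3 / 4 : ℝ) * θ ^ (-(3 / 4) : ℝ) := by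
      rw [Real.rpow_neg hθp.le, ← div_eq_mul_inv, one_le_div (by positivity)]
      exact Real.rpow_le_rpow hθp.le hθa (by norm_num)
    calc _ ≤ M * (C * x ^ (1 / 4 : ℝ)) := by gcongr
      _ ≤ M * (C * x ^ (1 / 4 : ℝ)) * (a ^ (3 / 4 : ℝ) * θ ^ (-(3 / 4) : ℝ)) :=
        le_mul_of_one_le_right (by positivity) h4
      _ = M * C * a ^ (3 / 4 : ℝ) * x ^ (1 / 4 : ℝ) * θ ^ (-(3 / 4) : ℝ) := by ring
      _ ≤ _ := by gcongr; linarith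

/-- Near 0 the modulus of continuity hA(1/θ)(θ/h)^(1/4) is divided by θA(1/θ), so that A cancels.
Away from 0 the increment is at most 2h E min(|X|, 1/h) = O(h^(3/4)). -/
lemma CondHa.norm_increment_mul_inv_le (hHa : CondHa F) {a : ℝ} (ha : 0 < a)
    (hφ : ∀ θ, 0 < θ → θ ≤ a → charFun F θ ≠ 1) :
    ∃ C h₀ : ℝ, 0 < C ∧ 0 < h₀ ∧ ∀ h θ, 0 < h → h ≤ h₀ → h ≤ θ → θ ≤ a →
      ‖charFun F (θ + h) - charFun F θ‖ * ‖(1 - charFun F θ)⁻¹‖ ≤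
        C * (h ^ (3 / 4 : ℝ) * θ ^ (-(3 / 4) : ℝ)) := by
  obtain ⟨C₁, δ₁, hC₁, hδ₁, hinc⟩ := hHa.norm_charFun_increment_le
  obtain ⟨δ, hδ, hnear⟩ := hHa.one_sub_charFun_asymp (ε := 1 / 2) (by norm_num)
  obtain ⟨C, x₁, hC, hx₁, hgr⟩ := hHa.truncMean_le_rpow
  set δ' := min δ δ₁ with hδ'
  have hδ'p : 0 < δ' := by positivity
  obtain ⟨M, hM, hMb⟩ := exists_norm_inv_le hδ'p hφ
  have hx1p : 0 < x₁ := by linarith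
  refine ⟨2 * C₁ + 2 * C * M * a ^ (3 / 4 : ℝ), x₁⁻¹, by positivity, by positivity,
    fun h θ hh hh0 hhθ hθa => ?_⟩
  have hθp : 0 < θ := hh.trans_le hhθ
  have hθ34 : 0 < θ ^ (-(3 / 4) : ℝ) := by positivity
  have eh : h * h ^ (-(1 / 4) : ℝ) = h ^ (3 / 4 : ℝ) := by
    rw [mul_comm, ← Real.rpow_add_one hh.ne']; norm_num
  rcases le_total θ δ' with hθ | hθ
  · obtain ⟨hA, hn⟩ := hnear θ hθp (hθ.trans (min_le_left _ _))
    obtain ⟨h3, -, -⟩ := norm_bounds_of_near (by positivity) le_rfl hn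
    obtain ⟨-, h4⟩ := hinc θ h hh hhθ (hθ.trans (min_le_right _ _))
    rw [norm_inv]
    have h5 : ‖1 - charFun F θ‖⁻¹ ≤ (θ * truncMean F θ⁻¹ / 2)⁻¹ := inv_anti₀ (by positivity) h3
    have e2 : θ ^ (1 / 4 : ℝ) = θ ^ (-(3 / 4) : ℝ) * θ := by
      rw [← Real.rpow_add_one hθp.ne']; norm_num
    calc _ ≤ C₁ * h * truncMean F θ⁻¹ * (θ / h) ^ (1 / 4 : ℝ) * (θ * truncMean F θ⁻¹ / 2)⁻¹ := by
          gcongr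
      _ = 2 * C₁ * ((h * h ^ (-(1 / 4) : ℝ)) * θ ^ (-(3 / 4) : ℝ)) := by
          rw [Real.div_rpow hθp.le hh.le, e2, Real.rpow_neg hh.le]
          generalize truncMean F θ⁻¹ = T at hA ⊢
          field_simp
      _ ≤ _ := by
          rw [eh]
          gcongr
          have : 0 ≤ 2 * C * M * a ^ (3 / 4 : ℝ) := by positivity
          linarith
  · have h3 := hMb θ hθ hθa
    have h4 : 1 ≤ a ^ (3 / 4 : ℝ) * θ ^ (-(3 / 4) : ℝ) := by
      rw [Real.rpow_neg hθp.le, ← div_eq_mul_inv, one_le_div (by positivity)]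
      exact Real.rpow_le_rpow hθp.le hθa (by norm_num)
    have h5 : x₁ ≤ h⁻¹ := by rwa [le_inv_comm₀ hx1p hh]
    have h6 := (hgr _ h5).2.2.1
    rw [Real.inv_rpow hh.le, ← Real.rpow_neg hh.le] at h6
    have h7 := norm_charFun_add_sub_le F θ hh
    calc _ ≤ (2 * h * (C * h ^ (-(1 / 4) : ℝ))) * M := by
          gcongr; exact h7.trans (by gcongr)
      _ = 2 * C * M * (h * h ^ (-(1 / 4) : ℝ)) := by ring
      _ ≤ 2 * C * M * (h * h ^ (-(1 / 4) : ℝ)) * (a ^ (3 / 4 : ℝ) * θ ^ (-(3 / 4) : ℝ)) :=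
        le_mul_of_one_le_right (by positivity) h4
      _ = 2 * C * M * a ^ (3 / 4 : ℝ) * (h ^ (3 / 4 : ℝ) * θ ^ (-(3 / 4) : ℝ)) := by rw [eh]; ring
      _ ≤ _ := by gcongr; linarith

/-- The Fourier transform of the Fejér-smoothed renewal measure, `(1 - θ / a) / (1 - φ(θ))`. -/
noncomputable def fejerResolvent (F : Measure ℝ) (a θ : ℝ) : ℂ :=
  ((1 - θ / a : ℝ) : ℂ) * (1 - charFun F θ)⁻¹

lemma continuousOn_fejerResolvent {a c : ℝ} (hc : 0 < c)
    (hφ : ∀ θ, 0 < θ → θ ≤ a → charFun F θ ≠ 1) :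
    ContinuousOn (fejerResolvent F a) (Set.Icc c a) := by
  refine ContinuousOn.mul (by fun_prop) ?_
  refine ContinuousOn.inv₀ (continuous_const.sub continuous_charFun).continuousOn ?_
  intro θ hθ h0
  exact hφ θ (hc.trans_le hθ.1) hθ.2 (sub_eq_zero.1 h0).symm

/-- Input for the half-period shift: the first bound handles the end pieces, the second the
difference. The power θ^(-3/2) is integrable at infinity, so integrating from B/x leaves a factor
B^(-1/2) and no power of x. -/
lemma CondHa.fejerResolvent_bounds (hHa : CondHa F) {a : ℝ} (ha : 0 < a)
    (hφ : ∀ θ, 0 < θ → θ ≤ a → charFun F θ ≠ 1) :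
    ∃ C x₀ : ℝ, 0 < C ∧ 1 ≤ x₀ ∧ ∀ x, x₀ ≤ x → 0 < truncMean F x ∧
      (∀ θ, x⁻¹ ≤ θ → θ ≤ a →
        ‖fejerResolvent F a θ‖ ≤ C * x ^ (1 / 4 : ℝ) * θ ^ (-(3 / 4) : ℝ) / truncMean F x) ∧
      (∀ θ, Real.pi / x ≤ θ → θ ≤ a - Real.pi / x →
        ‖fejerResolvent F a θ - fejerResolvent F a (θ + Real.pi / x)‖ ≤
          C * x ^ (-(1 / 2) : ℝ) * θ ^ (-(3 / 2) : ℝ) / truncMean F x) := by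
  obtain ⟨C₁, x₁, hC₁, hx₁, h1⟩ := hHa.norm_inv_le ha hφ
  obtain ⟨C₂, h₀, hC₂, hh₀, h2⟩ := hHa.norm_increment_mul_inv_le ha hφ
  have hpi := Real.pi_pos
  refine ⟨C₁ + (C₁ * C₂ + C₁) * Real.pi ^ (3 / 4 : ℝ), max (max x₁ (Real.pi / h₀)) (1 / a), by positivity,
    hx₁.trans ((le_max_left _ _).trans (le_max_left _ _)), fun x hx => ?_⟩
  have hxx₁ : x₁ ≤ x := ((le_max_left _ _).trans (le_max_left _ _)).trans hx
  have hxh : Real.pi / h₀ ≤ x := ((le_max_right _ _).trans (le_max_left _ _)).trans hx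
  have hxa : 1 / a ≤ x := (le_max_right _ _).trans hx
  have hxp : 0 < x := by linarith
  have hxia : x⁻¹ ≤ a := by rw [inv_le_comm₀ hxp ha]; simpa using hxa
  have hAx : 0 < truncMean F x := (h1 x a hxx₁ hxia le_rfl).1
  have hxip : 0 < x⁻¹ := inv_pos.2 hxp
  have hg : ∀ θ, 0 ≤ θ → θ ≤ a → ‖((1 - θ / a : ℝ) : ℂ)‖ ≤ 1 := by
    intro θ h0 h3
    have : θ / a ≤ 1 := (div_le_one ha).2 h3
    have : 0 ≤ θ / a := by positivity
    rw [Complex.norm_real, Real.norm_eq_abs, abs_le]; constructor <;> linarith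
  refine ⟨hAx, fun θ hθ hθa => ?_, fun θ hθ hθa => ?_⟩
  · have hθp : 0 < θ := hxip.trans_le hθ
    have b := (h1 x θ hxx₁ hθ hθa).2
    rw [fejerResolvent, norm_mul]
    calc _ ≤ 1 * (C₁ * x ^ (1 / 4 : ℝ) * θ ^ (-(3 / 4) : ℝ) / truncMean F x) := by
          gcongr; exact hg θ hθp.le hθa
      _ ≤ _ := by
          rw [one_mul]; gcongr
          have : 0 ≤ (C₁ * C₂ + C₁) * Real.pi ^ (3 / 4 : ℝ) := by positivity
          linarith
  · set h := Real.pi / x with hh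
    have hhp : 0 < h := by positivity
    have hθp : 0 < θ := hhp.trans_le hθ
    have hxih : x⁻¹ ≤ h := by
      rw [hh, div_eq_mul_inv]; nlinarith [Real.pi_gt_three]
    have hθx : x⁻¹ ≤ θ := hxih.trans hθ
    have hhh₀ : h ≤ h₀ := by rw [hh, div_le_comm₀ hxp hh₀]; exact hxh
    have b1 := (h1 x θ hxx₁ hθx (by linarith)).2
    have b2 := (h1 x (θ + h) hxx₁ (by linarith) (by linarith)).2
    have b3 := h2 h θ hhp hhh₀ hθ (by linarith)
    set W := x ^ (1 / 4 : ℝ) * θ ^ (-(3 / 4) : ℝ) / truncMean F x with hW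
    have hWp : 0 < W := by positivity
    have b2' : ‖(1 - charFun F (θ + h))⁻¹‖ ≤ C₁ * W := by
      refine b2.trans ?_
      rw [hW, ← mul_div_assoc, ← mul_assoc]
      gcongr ?_ / _
      gcongr C₁ * x ^ (1 / 4 : ℝ) * ?_
      exact Real.rpow_le_rpow_of_nonpos hθp (by linarith) (by norm_num)
    have b1' : ‖(1 - charFun F θ)⁻¹‖ ≤ C₁ * W := by rw [hW, ← mul_div_assoc, ← mul_assoc]; exact b1
    have d1 : 1 - charFun F θ ≠ 0 := fun h0 =>
      hφ θ hθp (by linarith) (sub_eq_zero.1 h0).symm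
    have d2 : 1 - charFun F (θ + h) ≠ 0 := fun h0 =>
      hφ (θ + h) (by linarith) (by linarith) (sub_eq_zero.1 h0).symm
    -- Change of the damping factor 1 - θ/a, plus the resolvent identity for the increment of (1 -
    -- φ)⁻¹.
    have e : fejerResolvent F a θ - fejerResolvent F a (θ + h) =
        ((h / a : ℝ) : ℂ) * (1 - charFun F θ)⁻¹ - ((1 - (θ + h) / a : ℝ) : ℂ) *
        ((charFun F (θ + h) - charFun F θ) * (1 - charFun F θ)⁻¹ * (1 - charFun F (θ + h))⁻¹) := by
      have : (charFun F (θ + h) - charFun F θ) * (1 - charFun F θ)⁻¹ * (1 - charFun F (θ + h))⁻¹ =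
          (1 - charFun F (θ + h))⁻¹ - (1 - charFun F θ)⁻¹ := by field_simp; ring
      rw [this, fejerResolvent, fejerResolvent]
      push_cast
      ring
    rw [e]
    refine (norm_sub_le _ _).trans ?_
    rw [norm_mul, norm_mul, norm_mul, norm_mul, Complex.norm_real,
      Real.norm_of_nonneg (by positivity : 0 ≤ h / a)]
    -- Because h ≤ θ ≤ a, the change h/a of the damping factor is no larger than the relative
    -- increment of the resolvent.
    have k1 : h ≤ h ^ (3 / 4 : ℝ) * θ ^ (-(3 / 4) : ℝ) * a := by
      have q1 : h = h ^ (3 / 4 : ℝ) * h ^ (1 / 4 : ℝ) := by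
        rw [← Real.rpow_add hhp]; norm_num
      have q2 : θ ^ (-(3 / 4) : ℝ) * θ = θ ^ (1 / 4 : ℝ) := by
        rw [← Real.rpow_add_one hθp.ne']; norm_num
      calc h = h ^ (3 / 4 : ℝ) * h ^ (1 / 4 : ℝ) := q1
        _ ≤ h ^ (3 / 4 : ℝ) * θ ^ (1 / 4 : ℝ) := by gcongr
        _ = h ^ (3 / 4 : ℝ) * (θ ^ (-(3 / 4) : ℝ) * θ) := by rw [q2]
        _ ≤ _ := by rw [mul_assoc]; gcongr; linarith
    have k2 : h / a ≤ h ^ (3 / 4 : ℝ) * θ ^ (-(3 / 4) : ℝ) := by rwa [div_le_iff₀ ha]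
    calc _ ≤ (h ^ (3 / 4 : ℝ) * θ ^ (-(3 / 4) : ℝ)) * (C₁ * W) +
          1 * (C₂ * (h ^ (3 / 4 : ℝ) * θ ^ (-(3 / 4) : ℝ)) * (C₁ * W)) := by
          gcongr
          exact hg _ (by linarith) (by linarith)
      _ = (C₁ * C₂ + C₁) * Real.pi ^ (3 / 4 : ℝ) * x ^ (-(1 / 2) : ℝ) * θ ^ (-(3 / 2) : ℝ)
            / truncMean F x := by
          have q3 : x ^ (-(1 / 2) : ℝ) = x ^ (-(3 / 4) : ℝ) * x ^ (1 / 4 : ℝ) := by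
            rw [← Real.rpow_add hxp]; norm_num
          have q4 : θ ^ (-(3 / 2) : ℝ) = θ ^ (-(3 / 4) : ℝ) * θ ^ (-(3 / 4) : ℝ) := by
            rw [← Real.rpow_add hθp]; norm_num
          rw [hW, hh, Real.div_rpow hpi.le hxp.le, div_eq_mul_inv _ (x ^ (3 / 4 : ℝ)),
            ← Real.rpow_neg hxp.le, q3, q4]
          ring
      _ ≤ _ := by gcongr; linarith

/-- Contribution of frequencies away from the origin (shift by half a period). -/
lemma CondHa.norm_outer_integral_le (hHa : CondHa F) {a : ℝ} (ha : 0 < a)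
    (hφ : ∀ θ, 0 < θ → θ ≤ a → charFun F θ ≠ 1) :
    ∃ C : ℝ, 0 < C ∧ ∀ B : ℝ, Real.pi ≤ B → ∃ x₀ : ℝ, 1 ≤ x₀ ∧ ∀ w : ℝ, x₀ ≤ |w| →
      ‖∫ θ in (B / |w|)..a, Complex.exp (-((θ * w : ℝ) * Complex.I)) * fejerResolvent F a θ‖ ≤
        C * B ^ (-(1 / 2) : ℝ) / truncMean F |w| := by
  obtain ⟨C, x₁, hC, hx₁, hb⟩ := hHa.fejerResolvent_bounds ha hφ
  have hpi := Real.pi_pos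
  refine ⟨(2 * Real.pi + 2) * C, by positivity, fun B hB =>
    ⟨max x₁ ((B + Real.pi) / a), hx₁.trans (le_max_left _ _), fun w hw => ?_⟩⟩
  set x := |w| with hx
  have hxx₁ : x₁ ≤ x := (le_max_left _ _).trans hw
  have hxp : 0 < x := by linarith
  obtain ⟨hAx, h1, h2⟩ := hb x hxx₁
  have hBp : 0 < B := by linarith
  set h := Real.pi / x with hh
  set c := B / x with hc
  have hhp : 0 < h := by positivity
  have hcp : 0 < c := by positivity
  have hhc : h ≤ c := by rw [hh, hc]; gcongr
  have hch : c ≤ a - h := by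
    have := (div_le_iff₀ ha).1 ((le_max_right _ _).trans hw)
    rw [le_sub_iff_add_le, hc, hh, ← add_div, div_le_iff₀ hxp]; linarith
  have hxc : x⁻¹ ≤ c := by
    rw [hc, div_eq_mul_inv]; nlinarith [Real.pi_gt_three, inv_pos.2 hxp]
  set f := fejerResolvent F a with hf
  set E : ℝ → ℂ := fun θ => Complex.exp (-((θ * w : ℝ) * Complex.I)) with hE
  have hEn : ∀ θ, ‖E θ‖ = 1 := by
    intro θ
    simp only [hE]
    rw [← neg_mul, ← Complex.ofReal_neg, Complex.norm_exp_ofReal_mul_I]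
  have hEs : ∀ θ, E (θ + h) = - E θ := by
    intro θ
    have hexp : Complex.exp (-((h * w : ℝ) * Complex.I)) = -1 := by
      rcases abs_choice w with hw' | hw'
      · have : h * w = Real.pi := by rw [hh, hx, hw']; rw [hx, hw'] at hxp; field_simp
        rw [this, Complex.exp_neg, Complex.exp_pi_mul_I]; norm_num
      · have : h * w = -Real.pi := by
          rw [hh, hx, hw']; rw [hx, hw'] at hxp
          have : w ≠ 0 := by intro h0; simp [h0] at hxp
          field_simp
        rw [this, Complex.ofReal_neg, neg_mul, neg_neg, Complex.exp_pi_mul_I]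
    have : E (θ + h) = E θ * Complex.exp (-((h * w : ℝ) * Complex.I)) := by
      simp only [hE]
      rw [← Complex.exp_add]
      push_cast; ring_nf
    rw [this, hexp, mul_neg_one]
  have hEc : Continuous E := by fun_prop
  have hcont : ContinuousOn (fun θ => E θ * f θ) (Set.Icc c a) :=
    hEc.continuousOn.mul (continuousOn_fejerResolvent hcp hφ)
  have hint : ∀ u v, c ≤ u → u ≤ v → v ≤ a → IntervalIntegrable (fun θ => E θ * f θ) volume u v :=
    fun u v h1 h2 h3 => ContinuousOn.intervalIntegrable_of_Icc h2
      (hcont.mono (Set.Icc_subset_Icc h1 h3))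
  have hint2 : IntervalIntegrable (fun θ => E θ * f (θ + h)) volume c (a - h) := by
    refine ContinuousOn.intervalIntegrable_of_Icc hch (hEc.continuousOn.mul ?_)
    refine (continuousOn_fejerResolvent hcp hφ).comp (by fun_prop) fun θ hθ => ⟨?_, ?_⟩
    · linarith [hθ.1]
    · linarith [hθ.2]
  have s1 : ∫ θ in c..a, E θ * f θ = (∫ θ in c..(c + h), E θ * f θ) + ∫ θ in (c + h)..a, E θ * f θ :=
    (intervalIntegral.integral_add_adjacent_intervals
      (hint _ _ le_rfl (by linarith) (by linarith)) (hint _ _ (by linarith) (by linarith) le_rfl)).symm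
  have s2 : ∫ θ in c..a, E θ * f θ = (∫ θ in c..(a - h), E θ * f θ) + ∫ θ in (a - h)..a, E θ * f θ :=
    (intervalIntegral.integral_add_adjacent_intervals
      (hint _ _ le_rfl (by linarith) (by linarith)) (hint _ _ (by linarith) (by linarith) le_rfl)).symm
  have s3 : ∫ θ in (c + h)..a, E θ * f θ = - ∫ θ in c..(a - h), E θ * f (θ + h) := by
    have := intervalIntegral.integral_comp_add_right (a := c) (b := a - h) (fun θ => E θ * f θ) h
    rw [sub_add_cancel] at this
    rw [← this, ← intervalIntegral.integral_neg]
    simp_rw [hEs, neg_mul]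
  -- The exponential changes sign under the shift h = π/|w|. Averaging the integral with its shifted
  -- copy leaves two end pieces of length h and the integral of f(θ) - f(θ + h).
  have s4 : 2 * ∫ θ in c..a, E θ * f θ = (∫ θ in c..(c + h), E θ * f θ) +
      (∫ θ in (a - h)..a, E θ * f θ) + ∫ θ in c..(a - h), E θ * (f θ - f (θ + h)) := by
    have : ∫ θ in c..(a - h), E θ * (f θ - f (θ + h)) =
        (∫ θ in c..(a - h), E θ * f θ) - ∫ θ in c..(a - h), E θ * f (θ + h) := by
      rw [← intervalIntegral.integral_sub (hint _ _ le_rfl (by linarith) (by linarith)) hint2]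
      simp_rw [mul_sub]
    rw [this, two_mul]
    nth_rewrite 1 [s1]
    rw [s2, s3]; ring
  have hBr : B ^ (-(3 / 4) : ℝ) ≤ B ^ (-(1 / 2) : ℝ) :=
    Real.rpow_le_rpow_of_exponent_le (by linarith [Real.pi_gt_three]) (by norm_num)
  have bd : ∀ θ, c ≤ θ → θ ≤ a → ‖E θ * f θ‖ ≤ C * B ^ (-(1 / 2) : ℝ) * x / truncMean F x := by
    intro θ hθ hθa
    rw [norm_mul, hEn, one_mul]
    refine (h1 θ (hxc.trans hθ) hθa).trans ?_
    have q1 : θ ^ (-(3 / 4) : ℝ) ≤ c ^ (-(3 / 4) : ℝ) :=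
      Real.rpow_le_rpow_of_nonpos hcp hθ (by norm_num)
    have q2 : x ^ (1 / 4 : ℝ) * c ^ (-(3 / 4) : ℝ) = B ^ (-(3 / 4) : ℝ) * x := by
      rw [hc, Real.div_rpow hBp.le hxp.le, Real.rpow_neg hxp.le, div_inv_eq_mul, mul_comm,
        mul_assoc, ← Real.rpow_add hxp]; norm_num
    calc _ ≤ C * x ^ (1 / 4 : ℝ) * c ^ (-(3 / 4) : ℝ) / truncMean F x := by gcongr
      _ = C * B ^ (-(3 / 4) : ℝ) * x / truncMean F x := by rw [mul_assoc, q2, mul_assoc]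
      _ ≤ _ := by gcongr
  set W := C * B ^ (-(1 / 2) : ℝ) / truncMean F x with hW
  have n1 : ‖∫ θ in c..(c + h), E θ * f θ‖ ≤ Real.pi * W := by
    have := intervalIntegral.norm_integral_le_of_norm_le_const (a := c) (b := c + h)
      (f := fun θ => E θ * f θ) (C := C * B ^ (-(1 / 2) : ℝ) * x / truncMean F x) (by
        intro θ hθ
        rw [Set.uIoc_of_le (by linarith)] at hθ
        exact bd θ hθ.1.le (by linarith [hθ.2]))
    refine this.trans (le_of_eq ?_)
    rw [add_sub_cancel_left, abs_of_pos hhp, hh, hW]; field_simp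
  have n2 : ‖∫ θ in (a - h)..a, E θ * f θ‖ ≤ Real.pi * W := by
    have := intervalIntegral.norm_integral_le_of_norm_le_const (a := a - h) (b := a)
      (f := fun θ => E θ * f θ) (C := C * B ^ (-(1 / 2) : ℝ) * x / truncMean F x) (by
        intro θ hθ
        rw [Set.uIoc_of_le (by linarith)] at hθ
        exact bd θ (by linarith [hθ.1]) hθ.2)
    refine this.trans (le_of_eq ?_)
    rw [sub_sub_cancel, abs_of_pos hhp, hh, hW]; field_simp
  have n3 : ‖∫ θ in c..(a - h), E θ * (f θ - f (θ + h))‖ ≤ 2 * W := by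
    have hi : IntervalIntegrable (fun θ : ℝ => C * x ^ (-(1 / 2) : ℝ) / truncMean F x *
        θ ^ (-(3 / 2) : ℝ)) volume c (a - h) :=
      (intervalIntegral.intervalIntegrable_rpow (Or.inr (by
        rw [Set.uIcc_of_le hch]; intro h0; linarith [h0.1]))).const_mul _
    have := intervalIntegral.norm_integral_le_of_norm_le (μ := volume) hch
      (f := fun θ => E θ * (f θ - f (θ + h))) (Eventually.of_forall fun θ hθ => by
        rw [norm_mul, hEn, one_mul]
        refine (h2 θ (by linarith [hθ.1]) hθ.2).trans (le_of_eq ?_)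
        ring) hi
    refine this.trans ?_
    rw [intervalIntegral.integral_const_mul, integral_rpow (Or.inr ⟨by norm_num, by
      rw [Set.uIcc_of_le hch]; intro h0; linarith [h0.1]⟩)]
    have e : (-(3 / 2) + 1 : ℝ) = -(1 / 2) := by norm_num
    rw [e]
    have q0 : 0 ≤ (a - h) ^ (-(1 / 2) : ℝ) := Real.rpow_nonneg (by linarith) _
    have q1 : ((a - h) ^ (-(1 / 2) : ℝ) - c ^ (-(1 / 2) : ℝ)) / (-(1 / 2)) ≤
        2 * c ^ (-(1 / 2) : ℝ) := by
      rw [div_le_iff_of_neg (by norm_num)]; linarith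
    have q2 : x ^ (-(1 / 2) : ℝ) * c ^ (-(1 / 2) : ℝ) = B ^ (-(1 / 2) : ℝ) := by
      rw [← Real.mul_rpow hxp.le hcp.le, hc, mul_div_cancel₀ _ hxp.ne']
    calc _ ≤ C * x ^ (-(1 / 2) : ℝ) / truncMean F x * (2 * c ^ (-(1 / 2) : ℝ)) := by gcongr
      _ = 2 * (C * (x ^ (-(1 / 2) : ℝ) * c ^ (-(1 / 2) : ℝ)) / truncMean F x) := by ring
      _ = _ := by rw [q2]
  have hWp : 0 ≤ W := by positivity
  have : 2 * ‖∫ θ in c..a, E θ * f θ‖ ≤ (2 * Real.pi + 2) * W := by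
    have e : ‖(2 : ℂ) * ∫ θ in c..a, E θ * f θ‖ = 2 * ‖∫ θ in c..a, E θ * f θ‖ := by
      rw [norm_mul]; norm_num
    rw [← e, s4]
    refine (norm_add_le _ _).trans ?_
    have := norm_add_le (∫ θ in c..(c + h), E θ * f θ) (∫ θ in (a - h)..a, E θ * f θ)
    linarith
  have e : (2 * Real.pi + 2) * C * B ^ (-(1 / 2) : ℝ) / truncMean F x = (2 * Real.pi + 2) * W := by
    rw [hW]; ring
  rw [e]
  have : 0 ≤ ‖∫ θ in c..a, E θ * f θ‖ := norm_nonneg _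
  linarith

end Outer

end RelStableRenewal


namespace RelStableRenewal

/-! ### The constant π/2 and the kernel ∫ (1 - cos(y/t)) A(t)⁻² dt. -/

section Constants

lemma integral_mul_exp_neg {u : ℝ} (hu : 0 < u) :
    IntegrableOn (fun t => t * Real.exp (-(u * t))) (Set.Ioi 0) ∧
      ∫ t in Set.Ioi (0 : ℝ), t * Real.exp (-(u * t)) = 1 / u ^ 2 := by
  have h := Real.integral_rpow_mul_exp_neg_mul_Ioi (a := 2) (by norm_num) hu
  have e : ∫ t in Set.Ioi (0 : ℝ), t * Real.exp (-(u * t)) = 1 / u ^ 2 := by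
    rw [Real.Gamma_two] at h
    norm_num at h ⊢
    exact h
  refine ⟨Integrable.of_integral_ne_zero ?_, e⟩
  rw [e]; positivity

lemma integral_exp_mul_one_sub_cos {t : ℝ} (ht : 0 < t) :
    IntegrableOn (fun u => Real.exp (-(t * u)) * (1 - Real.cos u)) (Set.Ioi 0) ∧
      ∫ u in Set.Ioi (0 : ℝ), Real.exp (-(t * u)) * (1 - Real.cos u) = 1 / (t * (1 + t ^ 2)) := by
  have r1 : (-(t : ℂ)).re < 0 := by simpa using ht
  have r2 : (-(t : ℂ) + Complex.I).re < 0 := by simpa using ht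
  have i1 := integrableOn_exp_mul_complex_Ioi r1 0
  have i2 := integrableOn_exp_mul_complex_Ioi r2 0
  have hi := (i1.sub i2).re
  have e : ∀ u : ℝ, RCLike.re ((Complex.exp (-(t : ℂ) * u) - Complex.exp ((-(t : ℂ) + Complex.I) * u)))
      = Real.exp (-(t * u)) * (1 - Real.cos u) := by
    intro u
    simp only [RCLike.re_eq_complex_re, Complex.sub_re, Complex.exp_re]
    simp
    ring
  simp only [Pi.sub_apply, e] at hi
  refine ⟨hi, ?_⟩
  have h := integral_re (i1.sub i2)
  simp only [Pi.sub_apply, e] at h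
  rw [h, integral_sub i1 i2, integral_exp_mul_complex_Ioi r1, integral_exp_mul_complex_Ioi r2]
  simp [Complex.div_re, Complex.normSq_apply]
  field_simp
  ring

/-- With 1/u² = ∫_0^∞ t e^{-ut} dt and Tonelli, the integral becomes ∫_0^∞ (1 + t²)⁻¹ dt. Working in
[0, ∞] lets the same computation supply the integrability. -/
lemma lintegral_one_sub_cos_div_sq :
    ∫⁻ u in Set.Ioi (0 : ℝ), ENNReal.ofReal ((1 - Real.cos u) / u ^ 2) =
      ENNReal.ofReal (Real.pi / 2) := by
  have h1 : ∀ u ∈ Set.Ioi (0 : ℝ), ENNReal.ofReal ((1 - Real.cos u) / u ^ 2) =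
      ∫⁻ t in Set.Ioi (0 : ℝ), ENNReal.ofReal (t * Real.exp (-(u * t)) * (1 - Real.cos u)) := by
    intro u hu
    obtain ⟨i, e⟩ := integral_mul_exp_neg hu
    rw [← ofReal_integral_eq_lintegral_ofReal (i.mul_const _), integral_mul_const, e]
    · congr 1; ring
    · filter_upwards [ae_restrict_mem measurableSet_Ioi] with t ht
      have := Real.cos_le_one u
      have ht : 0 < t := ht
      exact mul_nonneg (by positivity) (by linarith)
  have h2 : ∀ t ∈ Set.Ioi (0 : ℝ), ∫⁻ u in Set.Ioi (0 : ℝ),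
      ENNReal.ofReal (t * Real.exp (-(u * t)) * (1 - Real.cos u)) =
      ENNReal.ofReal ((1 + t ^ 2)⁻¹) := by
    intro t ht
    have ht : 0 < t := ht
    obtain ⟨i, e⟩ := integral_exp_mul_one_sub_cos ht
    have e2 : ∀ u, t * Real.exp (-(u * t)) * (1 - Real.cos u) =
        t * (Real.exp (-(t * u)) * (1 - Real.cos u)) := by intro u; rw [mul_comm u t, mul_assoc]
    simp_rw [e2]
    rw [← ofReal_integral_eq_lintegral_ofReal (i.const_mul t), integral_const_mul, e]
    · congr 1; field_simp
    · refine Eventually.of_forall fun u => ?_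
      have := Real.cos_le_one u
      exact mul_nonneg ht.le (mul_nonneg (by positivity) (by linarith))
  rw [setLIntegral_congr_fun measurableSet_Ioi h1, lintegral_lintegral_swap (by fun_prop),
    setLIntegral_congr_fun measurableSet_Ioi h2,
    ← ofReal_integral_eq_lintegral_ofReal integrable_inv_one_add_sq.integrableOn
      (Eventually.of_forall fun t => by positivity), integral_Ioi_inv_one_add_sq]
  simp

lemma one_sub_cos_div_sq_nonneg (u : ℝ) : 0 ≤ (1 - Real.cos u) / u ^ 2 :=
  div_nonneg (by linarith [Real.cos_le_one u]) (by positivity)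

lemma integrableOn_one_sub_cos_div_sq :
    IntegrableOn (fun u : ℝ => (1 - Real.cos u) / u ^ 2) (Set.Ioi 0) := by
  refine ⟨Measurable.aestronglyMeasurable (by fun_prop), ?_⟩
  rw [hasFiniteIntegral_iff_ofReal (Eventually.of_forall one_sub_cos_div_sq_nonneg),
    lintegral_one_sub_cos_div_sq]
  exact ENNReal.ofReal_lt_top

lemma integral_one_sub_cos_div_sq :
    ∫ u in Set.Ioi (0 : ℝ), (1 - Real.cos u) / u ^ 2 = Real.pi / 2 := by
  rw [integral_eq_lintegral_of_nonneg_ae (Eventually.of_forall one_sub_cos_div_sq_nonneg)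
    (Measurable.aestronglyMeasurable (by fun_prop)), lintegral_one_sub_cos_div_sq,
    ENNReal.toReal_ofReal (by positivity)]

lemma integrableOn_one_sub_cos_inv :
    IntegrableOn (fun v : ℝ => 1 - Real.cos v⁻¹) (Set.Ioi 0) := by
  rw [← integrableOn_Ioi_comp_rpow_iff (fun v : ℝ => 1 - Real.cos v⁻¹) (p := -1) (by norm_num)]
  refine integrableOn_one_sub_cos_div_sq.congr_fun (fun u hu => ?_) measurableSet_Ioi
  have hu : 0 < u := hu
  have e : u ^ (-1 - 1 : ℝ) = (u ^ 2)⁻¹ := by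
    rw [← Real.rpow_natCast, ← Real.rpow_neg hu.le]; norm_num
  simp only [e, Real.rpow_neg_one, inv_inv, smul_eq_mul]
  simp [div_eq_inv_mul]

lemma integral_one_sub_cos_inv :
    ∫ v in Set.Ioi (0 : ℝ), (1 - Real.cos v⁻¹) = Real.pi / 2 := by
  rw [← integral_comp_rpow_Ioi (fun v : ℝ => 1 - Real.cos v⁻¹) (p := -1) (by norm_num),
    ← integral_one_sub_cos_div_sq]
  refine setIntegral_congr_fun measurableSet_Ioi (fun u hu => ?_)
  have hu : 0 < u := hu
  have e : u ^ (-1 - 1 : ℝ) = (u ^ 2)⁻¹ := by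
    rw [← Real.rpow_natCast, ← Real.rpow_neg hu.le]; norm_num
  simp only [e, Real.rpow_neg_one, inv_inv, smul_eq_mul]
  simp [div_eq_inv_mul]

lemma one_sub_cos_le_half_sq (u : ℝ) : 1 - Real.cos u ≤ u ^ 2 / 2 := by
  linarith [Real.one_sub_sq_div_two_le_cos (x := u)]

/-- The weight `v ^ (1 / 2) + v ^ (-1 / 2)` in the uniform slow variation bound. -/
noncomputable def potterWeight (v : ℝ) : ℝ := v ^ (1 / 2 : ℝ) + (v⁻¹) ^ (1 / 2 : ℝ)

lemma potterWeight_nonneg {v : ℝ} (hv : 0 ≤ v) : 0 ≤ potterWeight v := by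
  unfold potterWeight; positivity

@[fun_prop]
lemma measurable_potterWeight : Measurable potterWeight := by
  unfold potterWeight; fun_prop

lemma potterWeight_eq {v : ℝ} (hv : 0 < v) :
    potterWeight v = v ^ (1 / 2 : ℝ) + v ^ (-(1 / 2) : ℝ) := by
  rw [potterWeight, Real.inv_rpow hv.le, Real.rpow_neg hv.le]

/-- Near 0 the weight v^(-1/2) is integrable against a bounded factor; at infinity 1 - cos(1/v) ≤
v⁻²/2 beats v^(1/2). -/
lemma integrableOn_one_sub_cos_inv_mul_potterWeight :
    IntegrableOn (fun v : ℝ => (1 - Real.cos v⁻¹) * potterWeight v) (Set.Ioi 0) := by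
  have hn : ∀ v : ℝ, 0 < v → 0 ≤ (1 - Real.cos v⁻¹) * potterWeight v := fun v hv =>
    mul_nonneg (by linarith [Real.cos_le_one v⁻¹]) (potterWeight_nonneg hv.le)
  rw [← Set.Ioc_union_Ioi_eq_Ioi (zero_le_one (α := ℝ))]
  refine IntegrableOn.union ?_ ?_
  · have hi : IntegrableOn (fun v : ℝ => 4 * v ^ (-(1 / 2) : ℝ)) (Set.Ioc 0 1) := by
      have := (intervalIntegral.intervalIntegrable_rpow' (a := 0) (b := 1) (r := -(1 / 2))
        (by norm_num)).const_mul 4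
      rwa [intervalIntegrable_iff_integrableOn_Ioc_of_le zero_le_one] at this
    refine hi.mono' (Measurable.aestronglyMeasurable (by fun_prop)) ?_
    filter_upwards [ae_restrict_mem measurableSet_Ioc] with v hv
    rw [Real.norm_of_nonneg (hn v hv.1), potterWeight_eq hv.1]
    have h1 : v ^ (1 / 2 : ℝ) ≤ v ^ (-(1 / 2) : ℝ) :=
      Real.rpow_le_rpow_of_exponent_ge hv.1 hv.2 (by norm_num)
    have h2 : 1 - Real.cos v⁻¹ ≤ 2 := by linarith [Real.neg_one_le_cos v⁻¹]
    have h3 : 0 ≤ v ^ (1 / 2 : ℝ) := Real.rpow_nonneg hv.1.le _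
    have h5 : 0 ≤ v ^ (-(1 / 2) : ℝ) := Real.rpow_nonneg hv.1.le _
    calc _ ≤ 2 * (v ^ (-(1 / 2) : ℝ) + v ^ (-(1 / 2) : ℝ)) := by gcongr
      _ = _ := by ring
  · have hi : IntegrableOn (fun v : ℝ => v ^ (-(3 / 2) : ℝ)) (Set.Ioi 1) :=
      integrableOn_Ioi_rpow_of_lt (by norm_num) one_pos
    refine hi.mono' (Measurable.aestronglyMeasurable (by fun_prop)) ?_
    filter_upwards [ae_restrict_mem measurableSet_Ioi] with v hv
    have hv1 : 1 < v := hv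
    have hv0 : 0 < v := by linarith
    rw [Real.norm_of_nonneg (hn v hv0), potterWeight_eq hv0]
    have h1 : v ^ (-(1 / 2) : ℝ) ≤ v ^ (1 / 2 : ℝ) :=
      Real.rpow_le_rpow_of_exponent_le hv1.le (by norm_num)
    have h2 := one_sub_cos_le_half_sq v⁻¹
    have h4 : v ^ (-(3 / 2) : ℝ) = v⁻¹ ^ 2 * v ^ (1 / 2 : ℝ) := by
      rw [← Real.rpow_natCast, ← Real.rpow_neg_one, ← Real.rpow_mul hv0.le, ← Real.rpow_add hv0]
      norm_num
    calc _ ≤ v⁻¹ ^ 2 / 2 * (v ^ (1 / 2 : ℝ) + v ^ (1 / 2 : ℝ)) := by gcongr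
      _ = _ := by rw [h4]; ring

lemma integral_one_sub_cos_div {y : ℝ} (hy : 0 < y) :
    IntegrableOn (fun t : ℝ => 1 - Real.cos (y / t)) (Set.Ioi 0) ∧
      ∫ t in Set.Ioi (0 : ℝ), (1 - Real.cos (y / t)) = y * (Real.pi / 2) := by
  have e : ∀ t : ℝ, 1 - Real.cos (y / t) = 1 - Real.cos (y⁻¹ * t)⁻¹ := by
    intro t; rw [mul_inv, inv_inv, div_eq_mul_inv]
  simp_rw [e]
  have hyi : 0 < y⁻¹ := inv_pos.2 hy
  refine ⟨?_, ?_⟩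
  · rw [integrableOn_Ioi_comp_mul_left_iff (fun v => 1 - Real.cos v⁻¹) 0 hyi, mul_zero]
    exact integrableOn_one_sub_cos_inv
  · rw [integral_comp_mul_left_Ioi (fun v => 1 - Real.cos v⁻¹) 0 hyi, mul_zero,
      integral_one_sub_cos_inv, inv_inv, smul_eq_mul]

lemma integral_one_sub_cos_div_mul_potterWeight {y : ℝ} (hy : 0 < y) :
    IntegrableOn (fun t : ℝ => (1 - Real.cos (y / t)) * potterWeight (t / y)) (Set.Ioi 0) ∧
      ∫ t in Set.Ioi (0 : ℝ), (1 - Real.cos (y / t)) * potterWeight (t / y) =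
        y * ∫ v in Set.Ioi (0 : ℝ), (1 - Real.cos v⁻¹) * potterWeight v := by
  have e : ∀ t : ℝ, (1 - Real.cos (y / t)) * potterWeight (t / y) =
      (1 - Real.cos (y⁻¹ * t)⁻¹) * potterWeight (y⁻¹ * t) := by
    intro t; rw [mul_inv, inv_inv, div_eq_mul_inv, div_eq_inv_mul]
  simp_rw [e]
  have hyi : 0 < y⁻¹ := inv_pos.2 hy
  refine ⟨?_, ?_⟩
  · rw [integrableOn_Ioi_comp_mul_left_iff (fun v => (1 - Real.cos v⁻¹) * potterWeight v) 0 hyi,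
      mul_zero]
    exact integrableOn_one_sub_cos_inv_mul_potterWeight
  · rw [integral_comp_mul_left_Ioi (fun v => (1 - Real.cos v⁻¹) * potterWeight v) 0 hyi, mul_zero,
      inv_inv, smul_eq_mul]

lemma integral_potterWeight_div_le {y : ℝ} (hy : 0 < y) :
    IntervalIntegrable (fun t => potterWeight (t / y)) volume 0 y ∧
      ∫ t in (0 : ℝ)..y, potterWeight (t / y) ≤ 3 * y := by
  have i1 : IntervalIntegrable (fun v : ℝ => v ^ (1 / 2 : ℝ)) volume 0 1 :=
    intervalIntegral.intervalIntegrable_rpow' (by norm_num)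
  have i2 : IntervalIntegrable (fun v : ℝ => v ^ (-(1 / 2) : ℝ)) volume 0 1 :=
    intervalIntegral.intervalIntegrable_rpow' (by norm_num)
  have h0 : IntervalIntegrable potterWeight volume 0 1 :=
    (i1.add i2).congr fun v hv => by
      rw [Set.uIoc_of_le zero_le_one] at hv
      exact (potterWeight_eq hv.1).symm
  refine ⟨?_, ?_⟩
  · have := h0.comp_mul_left (c := y⁻¹)
    simp only [div_inv_eq_mul, zero_mul, one_mul] at this
    convert this using 2 with t
    rw [div_eq_inv_mul]
  · rw [intervalIntegral.integral_comp_div _ hy.ne', zero_div, div_self hy.ne', smul_eq_mul,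
      mul_comm]
    have : ∫ v in (0 : ℝ)..1, potterWeight v =
        ∫ v in (0 : ℝ)..1, (v ^ (1 / 2 : ℝ) + v ^ (-(1 / 2) : ℝ)) := by
      refine intervalIntegral.integral_congr_ae (Eventually.of_forall fun v hv => ?_)
      rw [Set.uIoc_of_le zero_le_one] at hv
      exact potterWeight_eq hv.1
    rw [this, intervalIntegral.integral_add i1 i2, integral_rpow (Or.inl (by norm_num)),
      integral_rpow (Or.inl (by norm_num))]
    norm_num
    nlinarith

variable {F : Measure ℝ} [IsProbabilityMeasure F]

set_option maxHeartbeats 400000 in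
/-- Comparison of the Fourier kernel of `1 - Re φ` with the primitive of `1 / A²`. -/
lemma CondHa.kernel_comparison (hHa : CondHa F) {ε : ℝ} (hε : 0 < ε) :
    ∃ C x₀ : ℝ, 0 ≤ C ∧ 1 ≤ x₀ ∧ ∀ x y, x₀ ≤ x → x ≤ y →
      IntegrableOn (fun t => (1 - Real.cos (y / t)) / truncMean F t ^ 2) (Set.Ioi x) ∧
      |(∫ t in Set.Ioi x, (1 - Real.cos (y / t)) / truncMean F t ^ 2)
          - Real.pi / 2 * ∫ t in x..y, 1 / truncMean F t ^ 2| ≤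
        ε * (∫ t in x..y, 1 / truncMean F t ^ 2) + C * (x / truncMean F x ^ 2) := by
  set C₁ := ∫ v in Set.Ioi (0 : ℝ), (1 - Real.cos v⁻¹) * potterWeight v with hC₁
  have hC₁0 : 0 ≤ C₁ := by
    refine setIntegral_nonneg measurableSet_Ioi fun v hv => ?_
    exact mul_nonneg (by linarith [Real.cos_le_one v⁻¹]) (potterWeight_nonneg (le_of_lt hv))
  set C₂ := 2 * (C₁ + 6) + 4 with hC₂
  have hC₂0 : 0 < C₂ := by positivity
  -- The bound 1/6 makes 3η ≤ 1/2, so that the error in the second comparison is absorbed; 3ηC₂ ≤ ε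
  -- is the final coefficient of ∫ A⁻².
  set η := min (1 / 6) (ε / (3 * C₂)) with hη
  have hη0 : 0 < η := by positivity
  have hη1 : η ≤ 1 / 6 := min_le_left _ _
  have hη2 : η * (3 * C₂) ≤ ε := by
    rw [← le_div_iff₀ (by positivity)]; exact min_le_right _ _
  obtain ⟨x₀, h1, hpos, hSV⟩ := hHa.slowVariation hη0
  obtain ⟨x₁, h2, -, hP⟩ := hHa.potter (η := 1 / 2) (by norm_num)
  refine ⟨C₂ * (8 * η⁻¹), max x₀ x₁, by positivity, h1.trans (le_max_left _ _),
    fun x y hx hxy => ?_⟩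
  have hx0 : x₀ ≤ x := (le_max_left _ _).trans hx
  have hx1 : x₁ ≤ x := (le_max_right _ _).trans hx
  have hxp : 0 < x := by linarith
  have hyp : 0 < y := by linarith
  have hAx := hpos x hx0
  have hAy := hpos y (hx0.trans hxy)
  -- Both integrals are compared with their values when A is frozen at y: Gyπ/2 for the cosine
  -- kernel and G(y - x) for the primitive. The two-sided weight controls t on either side of y.
  set G := (truncMean F y ^ 2)⁻¹ with hG
  have hGp : 0 < G := by positivity
  have hbd : ∀ t, x ≤ t → |(truncMean F t ^ 2)⁻¹ - G| ≤ η * G * potterWeight (t / y) := by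
    intro t ht
    have h3 := (hSV y t (hx0.trans hxy) (hx0.trans ht)).2
    have e : (truncMean F t ^ 2)⁻¹ - G = G * (truncMean F y ^ 2 / truncMean F t ^ 2 - 1) := by
      rw [hG]; field_simp
    rw [e, abs_mul, abs_of_pos hGp, potterWeight, inv_div]
    calc _ ≤ G * (η * ((y / t) ^ (1 / 2 : ℝ) + (t / y) ^ (1 / 2 : ℝ))) := by gcongr
      _ = _ := by ring
  have hAm : Measurable (truncMean F) := (continuous_truncMean F).measurable
  obtain ⟨ia, ea⟩ := integral_one_sub_cos_div hyp
  obtain ⟨ib, eb⟩ := integral_one_sub_cos_div_mul_potterWeight hyp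
  have hsub : Set.Ioi x ⊆ Set.Ioi 0 := Set.Ioi_subset_Ioi hxp.le
  have ia' := ia.mono_set hsub
  have ib' := ib.mono_set hsub
  have hcos : ∀ t : ℝ, 0 ≤ 1 - Real.cos (y / t) := fun t => by linarith [Real.cos_le_one (y / t)]
  have hdiff : ∀ t ∈ Set.Ioi x, ‖(1 - Real.cos (y / t)) * ((truncMean F t ^ 2)⁻¹ - G)‖ ≤
      η * G * ((1 - Real.cos (y / t)) * potterWeight (t / y)) := by
    intro t ht
    rw [norm_mul, Real.norm_of_nonneg (hcos t), Real.norm_eq_abs]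
    calc _ ≤ (1 - Real.cos (y / t)) * (η * G * potterWeight (t / y)) := by
          gcongr
          · exact hcos t
          · exact hbd t (le_of_lt ht)
      _ = _ := by ring
  have idiff : IntegrableOn (fun t => (1 - Real.cos (y / t)) * ((truncMean F t ^ 2)⁻¹ - G))
      (Set.Ioi x) := by
    refine Integrable.mono' (ib'.const_mul (η * G)) (Measurable.aestronglyMeasurable (by fun_prop)) ?_
    filter_upwards [ae_restrict_mem measurableSet_Ioi] with t ht using hdiff t ht
  have ik : IntegrableOn (fun t => (1 - Real.cos (y / t)) / truncMean F t ^ 2) (Set.Ioi x) := by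
    have := idiff.add (ia'.const_mul G)
    refine this.congr_fun (fun t _ => ?_) measurableSet_Ioi
    simp only [Pi.add_apply]; ring
  refine ⟨ik, ?_⟩
  set k₁ := ∫ t in Set.Ioi x, (1 - Real.cos (y / t)) / truncMean F t ^ 2 with hk₁
  set k₂ := ∫ t in x..y, 1 / truncMean F t ^ 2 with hk₂
  have s1 : |k₁ - G * (y * (Real.pi / 2))| ≤ G * (η * C₁ * y + 2 * x) := by
    have e1 : k₁ = (∫ t in Set.Ioi x, (1 - Real.cos (y / t)) * ((truncMean F t ^ 2)⁻¹ - G)) +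
        G * ∫ t in Set.Ioi x, (1 - Real.cos (y / t)) := by
      rw [← integral_const_mul, ← integral_add idiff (ia'.const_mul G)]
      refine setIntegral_congr_fun measurableSet_Ioi fun t _ => ?_
      ring
    have e2 : y * (Real.pi / 2) = (∫ t in Set.Ioc 0 x, (1 - Real.cos (y / t))) +
        ∫ t in Set.Ioi x, (1 - Real.cos (y / t)) := by
      rw [← ea, ← Set.Ioc_union_Ioi_eq_Ioi hxp.le]
      exact setIntegral_union Set.Ioc_disjoint_Ioi_same measurableSet_Ioi
        (ia.mono_set Set.Ioc_subset_Ioi_self) ia'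
    have e3 : |∫ t in Set.Ioi x, (1 - Real.cos (y / t)) * ((truncMean F t ^ 2)⁻¹ - G)| ≤
        η * G * (y * C₁) := by
      rw [← eb, ← Real.norm_eq_abs]
      have := norm_integral_le_of_norm_le (ib'.const_mul (η * G))
        ((ae_restrict_mem measurableSet_Ioi).mono hdiff)
      refine this.trans ?_
      rw [integral_const_mul]
      refine mul_le_mul_of_nonneg_left ?_ (by positivity)
      refine setIntegral_mono_set ib ?_ hsub.eventuallyLE
      filter_upwards [ae_restrict_mem measurableSet_Ioi] with t ht
      have ht : 0 < t := ht
      exact mul_nonneg (hcos t) (potterWeight_nonneg (by positivity))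
    have e4 : |∫ t in Set.Ioc 0 x, (1 - Real.cos (y / t))| ≤ 2 * x := by
      have := norm_setIntegral_le_of_norm_le_const (μ := volume) (s := Set.Ioc 0 x) (C := 2)
        (f := fun t => 1 - Real.cos (y / t)) (by simp) (fun t _ => by
          rw [Real.norm_of_nonneg (hcos t)]; linarith [Real.neg_one_le_cos (y / t)])
      simpa [hxp.le] using this
    rw [e1, e2]
    calc |_| = |(∫ t in Set.Ioi x, (1 - Real.cos (y / t)) * ((truncMean F t ^ 2)⁻¹ - G)) -
          G * ∫ t in Set.Ioc 0 x, (1 - Real.cos (y / t))| := by congr 1; ring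
      _ ≤ η * G * (y * C₁) + G * (2 * x) := by
          refine (abs_sub _ _).trans (add_le_add e3 ?_)
          rw [abs_mul, abs_of_pos hGp]; gcongr
      _ = _ := by ring
  have s2 : |k₂ - G * (y - x)| ≤ 3 * η * G * y := by
    have hne : ∀ t ∈ Set.uIcc x y, truncMean F t ≠ 0 := fun t ht => by
      rw [Set.uIcc_of_le hxy] at ht; exact (hpos t (hx0.trans ht.1)).ne'
    have i3 : IntervalIntegrable (fun t => 1 / truncMean F t ^ 2) volume x y :=
      ContinuousOn.intervalIntegrable (continuousOn_const.div
        ((continuous_truncMean F).pow 2).continuousOn fun t ht => pow_ne_zero 2 (hne t ht))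
    obtain ⟨i4, e4⟩ := integral_potterWeight_div_le hyp
    have i5 := i4.mono_set (c := x) (d := y) (by
      rw [Set.uIcc_of_le hxy, Set.uIcc_of_le hyp.le]; exact Set.Icc_subset_Icc_left hxp.le)
    have e5 : k₂ - G * (y - x) = ∫ t in x..y, (1 / truncMean F t ^ 2 - G) := by
      rw [intervalIntegral.integral_sub i3 (by simp)]; simp [hk₂, mul_comm]
    rw [e5, ← Real.norm_eq_abs]
    refine (intervalIntegral.norm_integral_le_of_norm_le hxy (Eventually.of_forall fun t ht => ?_)
      (i5.const_mul (η * G))).trans ?_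
    · rw [one_div, Real.norm_eq_abs]; exact hbd t ht.1.le
    · rw [intervalIntegral.integral_const_mul]
      have : ∫ t in x..y, potterWeight (t / y) ≤ ∫ t in (0 : ℝ)..y, potterWeight (t / y) := by
        refine intervalIntegral.integral_mono_interval hxp.le hxy le_rfl ?_ i4
        filter_upwards [ae_restrict_mem measurableSet_Ioc] with t ht
        exact potterWeight_nonneg (div_nonneg ht.1.le hyp.le)
      calc _ ≤ η * G * (3 * y) := by gcongr; exact this.trans e4
        _ = _ := by ring
  have hk₂0 : 0 ≤ k₂ := intervalIntegral.integral_nonneg hxy fun t _ => by positivity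
  have hpi := Real.pi_lt_four
  have hpi0 := Real.pi_pos
  have s3 : |k₁ - Real.pi / 2 * k₂| ≤ G * (η * (C₁ + 6) * y + 4 * x) := by
    have a1 := abs_le.1 s1
    have a2 := abs_le.1 s2
    have b1 : 0 < G * x := by positivity
    have b2 : 0 ≤ 3 * η * G * y := by positivity
    have c1 : Real.pi / 2 * (k₂ - G * (y - x)) ≤ 2 * (3 * η * G * y) := by
      calc _ ≤ Real.pi / 2 * (3 * η * G * y) := by gcongr; exact a2.2
        _ ≤ _ := by gcongr; linarith
    have c2 : -(2 * (3 * η * G * y)) ≤ Real.pi / 2 * (k₂ - G * (y - x)) := by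
      have : Real.pi / 2 * (3 * η * G * y) ≤ 2 * (3 * η * G * y) := by gcongr; linarith
      have := mul_le_mul_of_nonneg_left a2.1 (by positivity : 0 ≤ Real.pi / 2)
      linarith
    have c3 : Real.pi / 2 * (G * x) ≤ 2 * (G * x) := by gcongr; linarith
    have c4 : 0 ≤ Real.pi / 2 * (G * x) := by positivity
    rw [abs_le]
    constructor <;> linarith [a1.1, a1.2]
  have s4 : G * y ≤ 2 * k₂ + 2 * (G * x) := by
    have a2 := abs_le.1 s2
    have : 3 * η * G * y ≤ 1 / 2 * (G * y) := by
      calc 3 * η * G * y ≤ 3 * (1 / 6) * G * y := by gcongr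
        _ = _ := by ring
    linarith
  -- Either x ≤ ηy and the first term dominates, or y/x < 1/η and Potter compares A(y) with A(x).
  have s5 : G * x ≤ η * (G * y) + η⁻¹ * (x / truncMean F x ^ 2) := by
    rcases le_total x (η * y) with h | h
    · have : 0 ≤ η⁻¹ * (x / truncMean F x ^ 2) := by positivity
      calc G * x ≤ G * (η * y) := by gcongr
        _ = η * (G * y) := by ring
        _ ≤ _ := by linarith
    · have h3 := (hP x y hx1 hxy).2
      have h4 : truncMean F x ^ 2 ≤ (y / x) * truncMean F y ^ 2 := by
        have h5 := pow_le_pow_left₀ hAx.le h3 2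
        rw [mul_pow, ← Real.rpow_natCast, ← Real.rpow_natCast, ← Real.rpow_mul (by positivity)] at h5
        norm_num at h5
        exact h5
      have h6 : y / x ≤ η⁻¹ := by
        rw [div_le_iff₀ hxp, inv_mul_eq_div, le_div_iff₀ hη0]; linarith
      have h7 : G ≤ η⁻¹ / truncMean F x ^ 2 := by
        rw [hG, le_div_iff₀ (by positivity), inv_mul_eq_div, div_le_iff₀ (by positivity)]
        exact h4.trans (by gcongr)
      have : 0 ≤ η * (G * y) := by positivity
      calc G * x ≤ η⁻¹ / truncMean F x ^ 2 * x := by gcongr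
        _ = η⁻¹ * (x / truncMean F x ^ 2) := by ring
        _ ≤ _ := by linarith
  set X := x / truncMean F x ^ 2 with hX
  have hX0 : 0 ≤ X := by positivity
  have hηi : 0 < η⁻¹ := by positivity
  have s6 : G * y ≤ 3 * k₂ + 4 * (η⁻¹ * X) := by
    have : 0 ≤ G * y := by positivity
    have : η * (G * y) ≤ 1 / 6 * (G * y) := by gcongr
    have : 0 ≤ η⁻¹ * X := by positivity
    linarith
  have s7 : G * x ≤ 3 * η * k₂ + 4 * (η⁻¹ * X) := by
    have q1 : η * (G * y) ≤ η * (3 * k₂ + 4 * (η⁻¹ * X)) := by gcongr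
    have q2 : η * (4 * (η⁻¹ * X)) ≤ 1 / 6 * (4 * (η⁻¹ * X)) := by gcongr
    have : 0 ≤ η⁻¹ * X := by positivity
    linarith
  refine s3.trans ?_
  have hC6 : 0 ≤ C₁ + 6 := by positivity
  calc G * (η * (C₁ + 6) * y + 4 * x) = η * (C₁ + 6) * (G * y) + 4 * (G * x) := by ring
    _ ≤ η * (C₁ + 6) * (3 * k₂ + 4 * (η⁻¹ * X)) + 4 * (3 * η * k₂ + 4 * (η⁻¹ * X)) := by
        gcongr
    _ ≤ η * (3 * C₂) * k₂ + C₂ * (8 * η⁻¹) * X := by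
        rw [hC₂]
        generalize C₁ + 6 = P at hC6
        have q1 : 0 ≤ P * (η * k₂) := by positivity
        have q2 : 0 ≤ P * (η⁻¹ * X) := by positivity
        have q4 : 0 ≤ η⁻¹ * X := by positivity
        have q3 : η * P * (4 * (η⁻¹ * X)) ≤ 1 * P * (4 * (η⁻¹ * X)) := by
          gcongr; linarith
        linarith
    _ ≤ _ := by gcongr

end Constants

end RelStableRenewal


namespace RelStableRenewal

/-! ### The integral of Re (1 - φ)⁻¹ near 0 and the tail integral of H/A². -/

section RealPart

/-- `∫_x^∞ H(t) / A(t)² dt`, with values in `[0, ∞]`. -/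
noncomputable def tailRatio (F : Measure ℝ) (x : ℝ) : ℝ≥0∞ :=
  ∫⁻ t in Set.Ioi x, ENNReal.ofReal (tailSum F t / truncMean F t ^ 2)

/-- `∫_0^{1/x} Re (1 - φ(θ))⁻¹ dθ`, with values in `[0, ∞]`. -/
noncomputable def resolventMass (F : Measure ℝ) (x : ℝ) : ℝ≥0∞ :=
  ∫⁻ θ in Set.Ioo 0 x⁻¹, ENNReal.ofReal ((1 - charFun F θ)⁻¹).re

variable {F : Measure ℝ} [IsProbabilityMeasure F]

/-- For the range |y| ≤ x, not covered by `CondHa.kernel_comparison`: 1 - cos(y/t) ≤ (y/t)²/2 and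
A(t)⁻² ≤ (t/x)^(1/2) A(x)⁻². -/
lemma CondHa.kernel_small (hHa : CondHa F) :
    ∃ x₀ : ℝ, 1 ≤ x₀ ∧ ∀ x y, x₀ ≤ x →
      IntegrableOn (fun t => (1 - Real.cos (y / t)) / truncMean F t ^ 2) (Set.Ioi x) ∧
      ∫ t in Set.Ioi x, (1 - Real.cos (y / t)) / truncMean F t ^ 2 ≤
        y ^ 2 / (x * truncMean F x ^ 2) := by
  obtain ⟨x₀, h1, hH, hP⟩ := hHa.potter_quarter
  refine ⟨x₀, h1, fun x y hx => ?_⟩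
  have hxp : 0 < x := by linarith
  have hAx := (hH x hx).1
  have hAm : Measurable (truncMean F) := (continuous_truncMean F).measurable
  have hi : IntegrableOn (fun t : ℝ => y ^ 2 / (2 * x ^ (1 / 2 : ℝ) * truncMean F x ^ 2) *
      t ^ (-(3 / 2) : ℝ)) (Set.Ioi x) :=
    (integrableOn_Ioi_rpow_of_lt (by norm_num) hxp).const_mul _
  have hcos : ∀ t : ℝ, 0 ≤ 1 - Real.cos (y / t) := fun t => by linarith [Real.cos_le_one (y / t)]
  have hb : ∀ t ∈ Set.Ioi x, (1 - Real.cos (y / t)) / truncMean F t ^ 2 ≤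
      y ^ 2 / (2 * x ^ (1 / 2 : ℝ) * truncMean F x ^ 2) * t ^ (-(3 / 2) : ℝ) := by
    intro t ht
    have hxt : x < t := ht
    have htp : 0 < t := hxp.trans hxt
    have hAt := (hH t (hx.trans hxt.le)).1
    have h3 := (hP x t hx hxt.le).2
    have h4 : truncMean F x ^ 2 ≤ (t / x) ^ (1 / 2 : ℝ) * truncMean F t ^ 2 := by
      have h5 := pow_le_pow_left₀ hAx.le h3 2
      rw [mul_pow, ← Real.rpow_natCast, ← Real.rpow_natCast, ← Real.rpow_mul (by positivity)] at h5
      norm_num at h5 ⊢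
      exact h5
    have e : t ^ (-(3 / 2) : ℝ) = t ^ (1 / 2 : ℝ) / t ^ 2 := by
      rw [← Real.rpow_natCast, ← Real.rpow_sub htp]; norm_num
    rw [div_le_iff₀ (by positivity), e]
    calc 1 - Real.cos (y / t) ≤ (y / t) ^ 2 / 2 := one_sub_cos_le_half_sq _
      _ = (y / t) ^ 2 / 2 * (truncMean F x ^ 2 / truncMean F x ^ 2) := by
          rw [div_self (by positivity), mul_one]
      _ ≤ (y / t) ^ 2 / 2 * ((t / x) ^ (1 / 2 : ℝ) * truncMean F t ^ 2 / truncMean F x ^ 2) := by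
          gcongr
      _ = _ := by rw [Real.div_rpow htp.le hxp.le]; field_simp
  have hk : IntegrableOn (fun t => (1 - Real.cos (y / t)) / truncMean F t ^ 2) (Set.Ioi x) := by
    refine Integrable.mono' hi (Measurable.aestronglyMeasurable (by fun_prop)) ?_
    filter_upwards [ae_restrict_mem measurableSet_Ioi] with t ht
    rw [Real.norm_of_nonneg (div_nonneg (hcos t) (by positivity))]
    exact hb t ht
  refine ⟨hk, (setIntegral_mono_on hk hi measurableSet_Ioi hb).trans (le_of_eq ?_)⟩
  rw [integral_const_mul, integral_Ioi_rpow_of_lt (by norm_num) hxp]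
  have e1 : (-(3 / 2) + 1 : ℝ) = -(1 / 2) := by norm_num
  have e2 : x = x ^ (1 / 2 : ℝ) * x ^ (1 / 2 : ℝ) := by
    rw [← Real.rpow_add hxp]; norm_num
  have hs : 0 < x ^ (1 / 2 : ℝ) := by positivity
  rw [e1, Real.rpow_neg hxp.le]
  calc _ = y ^ 2 / (x ^ (1 / 2 : ℝ) * x ^ (1 / 2 : ℝ) * truncMean F x ^ 2) := by
        generalize x ^ (1 / 2 : ℝ) = s at hs
        field_simp
    _ = _ := by rw [← e2]

/-- Both ranges of |y| in one form. The error min(x, |y|)² / (x A(x)²) is chosen because its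
expectation is the truncated second moment over x A(x)², which is o(1/A(x)). -/
lemma CondHa.kernel_bounds (hHa : CondHa F) {ε : ℝ} (hε : 0 < ε) :
    ∃ C x₀ : ℝ, 0 < C ∧ 1 ≤ x₀ ∧ ∀ x y, x₀ ≤ x →
      IntegrableOn (fun t => (1 - Real.cos (t⁻¹ * y)) / truncMean F t ^ 2) (Set.Ioi x) ∧
      (∫ t in Set.Ioi x, (1 - Real.cos (t⁻¹ * y)) / truncMean F t ^ 2 ≤
        (Real.pi / 2 + ε) * (∫ t in x..(max x |y|), 1 / truncMean F t ^ 2) +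
          C * ((min x |y|) ^ 2 / (x * truncMean F x ^ 2))) ∧
      ((Real.pi / 2 - ε) * (∫ t in x..(max x |y|), 1 / truncMean F t ^ 2) ≤
        (∫ t in Set.Ioi x, (1 - Real.cos (t⁻¹ * y)) / truncMean F t ^ 2) +
          C * ((min x |y|) ^ 2 / (x * truncMean F x ^ 2))) := by
  obtain ⟨C, x₁, hC, hx₁, h1⟩ := hHa.kernel_comparison hε
  obtain ⟨x₂, hx₂, h2⟩ := hHa.kernel_small
  refine ⟨C + 1, max x₁ x₂, by positivity, hx₁.trans (le_max_left _ _), fun x y hx => ?_⟩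
  have hxx₁ : x₁ ≤ x := (le_max_left _ _).trans hx
  have hxx₂ : x₂ ≤ x := (le_max_right _ _).trans hx
  have hxp : 0 < x := by linarith
  have e : ∀ t : ℝ, Real.cos (t⁻¹ * y) = Real.cos (|y| / t) := by
    intro t
    rw [← Real.cos_abs (t⁻¹ * y), ← Real.cos_abs (|y| / t), abs_mul, abs_div, abs_abs, abs_inv]
    ring_nf
  simp_rw [e]
  have hk1 : 0 ≤ ∫ t in Set.Ioi x, (1 - Real.cos (|y| / t)) / truncMean F t ^ 2 :=
    integral_nonneg fun t => div_nonneg (by linarith [Real.cos_le_one (|y| / t)]) (by positivity)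
  rcases le_total x |y| with hy | hy
  · obtain ⟨hi, hb⟩ := h1 x |y| hxx₁ hy
    rw [max_eq_right hy, min_eq_left hy]
    have hb' := abs_le.1 hb
    have e3 : x ^ 2 / (x * truncMean F x ^ 2) = x / truncMean F x ^ 2 := by field_simp
    rw [e3]
    have : 0 ≤ x / truncMean F x ^ 2 := by positivity
    refine ⟨hi, ?_, ?_⟩ <;> linarith
  · obtain ⟨hi, hb⟩ := h2 x |y| hxx₂
    rw [max_eq_left hy, min_eq_right hy, intervalIntegral.integral_same]
    have : 0 ≤ |y| ^ 2 / (x * truncMean F x ^ 2) := by positivity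
    refine ⟨hi, ?_, ?_⟩ <;> nlinarith

lemma ofReal_one_sub_re_div (F : Measure ℝ) [IsProbabilityMeasure F] (θ b : ℝ) :
    ENNReal.ofReal ((1 - (charFun F θ).re) / b ^ 2) =
      ∫⁻ y, ENNReal.ofReal ((1 - Real.cos (θ * y)) / b ^ 2) ∂F := by
  rw [one_sub_re_charFun, ← integral_div, ofReal_integral_eq_lintegral_ofReal]
  · exact ((integrable_const _).sub (integrable_cos_mul F θ)).div_const _
  · exact Eventually.of_forall fun y =>
      div_nonneg (by linarith [Real.cos_le_one (θ * y)]) (by positivity)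

lemma lintegral_one_sub_re_eq {x : ℝ}
    (hi : ∀ y, IntegrableOn (fun t => (1 - Real.cos (t⁻¹ * y)) / truncMean F t ^ 2) (Set.Ioi x)) :
    ∫⁻ t in Set.Ioi x, ENNReal.ofReal ((1 - (charFun F t⁻¹).re) / truncMean F t ^ 2) =
      ∫⁻ y, ENNReal.ofReal (∫ t in Set.Ioi x, (1 - Real.cos (t⁻¹ * y)) / truncMean F t ^ 2) ∂F := by
  have hAm : Measurable (truncMean F) := (continuous_truncMean F).measurable
  simp_rw [ofReal_one_sub_re_div]
  rw [lintegral_lintegral_swap (by fun_prop)]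
  refine lintegral_congr fun y => ?_
  rw [ofReal_integral_eq_lintegral_ofReal (hi y)]
  exact Eventually.of_forall fun t =>
    div_nonneg (by linarith [Real.cos_le_one (t⁻¹ * y)]) (by positivity)

/-- Tonelli, with H(t) = P[|X| > t] for t ≥ 0. -/
lemma tailRatio_eq {x : ℝ} (hx : 0 ≤ x) (hA : ∀ t, x ≤ t → 0 < truncMean F t) :
    tailRatio F x =
      ∫⁻ y, ENNReal.ofReal (∫ t in x..(max x |y|), 1 / truncMean F t ^ 2) ∂F := by
  have hAm : Measurable (truncMean F) := (continuous_truncMean F).measurable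
  have h1 : ∀ y : ℝ, ENNReal.ofReal (∫ t in x..(max x |y|), 1 / truncMean F t ^ 2) =
      ∫⁻ t in Set.Ioi x, (Set.Iio |y|).indicator
        (fun t => ENNReal.ofReal (1 / truncMean F t ^ 2)) t := by
    intro y
    have hle : x ≤ max x |y| := le_max_left _ _
    rw [setLIntegral_indicator measurableSet_Iio, intervalIntegral.integral_of_le hle,
      ofReal_integral_eq_lintegral_ofReal]
    · refine setLIntegral_congr ?_
      have e : Set.Iio |y| ∩ Set.Ioi x = Set.Ioo x (max x |y|) := by
        ext t
        simp only [Set.mem_inter_iff, Set.mem_Iio, Set.mem_Ioi, Set.mem_Ioo, lt_max_iff]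
        constructor
        · rintro ⟨h1, h2⟩; exact ⟨h2, Or.inr h1⟩
        · rintro ⟨h1, h2 | h2⟩
          · linarith
          · exact ⟨h2, h1⟩
      rw [e]; exact Ioo_ae_eq_Ioc.symm
    · refine (intervalIntegrable_iff_integrableOn_Ioc_of_le hle).1 ?_
      refine ContinuousOn.intervalIntegrable (continuousOn_const.div
        ((continuous_truncMean F).pow 2).continuousOn fun t ht => pow_ne_zero 2 ?_)
      rw [Set.uIcc_of_le hle] at ht
      exact (hA t ht.1).ne'
    · exact Eventually.of_forall fun t => by positivity
  simp_rw [h1]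
  have hmeas : MeasurableSet {p : ℝ × ℝ | p.2 < |p.1|} :=
    measurableSet_lt measurable_snd (by fun_prop)
  rw [lintegral_lintegral_swap]
  · refine setLIntegral_congr_fun measurableSet_Ioi fun t ht => ?_
    have ht0 : 0 ≤ t := hx.trans (le_of_lt ht)
    have h2 : ∀ y : ℝ, (Set.Iio |y|).indicator (fun t => ENNReal.ofReal (1 / truncMean F t ^ 2)) t =
        {y : ℝ | t < |y|}.indicator (fun _ => ENNReal.ofReal (1 / truncMean F t ^ 2)) y := by
      intro y; simp [Set.indicator_apply]
    simp_rw [h2]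
    rw [lintegral_indicator (measurableSet_lt measurable_const (by fun_prop)), setLIntegral_const,
      tailSum_eq F ht0, div_eq_inv_mul, ENNReal.ofReal_mul (by positivity), one_div,
      ofReal_measureReal]
  · have : Measurable fun p : ℝ × ℝ => ENNReal.ofReal (1 / truncMean F p.2 ^ 2) := by fun_prop
    exact (this.indicator hmeas).aemeasurable

lemma lintegral_truncSq (F : Measure ℝ) [IsProbabilityMeasure F] {x C D : ℝ} (hx : 0 ≤ x)
    (hC : 0 ≤ C) (hD : 0 ≤ D) :
    ∫⁻ y, ENNReal.ofReal (C * ((min x |y|) ^ 2 / D)) ∂F =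
      ENNReal.ofReal (C * (truncSq F x / D)) := by
  rw [truncSq, ← integral_div, ← integral_const_mul, ofReal_integral_eq_lintegral_ofReal]
  · exact ((integrable_min_abs_sq F hx).div_const _).const_mul _
  · exact Eventually.of_forall fun y => by positivity

omit [IsProbabilityMeasure F] in
lemma measurable_primitive_max (hA : Continuous (truncMean F)) (x : ℝ) :
    Measurable fun y : ℝ => ∫ t in x..(max x |y|), 1 / truncMean F t ^ 2 := by
  have hAm : Measurable (truncMean F) := hA.measurable
  have hmeas : MeasurableSet {p : ℝ × ℝ | p.2 ≤ max x |p.1|} :=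
    measurableSet_le measurable_snd (by fun_prop)
  have h1 : ∀ y : ℝ, ∫ t in x..(max x |y|), 1 / truncMean F t ^ 2 =
      ∫ t in Set.Ioi x, {p : ℝ × ℝ | p.2 ≤ max x |p.1|}.indicator
        (fun p => 1 / truncMean F p.2 ^ 2) (y, t) := by
    intro y
    rw [intervalIntegral.integral_of_le (le_max_left _ _), ← Set.Ioi_inter_Iic,
      ← setIntegral_indicator measurableSet_Iic]
    refine integral_congr_ae (Eventually.of_forall fun t => ?_)
    simp [Set.indicator_apply]
  simp_rw [h1]
  refine StronglyMeasurable.measurable ?_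
  refine StronglyMeasurable.integral_prod_right
    (f := fun y t => {p : ℝ × ℝ | p.2 ≤ max x |p.1|}.indicator
        (fun p => 1 / truncMean F p.2 ^ 2) (y, t)) ?_
  refine Measurable.stronglyMeasurable ?_
  have : Measurable fun p : ℝ × ℝ => 1 / truncMean F p.2 ^ 2 := by fun_prop
  exact this.indicator hmeas

/-- The kernel bounds integrated against F. The inequalities are kept in [0, ∞] in both directions,
so that finiteness of either side passes to the other. -/
lemma CondHa.lintegral_one_sub_re_bounds (hHa : CondHa F) {ε : ℝ} (hε : 0 < ε) (hε1 : ε ≤ 1) :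
    ∃ x₀ : ℝ, 1 ≤ x₀ ∧ ∀ x, x₀ ≤ x → 0 < truncMean F x ∧
      (∫⁻ t in Set.Ioi x, ENNReal.ofReal ((1 - (charFun F t⁻¹).re) / truncMean F t ^ 2) ≤
        ENNReal.ofReal (Real.pi / 2 + ε) * tailRatio F x + ENNReal.ofReal (ε / truncMean F x)) ∧
      (ENNReal.ofReal (Real.pi / 2 - ε) * tailRatio F x ≤
        (∫⁻ t in Set.Ioi x, ENNReal.ofReal ((1 - (charFun F t⁻¹).re) / truncMean F t ^ 2)) +
          ENNReal.ofReal (ε / truncMean F x)) := by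
  obtain ⟨C, x₁, hC, hx₁, h1⟩ := hHa.kernel_bounds hε
  obtain ⟨x₂, hx₂, hpos, -⟩ := hHa.potter one_pos
  obtain ⟨x₃, hx₃, h3⟩ := hHa.truncSq_le (ε := ε / C) (by positivity)
  refine ⟨max (max x₁ x₂) x₃, hx₁.trans ((le_max_left _ _).trans (le_max_left _ _)),
    fun x hx => ?_⟩
  have hxx₁ : x₁ ≤ x := ((le_max_left _ _).trans (le_max_left _ _)).trans hx
  have hxx₂ : x₂ ≤ x := ((le_max_right _ _).trans (le_max_left _ _)).trans hx
  have hxx₃ : x₃ ≤ x := (le_max_right _ _).trans hx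
  have hxp : 0 < x := by linarith
  have hAx := hpos x hxx₂
  refine ⟨hAx, ?_⟩
  rw [lintegral_one_sub_re_eq fun y => (h1 x y hxx₁).1,
    tailRatio_eq hxp.le fun t ht => hpos t (hxx₂.trans ht)]
  have hE : ENNReal.ofReal (C * (truncSq F x / (x * truncMean F x ^ 2))) ≤
      ENNReal.ofReal (ε / truncMean F x) := by
    apply ENNReal.ofReal_le_ofReal
    calc C * (truncSq F x / (x * truncMean F x ^ 2))
        ≤ C * (ε / C * x * truncMean F x / (x * truncMean F x ^ 2)) := by
          gcongr; exact h3 x hxx₃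
      _ = _ := by field_simp
  rw [← lintegral_truncSq F hxp.le hC.le (by positivity)] at hE
  have hpi := Real.pi_gt_three
  have hm := measurable_primitive_max (continuous_truncMean F) x
  have hk2 : ∀ y : ℝ, 0 ≤ ∫ t in x..(max x |y|), 1 / truncMean F t ^ 2 := fun y =>
    intervalIntegral.integral_nonneg (le_max_left _ _) fun t _ => by positivity
  have hE0 : ∀ y : ℝ, 0 ≤ C * ((min x |y|) ^ 2 / (x * truncMean F x ^ 2)) := fun y => by positivity
  have hk1 : ∀ y : ℝ, 0 ≤ ∫ t in Set.Ioi x, (1 - Real.cos (t⁻¹ * y)) / truncMean F t ^ 2 :=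
    fun y => integral_nonneg fun t =>
      div_nonneg (by linarith [Real.cos_le_one (t⁻¹ * y)]) (by positivity)
  have hmE : Measurable fun y : ℝ =>
      ENNReal.ofReal (C * ((min x |y|) ^ 2 / (x * truncMean F x ^ 2))) := by fun_prop
  constructor
  · refine le_trans ?_ (add_le_add_right hE _)
    rw [← lintegral_const_mul _ (by fun_prop), ← lintegral_add_right _ hmE]
    refine lintegral_mono fun y => ?_
    rw [← ENNReal.ofReal_mul (by positivity),
      ← ENNReal.ofReal_add (mul_nonneg (by positivity) (hk2 y)) (hE0 y)]
    exact ENNReal.ofReal_le_ofReal (h1 x y hxx₁).2.1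
  · refine le_trans ?_ (add_le_add_right hE _)
    rw [← lintegral_const_mul _ (by fun_prop), ← lintegral_add_right _ hmE]
    refine lintegral_mono fun y => ?_
    rw [← ENNReal.ofReal_mul (by linarith), ← ENNReal.ofReal_add (hk1 y) (hE0 y)]
    exact ENNReal.ofReal_le_ofReal (h1 x y hxx₁).2.2

lemma inv_image_Ioi {x : ℝ} (hx : 0 < x) : (fun t : ℝ => t⁻¹) '' Set.Ioi x = Set.Ioo 0 x⁻¹ := by
  ext θ
  simp only [Set.mem_image, Set.mem_Ioi, Set.mem_Ioo]
  constructor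
  · rintro ⟨t, ht, rfl⟩
    exact ⟨inv_pos.2 (hx.trans ht), inv_strictAnti₀ hx ht⟩
  · rintro ⟨h0, h1⟩
    exact ⟨θ⁻¹, by rwa [lt_inv_comm₀ hx h0], inv_inv θ⟩

/-- Under θ = 1/t the Jacobian t⁻² cancels the factor θ² in the denominator. -/
lemma lintegral_Ioo_inv_eq (F : Measure ℝ) {x : ℝ} (hx : 0 < x) :
    ∫⁻ θ in Set.Ioo 0 x⁻¹, ENNReal.ofReal
        ((1 - (charFun F θ).re) / (θ * truncMean F θ⁻¹) ^ 2) =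
      ∫⁻ t in Set.Ioi x, ENNReal.ofReal ((1 - (charFun F t⁻¹).re) / truncMean F t ^ 2) := by
  rw [← inv_image_Ioi hx, lintegral_image_eq_lintegral_abs_deriv_mul measurableSet_Ioi
    (f' := fun t => -(t ^ 2)⁻¹) (fun t ht => (hasDerivAt_inv (hx.trans ht).ne').hasDerivWithinAt)
    inv_injective.injOn]
  refine setLIntegral_congr_fun measurableSet_Ioi fun t ht => ?_
  have ht0 : 0 < t := hx.trans ht
  rw [← ENNReal.ofReal_mul (abs_nonneg _), inv_inv, abs_neg, abs_of_nonneg (by positivity)]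
  congr 1
  field_simp

lemma re_one_sub_charFun_inv_nonneg (F : Measure ℝ) [IsProbabilityMeasure F] (θ : ℝ) :
    0 ≤ ((1 - charFun F θ)⁻¹).re := by
  rw [Complex.inv_re]
  exact div_nonneg (by simpa using one_sub_re_charFun_nonneg F θ) (Complex.normSq_nonneg _)

/-- `∫_0^{1/x} Re (1 - φ)⁻¹ = (π/2) ∫_x^∞ H / A²` up to negligible terms. -/
lemma CondHa.resolventMass_bounds (hHa : CondHa F) {ε : ℝ} (hε : 0 < ε) (hε1 : ε ≤ 1) :
    ∃ x₀ : ℝ, 1 ≤ x₀ ∧ ∀ x, x₀ ≤ x → 0 < truncMean F x ∧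
      (resolventMass F x ≤
        ENNReal.ofReal (Real.pi / 2 + ε) * tailRatio F x + ENNReal.ofReal (ε / truncMean F x)) ∧
      (ENNReal.ofReal (Real.pi / 2 - ε) * tailRatio F x ≤
        resolventMass F x + ENNReal.ofReal (ε / truncMean F x)) := by
  obtain ⟨x₁, hx₁, h1⟩ := hHa.lintegral_one_sub_re_bounds (ε := ε / 4) (by positivity) (by linarith)
  -- The constant 12 of `abs_re_inv_sub_le_of_near` turns ε/72 into a relative error ε/6.
  obtain ⟨δ, hδ, h2⟩ := hHa.one_sub_charFun_asymp (ε := ε / 72) (by positivity)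
  refine ⟨max x₁ δ⁻¹, hx₁.trans (le_max_left _ _), fun x hx => ?_⟩
  have hxx₁ : x₁ ≤ x := (le_max_left _ _).trans hx
  have hxp : 0 < x := by linarith
  have hxδ : x⁻¹ ≤ δ := by rw [inv_le_comm₀ hxp hδ]; exact (le_max_right _ _).trans hx
  obtain ⟨hAx, u1, u2⟩ := h1 x hxx₁
  rw [← lintegral_Ioo_inv_eq F hxp] at u1 u2
  have key : ∀ θ ∈ Set.Ioo 0 x⁻¹,
      |((1 - charFun F θ)⁻¹).re - (1 - (charFun F θ).re) / (θ * truncMean F θ⁻¹) ^ 2| ≤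
        ε / 6 * ((1 - (charFun F θ).re) / (θ * truncMean F θ⁻¹) ^ 2) := by
    intro θ hθ
    obtain ⟨hA, hn⟩ := h2 θ hθ.1 (hθ.2.le.trans hxδ)
    have := abs_re_inv_sub_le_of_near (mul_pos hθ.1 hA) (by linarith)
      (by simpa using one_sub_re_charFun_nonneg F θ) hn
    simp only [Complex.sub_re, Complex.one_re] at this
    refine this.trans (le_of_eq ?_)
    ring
  have hg0 : ∀ θ, 0 ≤ (1 - (charFun F θ).re) / (θ * truncMean F θ⁻¹) ^ 2 := fun θ =>
    div_nonneg (one_sub_re_charFun_nonneg F θ) (by positivity)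
  set J := ∫⁻ θ in Set.Ioo 0 x⁻¹, ENNReal.ofReal
        ((1 - (charFun F θ).re) / (θ * truncMean F θ⁻¹) ^ 2) with hJ
  have b1 : resolventMass F x ≤ ENNReal.ofReal (1 + ε / 6) * J := by
    rw [hJ, ← lintegral_const_mul' _ _ ENNReal.ofReal_ne_top]
    refine setLIntegral_mono' measurableSet_Ioo fun θ hθ => ?_
    rw [← ENNReal.ofReal_mul (by positivity)]
    exact ENNReal.ofReal_le_ofReal (by linarith [(abs_le.1 (key θ hθ)).2])
  have b2 : ENNReal.ofReal (1 - ε / 6) * J ≤ resolventMass F x := by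
    rw [hJ, ← lintegral_const_mul' _ _ ENNReal.ofReal_ne_top]
    refine setLIntegral_mono' measurableSet_Ioo fun θ hθ => ?_
    rw [← ENNReal.ofReal_mul (by linarith)]
    exact ENNReal.ofReal_le_ofReal (by linarith [(abs_le.1 (key θ hθ)).1])
  have hpi := Real.pi_gt_three
  have hpi' := Real.pi_lt_four
  refine ⟨hAx, ?_, ?_⟩
  · calc resolventMass F x ≤ ENNReal.ofReal (1 + ε / 6) * (ENNReal.ofReal (Real.pi / 2 + ε / 4) *
          tailRatio F x + ENNReal.ofReal (ε / 4 / truncMean F x)) := b1.trans (by gcongr)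
      _ = ENNReal.ofReal ((1 + ε / 6) * (Real.pi / 2 + ε / 4)) * tailRatio F x +
          ENNReal.ofReal ((1 + ε / 6) * (ε / 4 / truncMean F x)) := by
          rw [mul_add, ← mul_assoc, ← ENNReal.ofReal_mul (by positivity),
            ← ENNReal.ofReal_mul (by positivity)]
      _ ≤ _ := by
          gcongr
          · nlinarith
          · rw [← mul_div_assoc]; gcongr; nlinarith
  · calc ENNReal.ofReal (Real.pi / 2 - ε) * tailRatio F x
        ≤ ENNReal.ofReal ((1 - ε / 6) * (Real.pi / 2 - ε / 4)) * tailRatio F x := by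
          gcongr; nlinarith
      _ = ENNReal.ofReal (1 - ε / 6) * (ENNReal.ofReal (Real.pi / 2 - ε / 4) * tailRatio F x) := by
          rw [← mul_assoc, ← ENNReal.ofReal_mul (by linarith)]
      _ ≤ ENNReal.ofReal (1 - ε / 6) * (J + ENNReal.ofReal (ε / 4 / truncMean F x)) := by gcongr
      _ = ENNReal.ofReal (1 - ε / 6) * J +
          ENNReal.ofReal ((1 - ε / 6) * (ε / 4 / truncMean F x)) := by
          rw [mul_add, ← ENNReal.ofReal_mul (by linarith)]
      _ ≤ _ := by
          gcongr
          rw [← mul_div_assoc]; gcongr; nlinarith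

omit [IsProbabilityMeasure F] in
lemma condHb_of_tailRatio_lt_top {x : ℝ} (hx : 0 < x) (hA : ∀ t, x ≤ t → 0 < truncMean F t)
    (h : tailRatio F x < ∞) : CondHb F := by
  refine ⟨x, hx, ?_⟩
  -- `tailRatio` divides in ℝ and `CondHb` in [0, ∞]; the two agree only where A does not vanish.
  rw [tailRatio, setLIntegral_congr_fun measurableSet_Ioi fun t ht =>
    ENNReal.ofReal_div_of_pos (pow_pos (hA t (le_of_lt ht)) 2)] at h
  exact h

lemma CondHa.tailRatio_lt_top (hHa : CondHa F) (hHb : CondHb F) :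
    ∃ x₀ : ℝ, 1 ≤ x₀ ∧ ∀ x, x₀ ≤ x → tailRatio F x < ∞ := by
  obtain ⟨x₂, hx₂, hpos, -⟩ := hHa.potter one_pos
  obtain ⟨b, hb, h⟩ := hHb
  refine ⟨max x₂ b, hx₂.trans (le_max_left _ _), fun x hx => ?_⟩
  refine lt_of_le_of_lt ?_ h
  rw [tailRatio, setLIntegral_congr_fun measurableSet_Ioi fun t ht =>
    ENNReal.ofReal_div_of_pos
      (pow_pos (hpos t (((le_max_left _ _).trans hx).trans (le_of_lt ht))) 2)]
  exact lintegral_mono_set (Set.Ioi_subset_Ioi ((le_max_right _ _).trans hx))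

end RealPart

end RelStableRenewal


namespace RelStableRenewal

/-! ### A tends to infinity; r₊ and r₋ in terms of R and 1/A. -/

section TailIntegrals

variable {F : Measure ℝ} [IsProbabilityMeasure F]

lemma lintegral_abs_le_tailSum (F : Measure ℝ) [IsProbabilityMeasure F] {x : ℝ} (hx : 0 ≤ x) :
    ∫⁻ y, ENNReal.ofReal |y| ∂F ≤
      ENNReal.ofReal x + ∫⁻ t in Set.Ioi x, ENNReal.ofReal (tailSum F t) := by
  rw [lintegral_eq_lintegral_meas_lt F (Eventually.of_forall fun y => abs_nonneg y)
    (by fun_prop), ← Set.Ioc_union_Ioi_eq_Ioi hx]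
  refine (lintegral_union_le _ _ _).trans (add_le_add ?_ ?_)
  · calc ∫⁻ t in Set.Ioc 0 x, F {y | t < |y|} ≤ ∫⁻ t in Set.Ioc 0 x, 1 :=
          lintegral_mono fun t => prob_le_one
      _ = _ := by simp
  · refine le_of_eq (setLIntegral_congr_fun measurableSet_Ioi fun t ht => ?_)
    rw [tailSum_eq F (hx.trans (le_of_lt ht)), ofReal_measureReal]

lemma integrableOn_tailRatio {x : ℝ} (h : tailRatio F x < ∞) :
    IntegrableOn (fun t => tailSum F t / truncMean F t ^ 2) (Set.Ioi x) := by
  have hAm : Measurable (truncMean F) := (continuous_truncMean F).measurable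
  have hHm := measurable_tailSum F
  refine ⟨Measurable.aestronglyMeasurable (by fun_prop), ?_⟩
  rw [hasFiniteIntegral_iff_ofReal
    (Eventually.of_forall fun t => div_nonneg (tailSum_nonneg F t) (by positivity))]
  exact h

lemma toReal_tailRatio (x : ℝ) :
    (tailRatio F x).toReal = ∫ t in Set.Ioi x, tailSum F t / truncMean F t ^ 2 := by
  have hAm : Measurable (truncMean F) := (continuous_truncMean F).measurable
  have hHm := measurable_tailSum F
  rw [integral_eq_lintegral_of_nonneg_ae
    (Eventually.of_forall fun t => div_nonneg (tailSum_nonneg F t) (by positivity))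
    (Measurable.aestronglyMeasurable (by fun_prop))]
  rfl

lemma integrableOn_tailDiff_div {x : ℝ} (h : tailRatio F x < ∞) :
    IntegrableOn (fun t => tailDiff F t / truncMean F t ^ 2) (Set.Ioi x) := by
  have hAm : Measurable (truncMean F) := (continuous_truncMean F).measurable
  have hKm := measurable_tailDiff F
  refine Integrable.mono' (integrableOn_tailRatio h) (Measurable.aestronglyMeasurable (by fun_prop))
    (Eventually.of_forall fun t => ?_)
  rw [norm_div, Real.norm_of_nonneg (by positivity : 0 ≤ truncMean F t ^ 2)]
  gcongr
  exact abs_tailDiff_le F t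

lemma integral_tailDiff_div {x y : ℝ} (hxy : x ≤ y) (hA : ∀ t, x ≤ t → 0 < truncMean F t) :
    ∫ t in x..y, tailDiff F t / truncMean F t ^ 2 = (truncMean F x)⁻¹ - (truncMean F y)⁻¹ := by
  have hne : ∀ t ∈ Set.Icc x y, truncMean F t ≠ 0 := fun t ht => (hA t ht.1).ne'
  have hd : ∀ t ∈ Set.Ioo x y, HasDerivWithinAt (fun t => -(truncMean F t)⁻¹)
      (tailDiff F t / truncMean F t ^ 2) (Set.Ioi t) t := by
    intro t ht
    have := (((hasDerivWithinAt_truncMean F t).mono Set.Ioi_subset_Ici_self).inv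
      (hne t ⟨ht.1.le, ht.2.le⟩)).neg
    have e : tailDiff F t / truncMean F t ^ 2 = -(-tailDiff F t / truncMean F t ^ 2) := by ring
    rw [e]
    exact this
  rw [intervalIntegral.integral_eq_sub_of_hasDeriv_right_of_le hxy
    (f := fun t => -(truncMean F t)⁻¹) (((continuous_truncMean F).continuousOn.inv₀ hne).neg) hd]
  · ring
  · refine (intervalIntegrable_tailDiff F x y).mul_continuousOn
      (g := fun t => (truncMean F t ^ 2)⁻¹) ?_
    rw [Set.uIcc_of_le hxy]
    exact ((continuous_truncMean F).pow 2).continuousOn.inv₀ fun t ht => pow_ne_zero 2 (hne t ht)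

/-- Under (Ha), (Hb) and `E|X| = ∞` the truncated mean tends to infinity, and `1 / A` is the
integral of `K / A²`. -/
lemma CondHa.tendsto_truncMean (hHa : CondHa F) (hHb : CondHb F)
    (hE : ∫⁻ x, ENNReal.ofReal |x| ∂F = ∞) :
    Tendsto (truncMean F) atTop atTop ∧
    ∃ x₀ : ℝ, 1 ≤ x₀ ∧ ∀ x, x₀ ≤ x → 0 < truncMean F x ∧ tailRatio F x < ∞ ∧
      ∫ t in Set.Ioi x, tailDiff F t / truncMean F t ^ 2 = (truncMean F x)⁻¹ := by
  obtain ⟨a, ha, hpos, -⟩ := hHa.potter one_pos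
  obtain ⟨b, hb, hR⟩ := hHa.tailRatio_lt_top hHb
  set m := max a b with hm
  have hlim : ∀ x, m ≤ x → Tendsto (fun y => (truncMean F x)⁻¹ - (truncMean F y)⁻¹) atTop
      (𝓝 (∫ t in Set.Ioi x, tailDiff F t / truncMean F t ^ 2)) := by
    intro x hx
    have := intervalIntegral_tendsto_integral_Ioi x
      (integrableOn_tailDiff_div (hR x ((le_max_right _ _).trans hx))) tendsto_id
    refine this.congr' ?_
    filter_upwards [eventually_ge_atTop x] with y hy
    exact integral_tailDiff_div hy fun t ht => hpos t (((le_max_left _ _).trans hx).trans ht)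
  set L := (truncMean F m)⁻¹ - ∫ t in Set.Ioi m, tailDiff F t / truncMean F t ^ 2 with hL
  have hinv : Tendsto (fun y => (truncMean F y)⁻¹) atTop (𝓝 L) := by
    have := (tendsto_const_nhds (x := (truncMean F m)⁻¹)).sub (hlim m le_rfl)
    simpa using this
  have hL0 : 0 ≤ L := ge_of_tendsto hinv (by
    filter_upwards [eventually_ge_atTop a] with y hy
    exact (inv_pos.2 (hpos y hy)).le)
  -- If 1/A had a positive limit, H/A² would dominate a multiple of H, and (Hb) would make H
  -- integrable, against E|X| = ∞.
  have hLz : L = 0 := by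
    by_contra hne
    have hLp : 0 < L := lt_of_le_of_ne hL0 (Ne.symm hne)
    obtain ⟨c, hc⟩ := eventually_atTop.1 (hinv.eventually_const_le (half_lt_self hLp))
    set x := max m c with hx
    have hxm : m ≤ x := le_max_left _ _
    have hx0 : 0 ≤ x := by
      have : a ≤ x := (le_max_left _ _).trans hxm
      linarith
    have h1 : ENNReal.ofReal ((L / 2) ^ 2) * ∫⁻ t in Set.Ioi x, ENNReal.ofReal (tailSum F t) ≤
        tailRatio F x := by
      rw [← lintegral_const_mul' _ _ ENNReal.ofReal_ne_top]
      refine setLIntegral_mono' measurableSet_Ioi fun t ht => ?_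
      have ht : x < t := ht
      rw [← ENNReal.ofReal_mul (by positivity)]
      apply ENNReal.ofReal_le_ofReal
      have := tailSum_nonneg F t
      have hct := hc t ((le_max_right _ _).trans ht.le)
      calc (L / 2) ^ 2 * tailSum F t ≤ ((truncMean F t)⁻¹) ^ 2 * tailSum F t := by gcongr
        _ = _ := by rw [inv_pow, inv_mul_eq_div]
    have h2 := lintegral_abs_le_tailSum F hx0
    rw [hE] at h2
    have h3 : ∫⁻ t in Set.Ioi x, ENNReal.ofReal (tailSum F t) = ∞ := by
      by_contra hfin
      exact absurd h2 (not_le.2 (ENNReal.add_lt_top.2 ⟨ENNReal.ofReal_lt_top, lt_top_iff_ne_top.2 hfin⟩))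
    rw [h3, ENNReal.mul_top (ENNReal.ofReal_pos.2 (by positivity)).ne'] at h1
    exact absurd (hR x ((le_max_right _ _).trans hxm)) (not_lt.2 h1)
  rw [hLz] at hinv
  refine ⟨?_, m, ha.trans (le_max_left _ _), fun x hx =>
    ⟨hpos x ((le_max_left _ _).trans hx), hR x ((le_max_right _ _).trans hx), ?_⟩⟩
  · have h1 : Tendsto (fun y => (truncMean F y)⁻¹) atTop (𝓝[>] 0) :=
      tendsto_nhdsWithin_iff.2 ⟨hinv, by
        filter_upwards [eventually_ge_atTop a] with y hy using inv_pos.2 (hpos y hy)⟩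
    exact (tendsto_inv_nhdsGT_zero.comp h1).congr fun y => by simp
  · have h1 := (tendsto_const_nhds (x := (truncMean F x)⁻¹)).sub hinv
    rw [sub_zero] at h1
    exact tendsto_nhds_unique (hlim x hx) h1

/-- r₋ is defined with P[X ≤ -t], whereas H and K use P[X < -t]. They differ only at atoms, a
Lebesgue null set by Tonelli on the antidiagonal. -/
lemma cdf_neg_ae_eq (F : Measure ℝ) [IsProbabilityMeasure F] :
    ∀ᵐ t : ℝ, cdf F (-t) = F.real (Set.Iio (-t)) := by
  have h0 : ∀ᵐ t : ℝ, F {-t} = 0 := by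
    have hm : Measurable (Function.uncurry fun (t y : ℝ) => ({p : ℝ × ℝ | p.2 = -p.1}.indicator
        (fun _ => (1 : ℝ≥0∞)) (t, y))) :=
      measurable_const.indicator (measurableSet_eq_fun measurable_snd (by fun_prop))
    have h1 := lintegral_lintegral_swap (μ := (volume : Measure ℝ)) (ν := F) hm.aemeasurable
    have h2 : ∀ y : ℝ, ∫⁻ t : ℝ, {p : ℝ × ℝ | p.2 = -p.1}.indicator
        (fun _ => (1 : ℝ≥0∞)) (t, y) = 0 := by
      intro y
      have : ∀ t : ℝ, {p : ℝ × ℝ | p.2 = -p.1}.indicator (fun _ => (1 : ℝ≥0∞)) (t, y) =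
          ({-y} : Set ℝ).indicator (fun _ => (1 : ℝ≥0∞)) t := by
        intro t
        have : y = -t ↔ t = -y := by constructor <;> intro h <;> linarith
        simp [Set.indicator_apply, this]
      simp_rw [this]
      rw [lintegral_indicator (measurableSet_singleton _)]; simp
    have h3 : ∀ t : ℝ, ∫⁻ y, {p : ℝ × ℝ | p.2 = -p.1}.indicator
        (fun _ => (1 : ℝ≥0∞)) (t, y) ∂F = F {-t} := by
      intro t
      have : ∀ y : ℝ, {p : ℝ × ℝ | p.2 = -p.1}.indicator (fun _ => (1 : ℝ≥0∞)) (t, y) =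
          ({-t} : Set ℝ).indicator (fun _ => (1 : ℝ≥0∞)) y := by
        intro y; simp [Set.indicator_apply]
      simp_rw [this]
      rw [lintegral_indicator (measurableSet_singleton _)]; simp
    simp_rw [h2, h3, lintegral_zero] at h1
    have hm' : Measurable fun t : ℝ => F {-t} := by
      simp_rw [← h3]; exact hm.lintegral_prod_right
    exact (lintegral_eq_zero_iff hm').1 h1
  filter_upwards [h0] with t ht
  rw [cdf_eq_real, ← Set.Iio_union_right, measureReal_union (by simp) (measurableSet_singleton _)]
  simp [Measure.real, ht]

/-- The upper and lower tails are (H + K)/2 and (H - K)/2, and the integral of K/A² is 1/A(x). -/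
lemma rPlus_rMinus_eq {x : ℝ} (hR : tailRatio F x < ∞)
    (hK : ∫ t in Set.Ioi x, tailDiff F t / truncMean F t ^ 2 = (truncMean F x)⁻¹) :
    rPlus F x = ((tailRatio F x).toReal + (truncMean F x)⁻¹) / 2 ∧
      (∫ t in Set.Ioi x, cdf F (-t) / truncMean F t ^ 2) =
        ((tailRatio F x).toReal - (truncMean F x)⁻¹) / 2 := by
  have i1 := integrableOn_tailRatio hR
  have i2 := integrableOn_tailDiff_div hR
  rw [toReal_tailRatio, ← hK]
  constructor
  · rw [rPlus, ← integral_add i1 i2, ← integral_div]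
    refine integral_congr_ae (Eventually.of_forall fun t => ?_)
    simp only [tailSum, tailDiff]; ring
  · rw [← integral_sub i1 i2, ← integral_div]
    refine integral_congr_ae (ae_restrict_of_ae ?_)
    filter_upwards [cdf_neg_ae_eq F] with t ht
    simp only [tailSum, tailDiff, ht]; ring

/-- The asymptotic density of the renewal measure on both half-lines. -/
noncomputable def renewalDensity (F : Measure ℝ) (w : ℝ) : ℝ :=
  if 0 ≤ w then rPlus F w else rMinus F w

lemma rMinus_eq_abs (F : Measure ℝ) (w : ℝ) :
    rMinus F w = ∫ t in Set.Ioi |w|, cdf F (-t) / truncMean F t ^ 2 := rfl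

/-- The integrand is at most 1/(tA(t)) because tH(t) ≤ A(t), hence at most 2/(xA(x)) on an interval
of length at most c. -/
lemma tailRatio_shift_le {x₀ c x y : ℝ} (hx₀ : 1 ≤ x₀)
    (hH : ∀ x, x₀ ≤ x → 0 < truncMean F x ∧ 0 < tailSum F x ∧ x * tailSum F x ≤ truncMean F x)
    (hR : tailRatio F x < ∞) (hx : x₀ ≤ x) (hxy : x ≤ y) (hy : y ≤ x + c)
    (hb : ∀ t, x ≤ t → t ≤ y → (truncMean F t)⁻¹ ≤ 2 * (truncMean F x)⁻¹) :
    |(tailRatio F x).toReal - (tailRatio F y).toReal| ≤ 2 * c / x * (truncMean F x)⁻¹ := by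
  have hxp : 0 < x := by linarith
  rw [toReal_tailRatio, toReal_tailRatio, ← Set.Ioc_union_Ioi_eq_Ioi hxy,
    setIntegral_union Set.Ioc_disjoint_Ioi_same measurableSet_Ioi
      ((integrableOn_tailRatio hR).mono_set Set.Ioc_subset_Ioi_self)
      ((integrableOn_tailRatio hR).mono_set (Set.Ioi_subset_Ioi hxy)), add_sub_cancel_right]
  have hAx := (hH x hx).1
  have := norm_setIntegral_le_of_norm_le_const (μ := volume) (s := Set.Ioc x y)
    (C := 2 / x * (truncMean F x)⁻¹)
    (f := fun t => tailSum F t / truncMean F t ^ 2) (by simp) (fun t ht => by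
      obtain ⟨h1, h2, h3⟩ := hH t (hx.trans ht.1.le)
      rw [Real.norm_of_nonneg (by positivity)]
      have h4 := hb t ht.1.le ht.2
      have htp : 0 < t := hxp.trans ht.1
      have h5 : tailSum F t ≤ truncMean F t / t := by rw [le_div_iff₀ htp]; linarith
      calc tailSum F t / truncMean F t ^ 2 ≤ truncMean F t / t / truncMean F t ^ 2 := by gcongr
        _ = 1 / t * (truncMean F t)⁻¹ := by field_simp
        _ ≤ 1 / x * (2 * (truncMean F x)⁻¹) := by gcongr; exact ht.1.le
        _ = _ := by ring)
  rw [← Real.norm_eq_abs]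
  refine this.trans ?_
  have e : (volume : Measure ℝ).real (Set.Ioc x y) = y - x := by simp [hxy]
  rw [e]
  calc 2 / x * (truncMean F x)⁻¹ * (y - x) ≤ 2 / x * (truncMean F x)⁻¹ * c := by
        gcongr; linarith
    _ = _ := by ring

lemma abs_truncMean_sub_le (F : Measure ℝ) [IsProbabilityMeasure F] (x y : ℝ) :
    |truncMean F y - truncMean F x| ≤ |y - x| := by
  rw [truncMean_sub, ← Real.norm_eq_abs]
  have := intervalIntegral.norm_integral_le_of_norm_le_const (a := x) (b := y) (C := 1)
    (f := tailDiff F) fun t _ => abs_tailDiff_le_one F t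
  simpa using this

/-- Facts on `r₊` and `r₋` far from the origin, including insensitivity to bounded shifts. -/
lemma CondHa.renewalDensity_props (hHa : CondHa F) (hHb : CondHb F)
    (hE : ∫⁻ x, ENNReal.ofReal |x| ∂F = ∞) :
    ∃ x₀ : ℝ, 1 ≤ x₀ ∧ ∀ x, x₀ ≤ x → 0 < truncMean F x ∧ tailRatio F x < ∞ ∧
      rPlus F x = ((tailRatio F x).toReal + (truncMean F x)⁻¹) / 2 ∧
      (∫ t in Set.Ioi x, cdf F (-t) / truncMean F t ^ 2) =
        ((tailRatio F x).toReal - (truncMean F x)⁻¹) / 2 ∧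
      (truncMean F x)⁻¹ ≤ (tailRatio F x).toReal := by
  obtain ⟨hlim, x₀, h1, h⟩ := hHa.tendsto_truncMean hHb hE
  refine ⟨x₀, h1, fun x hx => ?_⟩
  obtain ⟨hA, hR, hK⟩ := h x hx
  obtain ⟨e1, e2⟩ := rPlus_rMinus_eq hR hK
  refine ⟨hA, hR, e1, e2, ?_⟩
  -- The integral that defines r₋ is (R - 1/A)/2, so its nonnegativity gives 1/A ≤ R.
  have : 0 ≤ ∫ t in Set.Ioi x, cdf F (-t) / truncMean F t ^ 2 :=
    integral_nonneg fun t => div_nonneg (cdf_nonneg F _) (by positivity)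
  linarith

/-- A is 1-Lipschitz and tends to infinity, so a bounded shift changes 1/A by o(1/A); it changes R
by O(1/(xA)). Both are o(r₊) as 1/A ≤ r₊. On the negative side the error is still measured by r₊,
because r₋ may be of smaller order. -/
lemma CondHa.renewalDensity_shift (hHa : CondHa F) (hHb : CondHb F)
    (hE : ∫⁻ x, ENNReal.ofReal |x| ∂F = ∞) {c ε : ℝ} (hc : 0 < c) (hε : 0 < ε) :
    ∃ x₀ : ℝ, 1 ≤ x₀ ∧ ∀ w, x₀ ≤ |w| → 0 < rPlus F |w| ∧ 0 ≤ renewalDensity F w ∧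
      renewalDensity F w ≤ rPlus F |w| ∧ ∀ u, |u| ≤ c →
      |renewalDensity F (w + u) - renewalDensity F w| ≤ ε * rPlus F |w| ∧
      rPlus F |w + u| ≤ 2 * rPlus F |w| := by
  obtain ⟨hlim, -⟩ := hHa.tendsto_truncMean hHb hE
  obtain ⟨x₁, hx₁, h1⟩ := hHa.renewalDensity_props hHb hE
  obtain ⟨x₂, hx₂, h2, -⟩ := hHa.potter_quarter
  set κ := min ε 1 with hκ
  have hκ0 : 0 < κ := by positivity
  obtain ⟨x₃, h3⟩ := eventually_atTop.1 (hlim.eventually_ge_atTop (4 * c / κ))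
  set m := max (max x₁ x₂) (max x₃ (16 * c / κ)) with hm
  have hm1 : x₁ ≤ m := (le_max_left _ _).trans (le_max_left _ _)
  have hm2 : x₂ ≤ m := (le_max_right _ _).trans (le_max_left _ _)
  have hm3 : x₃ ≤ m := (le_max_left _ _).trans (le_max_right _ _)
  have hm4 : 16 * c / κ ≤ m := (le_max_right _ _).trans (le_max_right _ _)
  have hm0 : 1 ≤ m := hx₁.trans hm1
  have hκ1 : κ ≤ 1 := min_le_right _ _
  have inv_shift : ∀ s t, m ≤ s → m ≤ t → |s - t| ≤ c →
      |(truncMean F s)⁻¹ - (truncMean F t)⁻¹| ≤ κ / 2 * (truncMean F t)⁻¹ ∧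
        (truncMean F s)⁻¹ ≤ 2 * (truncMean F t)⁻¹ := by
    intro s t hs ht hst
    have a1 := (h1 s (hm1.trans hs)).1
    have a2 := (h1 t (hm1.trans ht)).1
    have a3 := h3 s (hm3.trans hs)
    have a4 := (abs_truncMean_sub_le F s t).trans ((abs_sub_comm t s).le.trans hst)
    have a5 : 4 * c ≤ κ * truncMean F s := by
      have := (div_le_iff₀ hκ0).1 a3
      linarith
    have a6 : |(truncMean F s)⁻¹ - (truncMean F t)⁻¹| ≤ κ / 2 * (truncMean F t)⁻¹ := by
      have e : (truncMean F s)⁻¹ - (truncMean F t)⁻¹ =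
          (truncMean F t - truncMean F s) * ((truncMean F s)⁻¹ * (truncMean F t)⁻¹) := by
        field_simp
      rw [e, abs_mul, abs_of_pos (a := (truncMean F s)⁻¹ * (truncMean F t)⁻¹) (by positivity)]
      calc _ ≤ (κ / 2 * truncMean F s) * ((truncMean F s)⁻¹ * (truncMean F t)⁻¹) := by
            gcongr; linarith
        _ = _ := by field_simp
    refine ⟨a6, ?_⟩
    have : 0 < (truncMean F t)⁻¹ := inv_pos.2 a2
    have := (abs_le.1 a6).2
    nlinarith
  have R_shift : ∀ s t, m ≤ s → m ≤ t → |s - t| ≤ c →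
      |(tailRatio F s).toReal - (tailRatio F t).toReal| ≤ κ / 2 * (truncMean F t)⁻¹ := by
    have aux : ∀ s t, m ≤ s → s ≤ t → t - s ≤ c →
        |(tailRatio F s).toReal - (tailRatio F t).toReal| ≤ κ / 8 * (truncMean F s)⁻¹ := by
      intro s t hs hst hc'
      have a1 := (h1 s (hm1.trans hs)).1
      have := tailRatio_shift_le hx₂ h2 (h1 s (hm1.trans hs)).2.1 (hm2.trans hs) hst
        (by linarith : t ≤ s + c) (fun u hu hut => (inv_shift u s (hs.trans hu) hs (by
          rw [abs_of_nonneg (by linarith)]; linarith)).2)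
      refine this.trans ?_
      have hsp : 0 < s := by linarith
      refine mul_le_mul_of_nonneg_right ?_ (inv_pos.2 a1).le
      rw [div_le_iff₀ hsp]
      have := (div_le_iff₀ hκ0).1 (hm4.trans hs)
      linarith
    intro s t hs ht hst
    rcases le_total s t with h | h
    · refine (aux s t hs h ((le_abs_self _).trans ((abs_sub_comm t s).le.trans hst))).trans ?_
      have := (inv_shift s t hs ht hst).2
      calc κ / 8 * (truncMean F s)⁻¹ ≤ κ / 8 * (2 * (truncMean F t)⁻¹) := by gcongr
        _ ≤ _ := by
          have : 0 ≤ κ * (truncMean F t)⁻¹ :=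
            mul_nonneg hκ0.le (inv_pos.2 (h1 t (hm1.trans ht)).1).le
          linarith
    · rw [abs_sub_comm]
      refine (aux t s ht h ((le_abs_self _).trans hst)).trans ?_
      have : 0 ≤ κ * (truncMean F t)⁻¹ :=
        mul_nonneg hκ0.le (inv_pos.2 (h1 t (hm1.trans ht)).1).le
      linarith
  -- Beyond m + c a shift by at most c keeps the sign of w and leaves its modulus at least m.
  refine ⟨m + c, by linarith, fun w hw => ?_⟩
  have hwm : m ≤ |w| := by linarith
  obtain ⟨hA, hR, ep, em, hle⟩ := h1 |w| (hm1.trans hwm)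
  have hAi : 0 < (truncMean F |w|)⁻¹ := inv_pos.2 hA
  have hw0 : w ≠ 0 := by rintro rfl; simp at hwm; linarith
  have hpos : 0 < rPlus F |w| := by rw [ep]; linarith
  have hge : (truncMean F |w|)⁻¹ ≤ rPlus F |w| := by rw [ep]; linarith
  refine ⟨hpos, ?_, ?_, fun u hu => ?_⟩
  · rw [renewalDensity]
    split_ifs with h
    · rw [abs_of_nonneg h] at hpos; exact hpos.le
    · rw [rMinus_eq_abs, em]; linarith
  · rw [renewalDensity]
    split_ifs with h
    · rw [abs_of_nonneg h]
    · rw [rMinus_eq_abs, em, ep]; linarith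
  · have hub := abs_le.1 hu
    have hwu : |(|w + u| - |w|)| ≤ c := by
      refine (abs_abs_sub_abs_le_abs_sub _ _).trans ?_
      simpa using hu
    have hwum : m ≤ |w + u| := by
      have := (abs_le.1 hwu).1; linarith
    obtain ⟨-, -, ep', em', -⟩ := h1 |w + u| (hm1.trans hwum)
    have s1 := abs_le.1 (inv_shift _ _ hwum hwm hwu).1
    have s2 := abs_le.1 (R_shift _ _ hwum hwm hwu)
    have hκA : κ * (truncMean F |w|)⁻¹ ≤ ε * rPlus F |w| := by
      have : κ ≤ ε := min_le_left _ _
      gcongr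
    have hκA' : κ * (truncMean F |w|)⁻¹ ≤ 1 * rPlus F |w| := by gcongr
    refine ⟨?_, ?_⟩
    · rw [renewalDensity, renewalDensity]
      rcases lt_or_gt_of_ne hw0 with h | h
      · have hw' : |w| = -w := abs_of_neg h
        have h' : w + u < 0 := by rw [hw'] at hw; linarith
        rw [if_neg (not_le.2 h'), if_neg (not_le.2 h), rMinus_eq_abs, rMinus_eq_abs, em, em', abs_le]
        constructor <;> linarith
      · have hw' : |w| = w := abs_of_pos h
        have h' : 0 < w + u := by rw [hw'] at hw; linarith
        rw [if_pos h'.le, if_pos h.le]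
        rw [abs_of_pos h'] at ep' s1 s2
        rw [hw'] at ep s1 s2 hκA ⊢
        rw [ep, ep', abs_le]
        rw [ep] at hκA
        constructor <;> linarith
    · rw [ep']; linarith

end TailIntegrals

end RelStableRenewal


namespace RelStableRenewal

/-! ### The Fejér kernel and Abel summation of the renewal series. -/

section Fejer

/-- The Fejér kernel `(1/π) ∫_0^a (1 - θ/a) cos(θ u) dθ = (1 - cos (a u)) / (π a u²)`. -/
noncomputable def fejer (a u : ℝ) : ℝ :=
  (1 / Real.pi) * ∫ θ in (0 : ℝ)..a, (1 - θ / a) * Real.cos (θ * u)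

lemma fejer_eq {a u : ℝ} (ha : 0 < a) (hu : u ≠ 0) :
    fejer a u = (1 - Real.cos (a * u)) / (Real.pi * a * u ^ 2) := by
  have hd : ∀ θ ∈ Set.uIcc 0 a, HasDerivAt
      (fun θ => (1 - θ / a) * (Real.sin (θ * u) / u) - Real.cos (θ * u) / (a * u ^ 2))
      ((1 - θ / a) * Real.cos (θ * u)) θ := by
    intro θ _
    have h0 : HasDerivAt (fun θ : ℝ => θ * u) u θ := by simpa using (hasDerivAt_id θ).mul_const u
    have h1 : HasDerivAt (fun θ : ℝ => 1 - θ / a) (-(1 / a)) θ := by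
      simpa using ((hasDerivAt_id θ).div_const a).const_sub 1
    have h2 := (h1.mul (h0.sin.div_const u)).sub (h0.cos.div_const (a * u ^ 2))
    exact h2.congr_deriv (by field_simp; ring)
  rw [fejer, intervalIntegral.integral_eq_sub_of_hasDerivAt hd
    (Continuous.intervalIntegrable (by fun_prop) _ _)]
  have := Real.pi_pos
  simp only [div_self ha.ne', sub_self, zero_mul, Real.sin_zero, Real.cos_zero, zero_div]
  field_simp
  ring

lemma continuous_fejer (a : ℝ) : Continuous (fejer a) := by
  refine continuous_const.mul ?_
  exact intervalIntegral.continuous_parametric_intervalIntegral_of_continuous'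
    (f := fun u θ => (1 - θ / a) * Real.cos (θ * u)) (by fun_prop) 0 a

lemma integral_one_sub_div {a : ℝ} (ha : 0 < a) : ∫ θ in (0 : ℝ)..a, (1 - θ / a) = a / 2 := by
  rw [intervalIntegral.integral_sub (by simp)
    (Continuous.intervalIntegrable (by fun_prop) _ _), intervalIntegral.integral_div,
    integral_id]
  simp
  field_simp
  ring

lemma fejer_nonneg {a : ℝ} (ha : 0 < a) (u : ℝ) : 0 ≤ fejer a u := by
  have := Real.pi_pos
  rcases eq_or_ne u 0 with rfl | hu
  · rw [fejer]
    simp only [mul_zero, Real.cos_zero, mul_one]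
    rw [integral_one_sub_div ha]
    positivity
  · rw [fejer_eq ha hu]
    exact div_nonneg (by linarith [Real.cos_le_one (a * u)]) (by positivity)

lemma fejer_le {a u : ℝ} (ha : 0 < a) (hu : u ≠ 0) : fejer a u ≤ 2 / (Real.pi * a * u ^ 2) := by
  have := Real.pi_pos
  rw [fejer_eq ha hu]
  gcongr
  linarith [Real.neg_one_le_cos (a * u)]

lemma le_fejer {a u : ℝ} (ha : 0 < a) (hu : a * |u| ≤ 1) : a / (4 * Real.pi) ≤ fejer a u := by
  have hpi := Real.pi_pos
  have h : ∫ θ in (0 : ℝ)..a, (1 - θ / a) * (1 / 2) ≤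
      ∫ θ in (0 : ℝ)..a, (1 - θ / a) * Real.cos (θ * u) := by
    refine intervalIntegral.integral_mono_on ha.le (Continuous.intervalIntegrable (by fun_prop) _ _)
      (Continuous.intervalIntegrable (by fun_prop) _ _) fun θ hθ => ?_
    have h1 : θ / a ≤ 1 := (div_le_one ha).2 hθ.2
    refine mul_le_mul_of_nonneg_left ?_ (by linarith)
    have h2 : |θ * u| ≤ 1 := by
      rw [abs_mul, abs_of_nonneg hθ.1]
      exact (mul_le_mul_of_nonneg_right hθ.2 (abs_nonneg u)).trans hu
    have h3 : (θ * u) ^ 2 ≤ 1 := by rw [← sq_abs]; nlinarith [abs_nonneg (θ * u)]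
    linarith [Real.one_sub_sq_div_two_le_cos (x := θ * u)]
  rw [intervalIntegral.integral_mul_const, integral_one_sub_div ha] at h
  rw [fejer]
  calc a / (4 * Real.pi) = 1 / Real.pi * (a / 2 * (1 / 2)) := by field_simp; ring
    _ ≤ _ := by gcongr

/-- Fubini: the kernel is a mixture of cosines of frequency at most a, so only the characteristic
function on [0, a] enters. -/
lemma integral_fejer_sub (μ : Measure ℝ) [IsFiniteMeasure μ] {a : ℝ} (ha : 0 < a) (x : ℝ) :
    Integrable (fun y => fejer a (y - x)) μ ∧
    ∫ y, fejer a (y - x) ∂μ = (1 / Real.pi) * ∫ θ in (0 : ℝ)..a, (1 - θ / a) *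
      (Complex.exp (-((θ * x : ℝ) * Complex.I)) * charFun μ θ).re := by
  have hint : Integrable (Function.uncurry fun (y θ : ℝ) => (1 - θ / a) * Real.cos (θ * (y - x)))
      (μ.prod (volume.restrict (Set.Ioc 0 a))) := by
    have h1 : Integrable (fun p : ℝ × ℝ => (1 : ℝ)) (μ.prod (volume.restrict (Set.Ioc 0 a))) :=
      integrable_const _
    have h2 : ∀ᵐ p : ℝ × ℝ ∂(μ.prod (volume.restrict (Set.Ioc 0 a))), p.2 ∈ Set.Ioc 0 a :=
      Measure.quasiMeasurePreserving_snd.ae (ae_restrict_mem measurableSet_Ioc)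
    refine h1.mono' (Continuous.aestronglyMeasurable (by fun_prop)) ?_
    filter_upwards [h2] with p hp
    have h3 : p.2 / a ≤ 1 := (div_le_one ha).2 hp.2
    have h4 : 0 ≤ p.2 / a := div_nonneg hp.1.le ha.le
    rw [Function.uncurry, norm_mul, Real.norm_of_nonneg (by linarith), Real.norm_eq_abs]
    exact mul_le_one₀ (by linarith) (abs_nonneg _) (Real.abs_cos_le_one _)
  have hre : ∀ θ : ℝ, (Complex.exp (-((θ * x : ℝ) * Complex.I)) * charFun μ θ).re =
      ∫ y, Real.cos (θ * (y - x)) ∂μ := by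
    intro θ
    have hi : Integrable (fun y : ℝ => Complex.exp (-((θ * x : ℝ) * Complex.I)) *
        Complex.exp (θ * y * Complex.I)) μ := by
      refine Integrable.of_bound (by fun_prop) 1 (Eventually.of_forall fun y => ?_)
      rw [← neg_mul, ← Complex.ofReal_neg, ← Complex.ofReal_mul, norm_mul,
        Complex.norm_exp_ofReal_mul_I, Complex.norm_exp_ofReal_mul_I, one_mul]
    rw [charFun_apply_real, ← integral_const_mul, ← RCLike.re_eq_complex_re, ← integral_re hi]
    refine integral_congr_ae (Eventually.of_forall fun y => ?_)
    simp only [RCLike.re_eq_complex_re]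
    rw [← Complex.exp_add, ← Complex.exp_ofReal_mul_I_re]
    congr 2
    push_cast; ring
  constructor
  · have := (hint.integral_prod_left).const_mul (1 / Real.pi)
    refine this.congr (Eventually.of_forall fun y => ?_)
    simp only [fejer, Function.uncurry]
    rw [intervalIntegral.integral_of_le ha.le]
  · simp_rw [fejer, hre]
    rw [integral_const_mul]
    congr 1
    simp_rw [intervalIntegral.integral_of_le ha.le]
    rw [integral_integral_swap hint]
    simp_rw [integral_const_mul]

variable (F : Measure ℝ) [IsProbabilityMeasure F]

instance isProbabilityMeasure_convPow (n : ℕ) : IsProbabilityMeasure (convPow F n) := by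
  induction n with
  | zero => rw [convPow]; infer_instance
  | succ n ih => rw [convPow]; infer_instance

lemma charFun_convPow (n : ℕ) (θ : ℝ) : charFun (convPow F n) θ = charFun F θ ^ n := by
  induction n with
  | zero => simp [convPow]
  | succ n ih => rw [convPow, charFun_conv, ih, pow_succ]

lemma norm_charFun_le (θ : ℝ) : ‖charFun F θ‖ ≤ 1 := norm_charFun_le_one θ

lemma hasSum_resolvent {r : ℝ} (hr0 : 0 ≤ r) (hr1 : r < 1) (z : ℂ) (θ : ℝ) :
    HasSum (fun n => r ^ n * (z * charFun F θ ^ n).re) (z * (1 - r * charFun F θ)⁻¹).re := by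
  have hn : ‖(r : ℂ) * charFun F θ‖ < 1 := by
    rw [norm_mul, Complex.norm_real, Real.norm_of_nonneg hr0]
    calc r * ‖charFun F θ‖ ≤ r * 1 := by gcongr; exact norm_charFun_le F θ
      _ < 1 := by linarith
  have h := Complex.hasSum_re ((hasSum_geometric_of_norm_lt_one hn).mul_left z)
  refine h.congr_fun fun n => ?_
  rw [mul_pow, ← Complex.re_ofReal_mul]
  congr 1
  push_cast; ring

/-- The Abel factor r < 1 dominates the series by a geometric one uniformly in θ, which allows
summation under the integral. At r = 1 even absolute integrability of (1 - φ)⁻¹ near 0 can fail. -/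
lemma hasSum_fejer {a : ℝ} (ha : 0 < a) (x : ℝ) {r : ℝ} (hr0 : 0 ≤ r) (hr1 : r < 1) :
    HasSum (fun n => (∫ y, fejer a (y - x) ∂(convPow F n)) * r ^ n)
      ((1 / Real.pi) * ∫ θ in (0 : ℝ)..a, (1 - θ / a) *
        (Complex.exp (-((θ * x : ℝ) * Complex.I)) * (1 - r * charFun F θ)⁻¹).re) := by
  have hE : ∀ θ : ℝ, ‖Complex.exp (-((θ * x : ℝ) * Complex.I))‖ = 1 := fun θ => by
    rw [← neg_mul, ← Complex.ofReal_neg, Complex.norm_exp_ofReal_mul_I]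
  have h := intervalIntegral.hasSum_integral_of_dominated_convergence (μ := volume)
    (a := 0) (b := a)
    (F := fun (n : ℕ) (θ : ℝ) => (1 - θ / a) * (r ^ n *
      (Complex.exp (-((θ * x : ℝ) * Complex.I)) * charFun F θ ^ n).re))
    (f := fun θ => (1 - θ / a) *
        (Complex.exp (-((θ * x : ℝ) * Complex.I)) * (1 - r * charFun F θ)⁻¹).re)
    (fun n _ => r ^ n)
    (fun n => by
      refine Continuous.aestronglyMeasurable ?_
      have := continuous_charFun (μ := F)
      have : Continuous fun θ : ℝ =>
          Complex.exp (-((θ * x : ℝ) * Complex.I)) * charFun F θ ^ n := by fun_prop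
      have := Complex.continuous_re.comp this
      simp only [Function.comp_def] at this
      fun_prop)
    (fun n => Eventually.of_forall fun θ hθ => by
      rw [Set.uIoc_of_le ha.le] at hθ
      have h3 : θ / a ≤ 1 := (div_le_one ha).2 hθ.2
      have h4 : 0 ≤ θ / a := div_nonneg hθ.1.le ha.le
      rw [norm_mul, norm_mul, Real.norm_of_nonneg (by linarith),
        Real.norm_of_nonneg (pow_nonneg hr0 n), Real.norm_eq_abs]
      have h5 : |(Complex.exp (-((θ * x : ℝ) * Complex.I)) * charFun F θ ^ n).re| ≤ 1 := by
        refine (Complex.abs_re_le_norm _).trans ?_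
        rw [norm_mul, hE, one_mul, norm_pow]
        exact pow_le_one₀ (norm_nonneg _) (norm_charFun_le F θ)
      calc _ ≤ 1 * (r ^ n * 1) := by gcongr; linarith
        _ = _ := by ring)
    (Eventually.of_forall fun θ _ => summable_geometric_of_lt_one hr0 hr1)
    (by simp)
    (Eventually.of_forall fun θ _ => (hasSum_resolvent F hr0 hr1 _ θ).mul_left _)
  refine (h.mul_left (1 / Real.pi)).congr_fun fun n => ?_
  rw [(integral_fejer_sub (convPow F n) ha x).2, mul_assoc, ← intervalIntegral.integral_mul_const]
  congr 1
  refine intervalIntegral.integral_congr fun θ _ => ?_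
  simp only [charFun_convPow]
  ring

/-- A Tauberian converse to Abel's theorem for nonnegative coefficients. -/
lemma hasSum_of_tendsto_powerSeries {c : ℕ → ℝ} (hc : ∀ n, 0 ≤ c n) {S : ℝ → ℝ} {L : ℝ}
    (hS : ∀ r, 0 ≤ r → r < 1 → HasSum (fun n => c n * r ^ n) (S r))
    (hL : Tendsto S (𝓝[<] 1) (𝓝 L)) : HasSum c L := by
  have hev : ∀ᶠ r : ℝ in 𝓝[<] 1, 0 ≤ r ∧ r < 1 := by
    filter_upwards [Ioo_mem_nhdsLT (zero_lt_one (α := ℝ))] with r hr using ⟨hr.1.le, hr.2⟩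
  have hsum : Summable c := by
    refine summable_of_sum_range_le (c := L) hc fun n => ?_
    have h1 : Tendsto (fun r : ℝ => ∑ i ∈ Finset.range n, c i * r ^ i) (𝓝[<] 1)
        (𝓝 (∑ i ∈ Finset.range n, c i)) := by
      have : Continuous fun r : ℝ => ∑ i ∈ Finset.range n, c i * r ^ i := by fun_prop
      have := this.tendsto 1
      simp only [one_pow, mul_one] at this
      exact this.mono_left nhdsWithin_le_nhds
    refine le_of_tendsto_of_tendsto h1 hL ?_
    filter_upwards [hev] with r hr
    exact sum_le_hasSum _ (fun i _ => mul_nonneg (hc i) (pow_nonneg hr.1 i)) (hS r hr.1 hr.2)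
  have h2 := Real.tendsto_tsum_powerSeries_nhdsWithin_lt hsum.hasSum.tendsto_sum_nat
  have h3 : Tendsto S (𝓝[<] 1) (𝓝 (∑' n, c n)) := by
    refine h2.congr' ?_
    filter_upwards [hev] with r hr using (hS r hr.1 hr.2).tsum_eq
  rw [tendsto_nhds_unique hL h3]
  exact hsum.hasSum

lemma lintegral_fejer_renewal_eq {a : ℝ} (ha : 0 < a) (x : ℝ) {L : ℝ}
    (hL : Tendsto (fun r : ℝ => (1 / Real.pi) * ∫ θ in (0 : ℝ)..a, (1 - θ / a) *
        (Complex.exp (-((θ * x : ℝ) * Complex.I)) * (1 - r * charFun F θ)⁻¹).re)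
      (𝓝[<] 1) (𝓝 L)) :
    ∫⁻ y, ENNReal.ofReal (fejer a (y - x)) ∂(renewalMeasure F) = ENNReal.ofReal L ∧ 0 ≤ L := by
  have h0 : ∀ n, 0 ≤ ∫ y, fejer a (y - x) ∂(convPow F n) := fun n =>
    integral_nonneg fun y => fejer_nonneg ha _
  have h := hasSum_of_tendsto_powerSeries h0 (fun r hr0 hr1 => hasSum_fejer F ha x hr0 hr1) hL
  refine ⟨?_, h.nonneg h0⟩
  rw [renewalMeasure, lintegral_sum_measure, ← h.tsum_eq, ENNReal.ofReal_tsum_of_nonneg h0 h.summable]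
  congr 1
  ext n
  rw [ofReal_integral_eq_lintegral_ofReal (integral_fejer_sub (convPow F n) ha x).1
    (Eventually.of_forall fun y => fejer_nonneg ha _)]

/-- In 1 - rφ = (1 - r) + r(1 - φ) the cross term is nonnegative because Re (1 - φ) ≥ 0, and r² ≥
1/4. This bound, uniform in r, drives the passage r ↑ 1. -/
lemma normSq_resolvent_ge {r : ℝ} (hr : 1 / 2 ≤ r) (hr1 : r ≤ 1) (θ : ℝ) :
    (1 - r) ^ 2 + Complex.normSq (1 - charFun F θ) / 4 ≤
      Complex.normSq (1 - r * charFun F θ) := by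
  have hre : 0 ≤ (1 - charFun F θ).re := by simpa using one_sub_re_charFun_nonneg F θ
  set D := 1 - charFun F θ with hD
  have e : (1 : ℂ) - r * charFun F θ = (1 - r : ℝ) + r * D := by
    rw [hD]; push_cast; ring
  rw [e, Complex.normSq_apply, Complex.normSq_apply]
  simp only [Complex.add_re, Complex.ofReal_re, Complex.mul_re, Complex.ofReal_im, zero_mul,
    sub_zero, Complex.add_im, Complex.mul_im, zero_add, add_zero]
  have h1 : 0 ≤ (1 - r) * (r * D.re) := mul_nonneg (by linarith) (mul_nonneg (by linarith) hre)
  have h2 : 1 / 4 ≤ r ^ 2 := by nlinarith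
  have h3 : 1 / 4 * (D.re ^ 2 + D.im ^ 2) ≤ r ^ 2 * (D.re ^ 2 + D.im ^ 2) := by gcongr
  nlinarith

end Fejer

/-! ### The limit r ↑ 1 and the inversion formula. -/

section Limit

variable {F : Measure ℝ} [IsProbabilityMeasure F]

lemma CondHa.integrableOn_re_resolvent (hHa : CondHa F) (hHb : CondHb F) {a : ℝ}
    (hφ : ∀ θ, 0 < θ → θ ≤ a → charFun F θ ≠ 1) :
    IntegrableOn (fun θ => ((1 - charFun F θ)⁻¹).re) (Set.Ioc 0 a) := by
  obtain ⟨x₁, hx₁, h1⟩ := hHa.resolventMass_bounds one_pos le_rfl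
  obtain ⟨x₂, hx₂, h2⟩ := hHa.tailRatio_lt_top hHb
  set x := max x₁ x₂ with hx
  have hxp : 0 < x := by have := le_max_left x₁ x₂; linarith
  have hfin : resolventMass F x < ∞ := by
    refine ((h1 x (le_max_left _ _)).2.1).trans_lt ?_
    exact ENNReal.add_lt_top.2 ⟨ENNReal.mul_lt_top ENNReal.ofReal_lt_top (h2 x (le_max_right _ _)),
      ENNReal.ofReal_lt_top⟩
  have hm : Measurable fun θ => ((1 - charFun F θ)⁻¹).re := by
    have := (continuous_charFun (μ := F)).measurable
    exact Complex.measurable_re.comp (by fun_prop)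
  have i1 : IntegrableOn (fun θ => ((1 - charFun F θ)⁻¹).re) (Set.Ioo 0 x⁻¹) := by
    refine ⟨hm.aestronglyMeasurable, ?_⟩
    rw [hasFiniteIntegral_iff_ofReal
      (Eventually.of_forall fun θ => re_one_sub_charFun_inv_nonneg F θ)]
    exact hfin
  have hxi : 0 < x⁻¹ := inv_pos.2 hxp
  have i2 : IntegrableOn (fun θ => ((1 - charFun F θ)⁻¹).re) (Set.Icc x⁻¹ a) := by
    refine ContinuousOn.integrableOn_Icc (Complex.continuous_re.comp_continuousOn ?_)
    refine ContinuousOn.inv₀ (continuous_const.sub continuous_charFun).continuousOn ?_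
    intro θ hθ h0
    exact hφ θ (hxi.trans_le hθ.1) hθ.2 (sub_eq_zero.1 h0).symm
  refine (i1.union i2).mono_set fun θ hθ => ?_
  rcases lt_or_ge θ x⁻¹ with h | h
  · exact Or.inl ⟨hθ.1, h⟩
  · exact Or.inr ⟨h, hθ.2⟩

/-- `|1 - φ(θ)| ≥ M θ` near the origin, for every `M`. -/
lemma CondHa.mul_le_norm_one_sub (hHa : CondHa F) (hlim : Tendsto (truncMean F) atTop atTop)
    (M : ℝ) : ∃ δ : ℝ, 0 < δ ∧ ∀ θ, 0 < θ → θ ≤ δ → M * θ ≤ ‖1 - charFun F θ‖ := by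
  obtain ⟨δ, hδ, h⟩ := hHa.one_sub_charFun_asymp (ε := 1 / 2) (by norm_num)
  obtain ⟨x₀, hx₀⟩ := eventually_atTop.1 (hlim.eventually_ge_atTop (2 * M))
  have hm : 0 < max x₀ 1 := by positivity
  refine ⟨min δ (max x₀ 1)⁻¹, by positivity, fun θ hθ hθδ => ?_⟩
  obtain ⟨hA, hn⟩ := h θ hθ (hθδ.trans (min_le_left _ _))
  have h1 := (norm_bounds_of_near (mul_pos hθ hA) le_rfl hn).1
  have h2 : max x₀ 1 ≤ θ⁻¹ := by
    rw [le_inv_comm₀ hm hθ]; exact hθδ.trans (min_le_right _ _)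
  have h3 := hx₀ _ ((le_max_left _ _).trans h2)
  nlinarith

lemma CondHa.mul_norm_inv_le (hHa : CondHa F) (hlim : Tendsto (truncMean F) atTop atTop) {a : ℝ}
    (ha : 0 < a) (hφ : ∀ θ, 0 < θ → θ ≤ a → charFun F θ ≠ 1) :
    ∃ C : ℝ, 0 < C ∧ ∀ θ, 0 < θ → θ ≤ a → θ * ‖(1 - charFun F θ)⁻¹‖ ≤ C := by
  obtain ⟨δ, hδ, h⟩ := hHa.mul_le_norm_one_sub hlim 1
  obtain ⟨M, hM, hM'⟩ := exists_norm_inv_le hδ hφ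
  refine ⟨1 + a * M, by positivity, fun θ hθ hθa => ?_⟩
  rcases le_total θ δ with h1 | h1
  · have h2 := h θ hθ h1
    rw [one_mul] at h2
    rw [norm_inv, ← div_eq_mul_inv]
    have : θ / ‖1 - charFun F θ‖ ≤ 1 := (div_le_one (hθ.trans_le h2)).2 h2
    have : 0 ≤ a * M := by positivity
    linarith
  · have := hM' θ h1 hθa
    calc _ ≤ a * M := by gcongr
      _ ≤ _ := by linarith

lemma integral_cauchy_le {ε m : ℝ} (hε : 0 < ε) (hm : 0 < m) (d : ℝ) :
    ∫ θ in (0 : ℝ)..d, ε / (ε ^ 2 + (m * θ) ^ 2) ≤ 2 / m := by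
  have hder : ∀ θ ∈ Set.uIcc 0 d, HasDerivAt (fun θ => 1 / m * Real.arctan (m / ε * θ))
      (ε / (ε ^ 2 + (m * θ) ^ 2)) θ := by
    intro θ _
    have h0 : HasDerivAt (fun θ : ℝ => m / ε * θ) (m / ε) θ := by
      simpa using (hasDerivAt_id θ).const_mul (m / ε)
    have h1 := (h0.arctan).const_mul (1 / m)
    exact h1.congr_deriv (by field_simp)
  have hne : ∀ θ : ℝ, ε ^ 2 + (m * θ) ^ 2 ≠ 0 := fun θ => by positivity
  rw [intervalIntegral.integral_eq_sub_of_hasDerivAt hder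
    (Continuous.intervalIntegrable (continuous_const.div (by fun_prop) hne) _ _)]
  simp only [mul_zero, Real.arctan_zero, sub_zero]
  have h1 := (Real.arctan_lt_pi_div_two (m / ε * d)).le
  have h2 := Real.pi_lt_four
  calc 1 / m * Real.arctan (m / ε * d) ≤ 1 / m * 2 := by gcongr; linarith
    _ = _ := by ring

/-- Near 0 the factor is at most a Cauchy kernel (1 - r)/((1 - r)² + (mθ)²), of mass at most 2/m; A
→ ∞ permits every m. For a finite positive mean the limit would be a nonzero multiple of g(0)
instead. -/
lemma CondHa.tendsto_integral_concentrating (hHa : CondHa F)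
    (hlim : Tendsto (truncMean F) atTop atTop) {a : ℝ} (ha : 0 < a)
    (hφ : ∀ θ, 0 < θ → θ ≤ a → charFun F θ ≠ 1) {g : ℝ → ℝ} (hg : Continuous g)
    (hg1 : ∀ θ, 0 ≤ θ → θ ≤ a → |g θ| ≤ 1) :
    Tendsto (fun r : ℝ => ∫ θ in (0 : ℝ)..a, g θ *
      ((1 - r) / Complex.normSq (1 - r * charFun F θ))) (𝓝[<] 1) (𝓝 0) := by
  have hφc := continuous_charFun (μ := F)
  have hrc : ∀ r : ℝ, 1 / 2 < r → r < 1 → Continuous fun θ => g θ *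
      ((1 - r) / Complex.normSq (1 - r * charFun F θ)) := by
    intro r h1 h2
    refine hg.mul (continuous_const.div
      (Complex.continuous_normSq.comp (by fun_prop)) fun θ => ?_)
    have := normSq_resolvent_ge F h1.le h2.le θ
    have h3 := Complex.normSq_nonneg (1 - charFun F θ)
    have h4 : 0 < (1 - r) ^ 2 := by have : 0 < 1 - r := by linarith
                                    positivity
    intro h0
    rw [h0] at this
    linarith
  rw [Metric.tendsto_nhds]
  intro ε hε
  -- A slope of at least 2m with m = 4/ε, so that the Cauchy mass 2/m is ε/2.
  obtain ⟨δ, hδ, hδM⟩ := hHa.mul_le_norm_one_sub hlim (8 / ε + 1)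
  set d := min δ a with hd
  have hd0 : 0 < d := by positivity
  have hda : d ≤ a := min_le_right _ _
  obtain ⟨M, hM, hM'⟩ := exists_norm_inv_le hd0 hφ
  have hev : ∀ᶠ r : ℝ in 𝓝[<] 1, 1 / 2 < r ∧ r < 1 ∧ (1 - r) * (4 * M ^ 2 * a) < ε / 2 := by
    have h1 : Tendsto (fun r : ℝ => (1 - r) * (4 * M ^ 2 * a)) (𝓝[<] 1) (𝓝 0) := by
      have : Continuous fun r : ℝ => (1 - r) * (4 * M ^ 2 * a) := by fun_prop
      have := this.tendsto 1
      simp only [sub_self, zero_mul] at this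
      exact this.mono_left nhdsWithin_le_nhds
    filter_upwards [Ioo_mem_nhdsLT (by norm_num : (1 / 2 : ℝ) < 1),
      h1.eventually_lt_const (half_pos hε)] with r hr h2
    exact ⟨hr.1, hr.2, h2⟩
  filter_upwards [hev] with r hr
  obtain ⟨hr0, hr1, hr2⟩ := hr
  rw [dist_zero_right]
  have hrp : 0 < 1 - r := by linarith
  have hc := hrc r hr0 hr1
  rw [← intervalIntegral.integral_add_adjacent_intervals (hc.intervalIntegrable 0 d)
    (hc.intervalIntegrable d a)]
  refine (norm_add_le _ _).trans_lt ?_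
  set m := 4 / ε with hm
  have hmp : 0 < m := by positivity
  have b0 : ∀ θ, 0 ≤ θ → θ ≤ a →
      ‖g θ * ((1 - r) / Complex.normSq (1 - r * charFun F θ))‖ ≤
      (1 - r) / ((1 - r) ^ 2 + Complex.normSq (1 - charFun F θ) / 4) := by
    intro θ h0 h1
    have h2 := normSq_resolvent_ge F hr0.le hr1.le θ
    have h3 := Complex.normSq_nonneg (1 - charFun F θ)
    rw [norm_mul, norm_div, Real.norm_of_nonneg hrp.le,
      Real.norm_of_nonneg (Complex.normSq_nonneg _), Real.norm_eq_abs]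
    calc _ ≤ 1 * ((1 - r) / ((1 - r) ^ 2 + Complex.normSq (1 - charFun F θ) / 4)) := by
          gcongr
          · exact div_nonneg hrp.le (Complex.normSq_nonneg _)
          · exact hg1 θ h0 h1
      _ = _ := one_mul _
  have b1 : ‖∫ θ in (0 : ℝ)..d, g θ * ((1 - r) / Complex.normSq (1 - r * charFun F θ))‖ ≤
      ε / 2 := by
    have hne : ∀ θ : ℝ, (1 - r) ^ 2 + (m * θ) ^ 2 ≠ 0 := fun θ => by positivity
    have := intervalIntegral.norm_integral_le_of_norm_le (μ := volume) hd0.le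
      (g := fun θ => (1 - r) / ((1 - r) ^ 2 + (m * θ) ^ 2))
      (f := fun θ => g θ * ((1 - r) / Complex.normSq (1 - r * charFun F θ)))
      (Eventually.of_forall fun θ hθ => by
        refine (b0 θ hθ.1.le (hθ.2.trans hda)).trans ?_
        have h4 := hδM θ hθ.1 (hθ.2.trans (min_le_left _ _))
        have h6 : 2 * m * θ ≤ ‖1 - charFun F θ‖ := by
          refine le_trans ?_ h4
          have hθp : 0 < θ := hθ.1
          gcongr
          have : 2 * m = 8 / ε := by rw [hm]; ring
          linarith
        have h5 : (m * θ) ^ 2 ≤ Complex.normSq (1 - charFun F θ) / 4 := by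
          rw [Complex.normSq_eq_norm_sq]
          have hθp : 0 < θ := hθ.1
          have := pow_le_pow_left₀ (by positivity) h6 2
          linarith
        gcongr)
      (Continuous.intervalIntegrable (continuous_const.div (by fun_prop) hne) _ _)
    refine this.trans ((integral_cauchy_le hrp hmp d).trans (le_of_eq ?_))
    rw [hm]; field_simp; norm_num
  have b2 : ‖∫ θ in d..a, g θ * ((1 - r) / Complex.normSq (1 - r * charFun F θ))‖ < ε / 2 := by
    have := intervalIntegral.norm_integral_le_of_norm_le_const (a := d) (b := a)
      (f := fun θ => g θ * ((1 - r) / Complex.normSq (1 - r * charFun F θ)))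
      (C := (1 - r) * (4 * M ^ 2)) (fun θ hθ => by
        rw [Set.uIoc_of_le hda] at hθ
        have hθ0 : 0 < θ := hd0.trans hθ.1
        refine (b0 θ hθ0.le hθ.2).trans ?_
        have h1 := hM' θ hθ.1.le hθ.2
        have hD : 0 < ‖1 - charFun F θ‖ := norm_pos_iff.2 fun h0 =>
          hφ θ hθ0 hθ.2 (sub_eq_zero.1 h0).symm
        rw [norm_inv] at h1
        rw [Complex.normSq_eq_norm_sq]
        calc (1 - r) / ((1 - r) ^ 2 + ‖1 - charFun F θ‖ ^ 2 / 4)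
            ≤ (1 - r) / (‖1 - charFun F θ‖ ^ 2 / 4) := by
              gcongr
              have : 0 < (1 - r) ^ 2 := by positivity
              linarith
          _ = (1 - r) * (4 * (‖1 - charFun F θ‖⁻¹) ^ 2) := by field_simp
          _ ≤ _ := by gcongr)
    refine this.trans_lt (lt_of_le_of_lt ?_ hr2)
    rw [abs_of_nonneg (by linarith)]
    calc (1 - r) * (4 * M ^ 2) * (a - d) ≤ (1 - r) * (4 * M ^ 2) * a := by
          gcongr; linarith
      _ = _ := by ring
  linarith

/-- The integrand in the inversion formula for the renewal measure. -/
noncomputable def inversionIntegrand (F : Measure ℝ) (a x θ : ℝ) : ℝ :=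
  (1 - θ / a) * (Real.cos (θ * x) * ((1 - charFun F θ)⁻¹).re +
    Real.sin (θ * x) * ((1 - charFun F θ)⁻¹).im)

lemma re_exp_neg_mul (t : ℝ) (z : ℂ) :
    (Complex.exp (-((t : ℝ) * Complex.I)) * z).re = Real.cos t * z.re + Real.sin t * z.im := by
  rw [← neg_mul, ← Complex.ofReal_neg, Complex.mul_re, Complex.exp_ofReal_mul_I_re,
    Complex.exp_ofReal_mul_I_im, Real.cos_neg, Real.sin_neg]
  ring

lemma inversionIntegrand_eq (F : Measure ℝ) (a x θ : ℝ) : inversionIntegrand F a x θ =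
    (Complex.exp (-((θ * x : ℝ) * Complex.I)) * fejerResolvent F a θ).re := by
  rw [re_exp_neg_mul, inversionIntegrand, fejerResolvent, Complex.re_ofReal_mul,
    Complex.im_ofReal_mul]
  ring

/-- Re (1 - rφ) = (1 - r) + r Re (1 - φ). The first summand gives a concentrating kernel, which
vanishes in the limit. The remainder converges by domination: its real part by Re (1 - φ)⁻¹,
integrable under (Hb), and its imaginary part because |sin(θx)| ≤ θ|x| and θ|1 - φ|⁻¹ is bounded. -/
lemma CondHa.intervalIntegrable_inversionIntegrand (hHa : CondHa F) (hHb : CondHb F)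
    (hlim : Tendsto (truncMean F) atTop atTop) {a : ℝ} (ha : 0 < a)
    (hφ : ∀ θ, 0 < θ → θ ≤ a → charFun F θ ≠ 1) (x : ℝ) :
    IntervalIntegrable (inversionIntegrand F a x) volume 0 a ∧
    Tendsto (fun r : ℝ => (1 / Real.pi) * ∫ θ in (0 : ℝ)..a, (1 - θ / a) *
        (Complex.exp (-((θ * x : ℝ) * Complex.I)) * (1 - r * charFun F θ)⁻¹).re)
      (𝓝[<] 1) (𝓝 ((1 / Real.pi) * ∫ θ in (0 : ℝ)..a, inversionIntegrand F a x θ)) := by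
  have hφc := continuous_charFun (μ := F)
  obtain ⟨C, hC, hCb⟩ := hHa.mul_norm_inv_le hlim ha hφ
  have hQ := hHa.integrableOn_re_resolvent hHb hφ
  set bound : ℝ → ℝ := fun θ => 4 * ((1 - charFun F θ)⁻¹).re + 4 * |x| * C with hbound
  have ibound : IntervalIntegrable bound volume 0 a := by
    rw [intervalIntegrable_iff_integrableOn_Ioc_of_le ha.le]
    exact Integrable.add (hQ.const_mul 4) (integrable_const (4 * |x| * C))
  have hw : ∀ θ, 0 < θ → θ ≤ a → |1 - θ / a| ≤ 1 := by
    intro θ h0 h1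
    have h3 : θ / a ≤ 1 := (div_le_one ha).2 h1
    have h4 : 0 ≤ θ / a := div_nonneg h0.le ha.le
    rw [abs_le]; constructor <;> linarith
  have key : ∀ (r : ℝ), 1 / 2 ≤ r → r ≤ 1 → ∀ θ, 0 < θ → θ ≤ a →
      ‖(1 - θ / a) * (Real.cos (θ * x) * (r * (1 - charFun F θ).re /
        Complex.normSq (1 - r * charFun F θ)) + Real.sin (θ * x) *
        (-(r * (1 - charFun F θ).im) / Complex.normSq (1 - r * charFun F θ)))‖ ≤ bound θ := by
    intro r hr0 hr1 θ h0 h1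
    set D := 1 - charFun F θ with hD
    have hre : 0 ≤ D.re := by simpa [hD] using one_sub_re_charFun_nonneg F θ
    have hDne : D ≠ 0 := fun h => hφ θ h0 h1 (sub_eq_zero.1 h).symm
    have hDp : 0 < Complex.normSq D := Complex.normSq_pos.2 hDne
    have h2 := normSq_resolvent_ge F hr0 hr1 θ
    have hN : Complex.normSq D / 4 ≤ Complex.normSq (1 - r * charFun F θ) := by
      have := sq_nonneg (1 - r); linarith
    set N := Complex.normSq (1 - r * charFun F θ) with hNdef
    have hNp : 0 < N := by linarith
    have e1 : |Real.cos (θ * x) * (r * D.re / N)| ≤ 4 * (D⁻¹).re := by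
      rw [abs_mul, abs_of_nonneg (a := r * D.re / N) (by positivity), Complex.inv_re]
      calc |Real.cos (θ * x)| * (r * D.re / N) ≤ 1 * (1 * D.re / (Complex.normSq D / 4)) := by
            gcongr
            exact Real.abs_cos_le_one _
        _ = _ := by field_simp
    have e2 : |Real.sin (θ * x) * (-(r * D.im) / N)| ≤ 4 * |x| * C := by
      rw [abs_mul, abs_div, abs_neg, abs_mul, abs_of_pos hNp,
        abs_of_nonneg (by linarith : 0 ≤ r)]
      have q1 : |Real.sin (θ * x)| ≤ θ * |x| := by
        refine Real.abs_sin_le_abs.trans ?_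
        rw [abs_mul, abs_of_pos h0]
      calc |Real.sin (θ * x)| * (r * |D.im| / N)
          ≤ θ * |x| * (1 * ‖D‖ / (Complex.normSq D / 4)) := by
            gcongr
            exact Complex.abs_im_le_norm D
        _ = 4 * |x| * (θ * ‖D⁻¹‖) := by
            have : 0 < ‖D‖ := norm_pos_iff.2 hDne
            rw [Complex.normSq_eq_norm_sq, norm_inv]; field_simp
        _ ≤ _ := by gcongr; exact hCb θ h0 h1
    rw [norm_mul, Real.norm_eq_abs, Real.norm_eq_abs]
    calc _ ≤ 1 * (4 * (D⁻¹).re + 4 * |x| * C) := by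
          gcongr
          · exact hw θ h0 h1
          · exact (abs_add_le _ _).trans (add_le_add e1 e2)
      _ = _ := one_mul _
  have hmeas : ∀ r : ℝ, Measurable fun θ => (1 - θ / a) * (Real.cos (θ * x) *
      (r * (1 - charFun F θ).re / Complex.normSq (1 - r * charFun F θ)) + Real.sin (θ * x) *
        (-(r * (1 - charFun F θ).im) / Complex.normSq (1 - r * charFun F θ))) := by
    intro r
    have h0 := hφc.measurable
    have h1 : Measurable fun θ => (1 - charFun F θ).re := Complex.measurable_re.comp (by fun_prop)
    have h2 : Measurable fun θ => (1 - charFun F θ).im := Complex.measurable_im.comp (by fun_prop)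
    have h3 : Measurable fun θ => Complex.normSq (1 - r * charFun F θ) :=
      Complex.continuous_normSq.measurable.comp (by fun_prop)
    fun_prop
  have hlimit : ∀ θ, inversionIntegrand F a x θ = (1 - θ / a) * (Real.cos (θ * x) *
      ((1 : ℝ) * (1 - charFun F θ).re / Complex.normSq (1 - (1 : ℝ) * charFun F θ)) +
      Real.sin (θ * x) * (-((1 : ℝ) * (1 - charFun F θ).im) /
        Complex.normSq (1 - (1 : ℝ) * charFun F θ))) := by
    intro θ
    rw [inversionIntegrand, Complex.inv_re, Complex.inv_im]
    simp
  have hii : IntervalIntegrable (inversionIntegrand F a x) volume 0 a := by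
    refine ibound.mono_fun' ?_ ?_
    · have := (hmeas 1).aestronglyMeasurable (μ := volume.restrict (Set.uIoc 0 a))
      simp_rw [← hlimit] at this
      exact this
    · filter_upwards [ae_restrict_mem measurableSet_uIoc] with θ hθ
      rw [Set.uIoc_of_le ha.le] at hθ
      rw [hlimit]
      exact key 1 (by norm_num) le_rfl θ hθ.1 hθ.2
  refine ⟨hii, ?_⟩
  refine Tendsto.const_mul _ ?_
  have hev : ∀ᶠ r : ℝ in 𝓝[<] 1, 1 / 2 < r ∧ r < 1 := by
    filter_upwards [Ioo_mem_nhdsLT (by norm_num : (1 / 2 : ℝ) < 1)] with r hr using hr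
  have t1 : Tendsto (fun r : ℝ => ∫ θ in (0 : ℝ)..a, (1 - θ / a) * (Real.cos (θ * x) *
      (r * (1 - charFun F θ).re / Complex.normSq (1 - r * charFun F θ)) + Real.sin (θ * x) *
        (-(r * (1 - charFun F θ).im) / Complex.normSq (1 - r * charFun F θ)))) (𝓝[<] 1)
      (𝓝 (∫ θ in (0 : ℝ)..a, inversionIntegrand F a x θ)) := by
    refine intervalIntegral.tendsto_integral_filter_of_dominated_convergence bound ?_ ?_ ibound ?_
    · exact Eventually.of_forall fun r => (hmeas r).aestronglyMeasurable
    · filter_upwards [hev] with r hr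
      refine Eventually.of_forall fun θ hθ => ?_
      rw [Set.uIoc_of_le ha.le] at hθ
      exact key r hr.1.le hr.2.le θ hθ.1 hθ.2
    · refine Eventually.of_forall fun θ hθ => ?_
      rw [Set.uIoc_of_le ha.le] at hθ
      rw [hlimit]
      have hne : Complex.normSq (1 - (1 : ℝ) * charFun F θ) ≠ 0 := by
        rw [Ne, Complex.normSq_eq_zero, Complex.ofReal_one, one_mul]
        exact fun h => hφ θ hθ.1 hθ.2 (sub_eq_zero.1 h).symm
      have hcN : ContinuousAt (fun r : ℝ => Complex.normSq (1 - r * charFun F θ)) 1 :=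
        (Complex.continuous_normSq.comp (by fun_prop)).continuousAt
      have hca : ContinuousAt (fun r : ℝ => (1 - θ / a) * (Real.cos (θ * x) *
          (r * (1 - charFun F θ).re / Complex.normSq (1 - r * charFun F θ)) + Real.sin (θ * x) *
          (-(r * (1 - charFun F θ).im) / Complex.normSq (1 - r * charFun F θ)))) 1 := by
        refine continuousAt_const.mul (ContinuousAt.add (continuousAt_const.mul ?_)
          (continuousAt_const.mul ?_))
        · exact ContinuousAt.div (by fun_prop) hcN hne
        · exact ContinuousAt.div (by fun_prop) hcN hne
      exact hca.tendsto.mono_left nhdsWithin_le_nhds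
  have t2 := hHa.tendsto_integral_concentrating hlim ha hφ
    (g := fun θ => max 0 (1 - θ / a) * Real.cos (θ * x)) (by fun_prop) (by
      intro θ h0 h1
      have h3 : θ / a ≤ 1 := (div_le_one ha).2 h1
      have h4 : 0 ≤ θ / a := div_nonneg h0 ha.le
      rw [abs_mul, max_eq_right (by linarith), abs_of_nonneg (by linarith)]
      calc _ ≤ (1 : ℝ) * 1 := by
            gcongr
            · linarith
            · exact Real.abs_cos_le_one _
        _ = 1 := one_mul _)
  have t3 := t1.add t2
  rw [add_zero] at t3
  refine t3.congr' ?_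
  filter_upwards [hev] with r hr
  have hrp : 0 < 1 - r := by linarith [hr.2]
  have hNc : Continuous fun θ => Complex.normSq (1 - r * charFun F θ) :=
    Complex.continuous_normSq.comp (by fun_prop)
  have hNne : ∀ θ, Complex.normSq (1 - r * charFun F θ) ≠ 0 := by
    intro θ h0
    have := normSq_resolvent_ge F hr.1.le hr.2.le θ
    have h3 := Complex.normSq_nonneg (1 - charFun F θ)
    have h4 : 0 < (1 - r) ^ 2 := by positivity
    rw [h0] at this
    linarith
  have hrec : Continuous fun θ => (1 - charFun F θ).re := Complex.continuous_re.comp (by fun_prop)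
  have himc : Continuous fun θ => (1 - charFun F θ).im := Complex.continuous_im.comp (by fun_prop)
  rw [← intervalIntegral.integral_add]
  · refine intervalIntegral.integral_congr fun θ hθ => ?_
    rw [Set.uIcc_of_le ha.le] at hθ
    have h3 : θ / a ≤ 1 := (div_le_one ha).2 hθ.2
    rw [max_eq_right (by linarith), re_exp_neg_mul, Complex.inv_re, Complex.inv_im]
    have hN := hNne θ
    set N := Complex.normSq (1 - r * charFun F θ)
    have e1 : (1 - (r : ℂ) * charFun F θ).re = (1 - r) + r * (1 - charFun F θ).re := by
      simp; ring
    have e2 : (1 - (r : ℂ) * charFun F θ).im = r * (1 - charFun F θ).im := by simp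
    rw [e1, e2]
    field_simp
    ring
  · refine Continuous.intervalIntegrable ?_ _ _
    have a1 : Continuous fun θ => r * (1 - charFun F θ).re /
        Complex.normSq (1 - r * charFun F θ) := (hrec.const_mul r).div hNc hNne
    have a2 : Continuous fun θ => -(r * (1 - charFun F θ).im) /
        Complex.normSq (1 - r * charFun F θ) := ((himc.const_mul r).neg).div hNc hNne
    fun_prop
  · refine Continuous.intervalIntegrable ?_ _ _
    have a1 : Continuous fun θ => (1 - r) / Complex.normSq (1 - r * charFun F θ) :=
      continuous_const.div hNc hNne
    fun_prop

/-- Fourier inversion for the renewal measure smoothed by the Fejér kernel. -/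
lemma CondHa.lintegral_fejer_renewal (hHa : CondHa F) (hHb : CondHb F)
    (hE : ∫⁻ x, ENNReal.ofReal |x| ∂F = ∞) {a : ℝ} (ha : 0 < a)
    (hφ : ∀ θ, 0 < θ → θ ≤ a → charFun F θ ≠ 1) (x : ℝ) :
    IntervalIntegrable (inversionIntegrand F a x) volume 0 a ∧
    ∫⁻ y, ENNReal.ofReal (fejer a (y - x)) ∂(renewalMeasure F) =
      ENNReal.ofReal ((1 / Real.pi) * ∫ θ in (0 : ℝ)..a, inversionIntegrand F a x θ) ∧
    0 ≤ (1 / Real.pi) * ∫ θ in (0 : ℝ)..a, inversionIntegrand F a x θ := by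
  obtain ⟨hlim, -⟩ := hHa.tendsto_truncMean hHb hE
  obtain ⟨h1, h2⟩ := hHa.intervalIntegrable_inversionIntegrand hHb hlim ha hφ x
  exact ⟨h1, lintegral_fejer_renewal_eq F ha x h2⟩

end Limit

end RelStableRenewal


namespace RelStableRenewal

/-! ### Transience is equivalent to (Hb). -/

section Transience

lemma integral_one_sub_cos_mul_div_sq (c : ℝ) :
    IntegrableOn (fun θ => (1 - Real.cos (c * θ)) / θ ^ 2) (Set.Ioi 0) ∧
      ∫ θ in Set.Ioi (0 : ℝ), (1 - Real.cos (c * θ)) / θ ^ 2 = |c| * (Real.pi / 2) := by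
  have hpos : ∀ c : ℝ, 0 < c → IntegrableOn (fun θ => (1 - Real.cos (c * θ)) / θ ^ 2) (Set.Ioi 0) ∧
      ∫ θ in Set.Ioi (0 : ℝ), (1 - Real.cos (c * θ)) / θ ^ 2 = c * (Real.pi / 2) := by
    intro c hc
    have e : ∀ θ : ℝ, (1 - Real.cos (c * θ)) / θ ^ 2 =
        c ^ 2 * ((1 - Real.cos (c * θ)) / (c * θ) ^ 2) := by
      intro θ
      rw [mul_pow, ← mul_div_assoc, mul_div_mul_left _ _ (by positivity)]
    simp_rw [e]
    constructor
    · refine Integrable.const_mul ?_ _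
      have := (integrableOn_Ioi_comp_mul_left_iff (fun u : ℝ => (1 - Real.cos u) / u ^ 2) 0 hc).2
        (by rw [mul_zero]; exact integrableOn_one_sub_cos_div_sq)
      exact this
    · rw [integral_const_mul, integral_comp_mul_left_Ioi (fun u : ℝ => (1 - Real.cos u) / u ^ 2) 0 hc,
        mul_zero, integral_one_sub_cos_div_sq, smul_eq_mul]
      field_simp
  rcases lt_trichotomy c 0 with h | h | h
  · have := hpos (-c) (by linarith)
    simp only [neg_mul, Real.cos_neg] at this
    rw [abs_of_neg h, neg_mul]
    exact this
  · subst h; simp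
  · rw [abs_of_pos h]; exact hpos c h

/-- Product-to-sum formulas reduce this to three integrals of (1 - cos cθ)/θ². The result is (π/2)
max(1 - |y|, 0), supported in [-1, 1], so the mass of U on [-1, 1] controls the weighted resolvent.
-/
lemma integral_fejer_mul_cos (y : ℝ) :
    ∫ θ in Set.Ioi (0 : ℝ), (1 - Real.cos θ) / θ ^ 2 * Real.cos (θ * y) =
      Real.pi / 2 * ((|1 + y| + |1 - y|) / 2 - |y|) := by
  obtain ⟨i1, e1⟩ := integral_one_sub_cos_mul_div_sq (1 + y)
  obtain ⟨i2, e2⟩ := integral_one_sub_cos_mul_div_sq (1 - y)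
  obtain ⟨i3, e3⟩ := integral_one_sub_cos_mul_div_sq y
  have h : ∀ θ : ℝ, (1 - Real.cos θ) / θ ^ 2 * Real.cos (θ * y) =
      ((1 - Real.cos ((1 + y) * θ)) / θ ^ 2 + (1 - Real.cos ((1 - y) * θ)) / θ ^ 2) / 2 -
        (1 - Real.cos (y * θ)) / θ ^ 2 := by
    intro θ
    have a1 : (1 + y) * θ = θ + y * θ := by ring
    have a2 : (1 - y) * θ = θ - y * θ := by ring
    rw [a1, a2, Real.cos_add, Real.cos_sub, mul_comm θ y]
    ring
  simp_rw [h]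
  have i12 := (i1.add i2).div_const 2
  have := integral_sub i12 i3
  simp only [Pi.add_apply] at this
  rw [this, integral_div, integral_add i1 i2, e1, e2, e3]
  ring

lemma triangle_le (y : ℝ) : (|1 + y| + |1 - y|) / 2 - |y| ≤
    (Set.Icc (-1) 1 : Set ℝ).indicator (fun _ => (1 : ℝ)) y := by
  by_cases hy : y ∈ Set.Icc (-1 : ℝ) 1
  · rw [Set.indicator_of_mem hy, abs_of_nonneg (by linarith [hy.1]), abs_of_nonneg (by linarith [hy.2])]
    linarith [abs_nonneg y]
  · rw [Set.indicator_of_notMem hy]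
    rw [Set.mem_Icc, not_and_or, not_le, not_le] at hy
    rcases hy with h | h
    · rw [abs_of_neg (by linarith), abs_of_pos (by linarith), abs_of_neg (by linarith)]
      linarith
    · rw [abs_of_pos (by linarith), abs_of_neg (by linarith), abs_of_pos (by linarith)]
      linarith

lemma integrable_fejer_mul_re_charFun (μ : Measure ℝ) [IsProbabilityMeasure μ] :
    ∫ θ in Set.Ioi (0 : ℝ), (1 - Real.cos θ) / θ ^ 2 * (charFun μ θ).re ≤
      Real.pi / 2 * μ.real (Set.Icc (-1) 1) := by
  have hint : Integrable (Function.uncurry fun (y θ : ℝ) =>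
      (1 - Real.cos θ) / θ ^ 2 * Real.cos (θ * y)) (μ.prod (volume.restrict (Set.Ioi 0))) := by
    have h1 : Integrable (fun p : ℝ × ℝ => (1 - Real.cos p.2) / p.2 ^ 2)
        (μ.prod (volume.restrict (Set.Ioi 0))) := integrableOn_one_sub_cos_div_sq.integrable.comp_snd μ
    refine h1.mono' (Measurable.aestronglyMeasurable (by fun_prop)) (Eventually.of_forall fun p => ?_)
    rw [Function.uncurry, norm_mul, Real.norm_of_nonneg (one_sub_cos_div_sq_nonneg _)]
    exact mul_le_of_le_one_right (one_sub_cos_div_sq_nonneg _) (Real.abs_cos_le_one _)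
  simp_rw [re_charFun, ← integral_const_mul]
  rw [← integral_integral_swap hint]
  have hi := hint.integral_prod_left
  simp only [Function.uncurry_apply_pair] at hi
  have e : Real.pi / 2 * μ.real (Set.Icc (-1) 1) =
      ∫ y, Real.pi / 2 * (Set.Icc (-1) 1 : Set ℝ).indicator (fun _ => (1 : ℝ)) y ∂μ := by
    rw [integral_const_mul, integral_indicator measurableSet_Icc]; simp
  rw [e]
  refine integral_mono hi (((integrable_const _).indicator measurableSet_Icc).const_mul _) fun y => ?_
  simp only
  rw [integral_fejer_mul_cos]
  exact mul_le_mul_of_nonneg_left (triangle_le y) (by positivity)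

variable {F : Measure ℝ} [IsProbabilityMeasure F]

/-- Expand the resolvent as a geometric series: the n-th term is at most π/2 times the mass of
F^{n*} on [-1, 1]. The resulting bound does not depend on r. -/
lemma integral_fejer_mul_resolvent_le
    (hU : renewalMeasure F (Set.Icc (-1) 1) < ∞) {r : ℝ} (hr0 : 0 ≤ r) (hr1 : r < 1) :
    IntegrableOn (fun θ => (1 - Real.cos θ) / θ ^ 2 * ((1 - r * charFun F θ)⁻¹).re) (Set.Ioi 0) ∧
    ∫ θ in Set.Ioi (0 : ℝ), (1 - Real.cos θ) / θ ^ 2 * ((1 - r * charFun F θ)⁻¹).re ≤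
      Real.pi / 2 * (renewalMeasure F (Set.Icc (-1) 1)).toReal := by
  have hφc := continuous_charFun (μ := F)
  have hw := integrableOn_one_sub_cos_div_sq
  have hre1 : ∀ (n : ℕ) (θ : ℝ), |(charFun F θ ^ n).re| ≤ 1 := by
    intro n θ
    refine (Complex.abs_re_le_norm _).trans ?_
    rw [norm_pow]
    exact pow_le_one₀ (norm_nonneg _) (norm_charFun_le F θ)
  have hm : ∀ n : ℕ, Measurable fun θ => (charFun F θ ^ n).re := fun n =>
    (Complex.continuous_re.comp (hφc.pow n)).measurable
  have hI : ∀ n : ℕ, Integrable (fun θ => (1 - Real.cos θ) / θ ^ 2 * (r ^ n * (charFun F θ ^ n).re))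
      (volume.restrict (Set.Ioi 0)) := by
    intro n
    have := hm n
    refine (hw.mul_const (r ^ n)).mono' (Measurable.aestronglyMeasurable (by fun_prop))
      (Eventually.of_forall fun θ => ?_)
    rw [norm_mul, norm_mul, Real.norm_of_nonneg (one_sub_cos_div_sq_nonneg _),
      Real.norm_of_nonneg (pow_nonneg hr0 n)]
    refine mul_le_mul_of_nonneg_left ?_ (one_sub_cos_div_sq_nonneg _)
    exact mul_le_of_le_one_right (pow_nonneg hr0 n) (hre1 n θ)
  have hsum : ∀ θ : ℝ, HasSum (fun n => (1 - Real.cos θ) / θ ^ 2 * (r ^ n * (charFun F θ ^ n).re))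
      ((1 - Real.cos θ) / θ ^ 2 * ((1 - r * charFun F θ)⁻¹).re) := by
    intro θ
    have := hasSum_resolvent F hr0 hr1 1 θ
    simp only [one_mul] at this
    exact this.mul_left _
  have h := hasSum_integral_of_dominated_convergence (μ := volume.restrict (Set.Ioi (0 : ℝ)))
    (F := fun (n : ℕ) (θ : ℝ) => (1 - Real.cos θ) / θ ^ 2 * (r ^ n * (charFun F θ ^ n).re))
    (f := fun θ => (1 - Real.cos θ) / θ ^ 2 * ((1 - r * charFun F θ)⁻¹).re)
    (fun n θ => (1 - Real.cos θ) / θ ^ 2 * r ^ n)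
    (fun n => (hI n).aestronglyMeasurable)
    (fun n => Eventually.of_forall fun θ => by
      rw [norm_mul, norm_mul, Real.norm_of_nonneg (one_sub_cos_div_sq_nonneg _),
        Real.norm_of_nonneg (pow_nonneg hr0 n)]
      refine mul_le_mul_of_nonneg_left ?_ (one_sub_cos_div_sq_nonneg _)
      exact mul_le_of_le_one_right (pow_nonneg hr0 n) (hre1 n θ))
    (Eventually.of_forall fun θ => (summable_geometric_of_lt_one hr0 hr1).mul_left _)
    (by simp_rw [tsum_mul_left]; exact hw.mul_const _)
    (Eventually.of_forall hsum)
  constructor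
  · have hmr : Measurable fun θ => ((1 - r * charFun F θ)⁻¹).re := by
      have := hφc.measurable
      exact Complex.measurable_re.comp (by fun_prop)
    refine (hw.mul_const (1 - r)⁻¹).mono' (Measurable.aestronglyMeasurable (by fun_prop))
      (Eventually.of_forall fun θ => ?_)
    rw [norm_mul, Real.norm_of_nonneg (one_sub_cos_div_sq_nonneg _)]
    refine mul_le_mul_of_nonneg_left ?_ (one_sub_cos_div_sq_nonneg _)
    refine (Complex.abs_re_le_norm _).trans ?_
    rw [norm_inv]
    refine inv_anti₀ (by linarith) ?_
    have h1 := norm_sub_norm_le (1 : ℂ) (r * charFun F θ)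
    rw [norm_one, norm_mul, Complex.norm_real, Real.norm_of_nonneg hr0] at h1
    have h2 : r * ‖charFun F θ‖ ≤ r * 1 := by gcongr; exact norm_charFun_le F θ
    linarith
  · have hUs : HasSum (fun n => Real.pi / 2 * (convPow F n).real (Set.Icc (-1) 1))
        (Real.pi / 2 * (renewalMeasure F (Set.Icc (-1) 1)).toReal) := by
      refine HasSum.mul_left _ ?_
      rw [renewalMeasure, Measure.sum_apply _ measurableSet_Icc] at hU ⊢
      rw [ENNReal.tsum_toReal_eq fun n => measure_ne_top _ _]
      exact (ENNReal.hasSum_toReal hU.ne)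
    refine hasSum_le (fun n => ?_) h hUs
    have h1 : ∫ θ in Set.Ioi (0 : ℝ), (1 - Real.cos θ) / θ ^ 2 * (r ^ n * (charFun F θ ^ n).re) =
        r ^ n * ∫ θ in Set.Ioi (0 : ℝ), (1 - Real.cos θ) / θ ^ 2 * (charFun (convPow F n) θ).re := by
      rw [← integral_const_mul]
      refine integral_congr_ae (Eventually.of_forall fun θ => ?_)
      simp only [charFun_convPow]; ring
    rw [h1]
    have h2 := integrable_fejer_mul_re_charFun (convPow F n)
    have h3 : 0 ≤ Real.pi / 2 * (convPow F n).real (Set.Icc (-1) 1) := by positivity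
    have h4 : r ^ n ≤ 1 := pow_le_one₀ hr0 hr1.le
    have h5 := pow_nonneg hr0 n
    nlinarith

lemma CondHa.charFun_ne_one (hHa : CondHa F) :
    ∃ δ : ℝ, 0 < δ ∧ ∀ θ, 0 < θ → θ ≤ δ → charFun F θ ≠ 1 := by
  obtain ⟨δ, hδ, h⟩ := hHa.one_sub_charFun_asymp (ε := 1 / 2) (by norm_num)
  refine ⟨δ, hδ, fun θ h0 h1 h2 => ?_⟩
  obtain ⟨hA, hn⟩ := h θ h0 h1
  have h3 := (norm_bounds_of_near (mul_pos h0 hA) le_rfl hn).1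
  rw [h2, sub_self, norm_zero] at h3
  have := mul_pos h0 hA
  linarith

/-- Fatou along r = 1 - 1/(n + 1): the integrands are nonnegative, converge pointwise where φ ≠ 1,
and have uniformly bounded integrals. -/
lemma lintegral_fejer_mul_resolvent_lt_top (hU : renewalMeasure F (Set.Icc (-1) 1) < ∞) {δ : ℝ}
    (hφ : ∀ θ, 0 < θ → θ ≤ δ → charFun F θ ≠ 1) :
    ∫⁻ θ in Set.Ioo 0 δ, ENNReal.ofReal ((1 - Real.cos θ) / θ ^ 2 * ((1 - charFun F θ)⁻¹).re) < ∞ := by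
  set C := Real.pi / 2 * (renewalMeasure F (Set.Icc (-1) 1)).toReal with hC
  set r : ℕ → ℝ := fun n => 1 - 1 / ((n : ℝ) + 1) with hr
  have hr0 : ∀ n, 0 ≤ r n := by
    intro n
    simp only [hr]
    have : 1 / ((n : ℝ) + 1) ≤ 1 := by
      rw [div_le_one (by positivity)]; have : (0 : ℝ) ≤ n := n.cast_nonneg; linarith
    linarith
  have hr1 : ∀ n, r n < 1 := by
    intro n
    have : 0 < 1 / ((n : ℝ) + 1) := by positivity
    simp only [hr]; linarith
  have hrlim : Tendsto r atTop (𝓝 1) := by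
    have := (tendsto_one_div_add_atTop_nhds_zero_nat (𝕜 := ℝ)).const_sub 1
    rw [sub_zero] at this
    exact this
  have hφc := continuous_charFun (μ := F)
  have hre : ∀ n θ, 0 ≤ ((1 - r n * charFun F θ)⁻¹).re := by
    intro n θ
    rw [Complex.inv_re]
    refine div_nonneg ?_ (Complex.normSq_nonneg _)
    have h1 : (charFun F θ).re ≤ 1 := by linarith [one_sub_re_charFun_nonneg F θ]
    simp only [Complex.sub_re, Complex.one_re, Complex.re_ofReal_mul]
    nlinarith [hr0 n, hr1 n]
  have hmeas : ∀ n, Measurable fun θ =>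
      ENNReal.ofReal ((1 - Real.cos θ) / θ ^ 2 * ((1 - r n * charFun F θ)⁻¹).re) := by
    intro n
    have hm : Measurable fun θ => ((1 - r n * charFun F θ)⁻¹).re := by
      have := hφc.measurable
      exact Complex.measurable_re.comp (by fun_prop)
    fun_prop
  have hb : ∀ n, ∫⁻ θ in Set.Ioo 0 δ, ENNReal.ofReal ((1 - Real.cos θ) / θ ^ 2 *
      ((1 - r n * charFun F θ)⁻¹).re) ≤ ENNReal.ofReal C := by
    intro n
    obtain ⟨hi, hle⟩ := integral_fejer_mul_resolvent_le hU (hr0 n) (hr1 n)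
    calc _ ≤ ∫⁻ θ in Set.Ioi 0, ENNReal.ofReal ((1 - Real.cos θ) / θ ^ 2 *
          ((1 - r n * charFun F θ)⁻¹).re) := lintegral_mono_set Set.Ioo_subset_Ioi_self
      _ = ENNReal.ofReal (∫ θ in Set.Ioi 0, (1 - Real.cos θ) / θ ^ 2 *
          ((1 - r n * charFun F θ)⁻¹).re) :=
        (ofReal_integral_eq_lintegral_ofReal hi (Eventually.of_forall fun θ =>
          mul_nonneg (one_sub_cos_div_sq_nonneg θ) (hre n θ))).symm
      _ ≤ _ := ENNReal.ofReal_le_ofReal hle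
  have hlim : ∀ θ ∈ Set.Ioo 0 δ, ENNReal.ofReal ((1 - Real.cos θ) / θ ^ 2 *
      ((1 - charFun F θ)⁻¹).re) = liminf (fun n => ENNReal.ofReal ((1 - Real.cos θ) / θ ^ 2 *
      ((1 - r n * charFun F θ)⁻¹).re)) atTop := by
    intro θ hθ
    have hne : (1 : ℂ) - charFun F θ ≠ 0 := fun h0 =>
      hφ θ hθ.1 hθ.2.le (sub_eq_zero.1 h0).symm
    have h1 : Tendsto (fun n => (1 : ℂ) - r n * charFun F θ) atTop (𝓝 (1 - (1 : ℝ) * charFun F θ)) :=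
      (((Complex.continuous_ofReal.tendsto 1).comp hrlim).mul_const _).const_sub _
    rw [Complex.ofReal_one, one_mul] at h1
    have h2 := (Complex.continuous_re.tendsto _).comp (h1.inv₀ hne)
    exact (ENNReal.tendsto_ofReal (h2.const_mul _)).liminf_eq.symm
  rw [setLIntegral_congr_fun measurableSet_Ioo hlim]
  refine (lintegral_liminf_le hmeas).trans_lt (lt_of_le_of_lt ?_ (ENNReal.ofReal_lt_top (r := C)))
  refine liminf_le_of_le (by isBoundedDefault) fun b hb' => ?_
  obtain ⟨n, hn⟩ := hb'.exists
  exact hn.trans (hb n)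

lemma CondHa.condHb_of_isTransient (hHa : CondHa F) (hT : IsTransient F) : CondHb F := by
  obtain ⟨δ, hδ, hφ⟩ := hHa.charFun_ne_one
  have hfin := lintegral_fejer_mul_resolvent_lt_top (hT 1 one_pos) hφ
  -- ε = 1 suffices: π/2 - 1 > 0, so an infinite R would force an infinite resolvent mass.
  obtain ⟨x₁, hx₁, h1⟩ := hHa.resolventMass_bounds one_pos le_rfl
  obtain ⟨x₂, hx₂, hpos, -⟩ := hHa.potter one_pos
  set x := max (max x₁ x₂) δ⁻¹ with hx
  have hxx₁ : x₁ ≤ x := (le_max_left _ _).trans (le_max_left _ _)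
  have hxx₂ : x₂ ≤ x := (le_max_right _ _).trans (le_max_left _ _)
  have hxp : 0 < x := by linarith
  have hxδ : x⁻¹ ≤ δ := by rw [inv_le_comm₀ hxp hδ]; exact le_max_right _ _
  have hx1 : x⁻¹ ≤ 1 := inv_le_one_of_one_le₀ (by linarith)
  have hpi := Real.pi_gt_three
  have hmass : resolventMass F x < ∞ := by
    have hle : resolventMass F x ≤ ENNReal.ofReal (Real.pi ^ 2 / 2) *
        ∫⁻ θ in Set.Ioo 0 δ, ENNReal.ofReal ((1 - Real.cos θ) / θ ^ 2 * ((1 - charFun F θ)⁻¹).re) := by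
      rw [← lintegral_const_mul' _ _ ENNReal.ofReal_ne_top]
      refine (setLIntegral_mono' measurableSet_Ioo fun θ hθ => ?_).trans
        (lintegral_mono_set (Set.Ioo_subset_Ioo_right hxδ))
      rw [← ENNReal.ofReal_mul (by positivity)]
      apply ENNReal.ofReal_le_ofReal
      have hQ := re_one_sub_charFun_inv_nonneg F θ
      have hθ0 : 0 < θ := hθ.1
      have h3 : Real.cos θ ≤ 1 - 2 / Real.pi ^ 2 * θ ^ 2 := Real.cos_le_one_sub_mul_cos_sq (by
        rw [abs_of_pos hθ0]; linarith [hθ.2])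
      have h4 : 1 ≤ Real.pi ^ 2 / 2 * ((1 - Real.cos θ) / θ ^ 2) := by
        have : 2 / Real.pi ^ 2 ≤ (1 - Real.cos θ) / θ ^ 2 := by
          rw [le_div_iff₀ (by positivity)]; linarith
        calc (1 : ℝ) = Real.pi ^ 2 / 2 * (2 / Real.pi ^ 2) := by field_simp
          _ ≤ _ := by gcongr
      rw [← mul_assoc]
      exact le_mul_of_one_le_left hQ h4
    exact hle.trans_lt (ENNReal.mul_lt_top ENNReal.ofReal_lt_top hfin)
  have h3 := (h1 x hxx₁).2.2
  refine condHb_of_tailRatio_lt_top hxp (fun t ht => hpos t (hxx₂.trans ht)) ?_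
  by_contra hinf
  rw [not_lt, top_le_iff] at hinf
  rw [hinf, ENNReal.mul_top (ENNReal.ofReal_pos.2 (by linarith)).ne'] at h3
  exact absurd (ENNReal.add_lt_top.2 ⟨hmass, ENNReal.ofReal_lt_top⟩) (not_lt.2 h3)

/-- The inversion formula at 0 makes the smoothed mass finite, and a Fejér kernel of bandwidth a ≤
1/y is bounded below on [-y, y]. -/
lemma CondHa.isTransient_of_condHb (hHa : CondHa F) (hHb : CondHb F)
    (hE : ∫⁻ x, ENNReal.ofReal |x| ∂F = ∞) : IsTransient F := by
  intro y hy
  obtain ⟨δ, hδ, hφ⟩ := hHa.charFun_ne_one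
  set a := min δ y⁻¹ with ha
  have ha0 : 0 < a := by positivity
  obtain ⟨-, h, -⟩ := hHa.lintegral_fejer_renewal hHb hE ha0
    (fun θ h0 h1 => hφ θ h0 (h1.trans (min_le_left _ _))) 0
  have hpi := Real.pi_pos
  have hle : ENNReal.ofReal (a / (4 * Real.pi)) * renewalMeasure F (Set.Icc (-y) y) ≤
      ∫⁻ u, ENNReal.ofReal (fejer a (u - 0)) ∂(renewalMeasure F) := by
    rw [← setLIntegral_const]
    refine (setLIntegral_mono' measurableSet_Icc fun u hu => ?_).trans (setLIntegral_le_lintegral _ _)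
    apply ENNReal.ofReal_le_ofReal
    rw [sub_zero]
    refine le_fejer ha0 ?_
    have h1 : |u| ≤ y := abs_le.2 hu
    calc a * |u| ≤ y⁻¹ * y := by gcongr; exact min_le_right _ _
      _ = 1 := inv_mul_cancel₀ hy.ne'
  rw [h] at hle
  by_contra hinf
  rw [not_lt, top_le_iff] at hinf
  rw [hinf, ENNReal.mul_top (ENNReal.ofReal_pos.2 (by positivity)).ne'] at hle
  exact absurd ENNReal.ofReal_lt_top (not_lt.2 hle)

end Transience

end RelStableRenewal


namespace RelStableRenewal

/-! ### Frequencies of order 1/|w| and the smoothed asymptotics. -/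

section Inner

/-- The derivative of (1 - cos u)/u is sinc u - (1 - cos u)/u², which transfers the value π/2 from
the absolutely convergent integral; the tail and the boundary term are each between 0 and 2/B. -/
lemma abs_integral_sinc_sub_le {B : ℝ} (hB : 0 < B) :
    |(∫ u in (0 : ℝ)..B, Real.sinc u) - Real.pi / 2| ≤ 2 / B := by
  set g : ℝ → ℝ := fun u => (1 - Real.cos u) / u ^ 2 with hg
  have hgi := integrableOn_one_sub_cos_div_sq
  have hgi0 : IntervalIntegrable g volume 0 B :=
    (intervalIntegrable_iff_integrableOn_Ioc_of_le hB.le).2 (hgi.mono_set Set.Ioc_subset_Ioi_self)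
  have hsi : IntervalIntegrable Real.sinc volume 0 B := Real.continuous_sinc.intervalIntegrable _ _
  -- The value 0/0 = 0 coincides with the limit at 0.
  have hcont : Continuous fun u : ℝ => (1 - Real.cos u) / u := by
    rw [continuous_iff_continuousAt]
    intro u
    rcases eq_or_ne u 0 with rfl | hu
    · rw [ContinuousAt, div_zero, Metric.tendsto_nhds_nhds]
      intro ε hε
      refine ⟨ε, hε, fun v hv => ?_⟩
      rw [Real.dist_eq, sub_zero] at hv ⊢
      rcases eq_or_ne v 0 with rfl | hv0
      · simpa using hε
      have h1 := one_sub_cos_le_half_sq v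
      have h2 := Real.cos_le_one v
      have h3 := abs_pos.2 hv0
      rw [abs_div, abs_of_nonneg (by linarith), div_lt_iff₀ h3]
      have h4 : |v| * |v| < ε * |v| := mul_lt_mul_of_pos_right hv h3
      have h5 : |v| * |v| = v ^ 2 := by rw [abs_mul_abs_self, sq]
      have h6 := sq_nonneg v
      linarith
    · exact ContinuousAt.div (by fun_prop) continuousAt_id hu
  have hft : ∫ u in (0 : ℝ)..B, (Real.sinc u - g u) = (1 - Real.cos B) / B - (1 - Real.cos 0) / 0 :=
    intervalIntegral.integral_eq_sub_of_hasDerivAt_of_le hB.le hcont.continuousOn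
      (fun u hu => by
        have hu0 : u ≠ 0 := hu.1.ne'
        refine HasDerivAt.congr_deriv
          (((Real.hasDerivAt_cos u).const_sub 1).div (hasDerivAt_id u) hu0) ?_
        rw [Real.sinc_of_ne_zero hu0, hg]
        dsimp only
        field_simp) (hsi.sub hgi0)
  rw [intervalIntegral.integral_sub hsi hgi0, div_zero, sub_zero] at hft
  have hsplit : (∫ u in (0 : ℝ)..B, g u) + ∫ u in Set.Ioi B, g u = Real.pi / 2 := by
    rw [intervalIntegral.integral_of_le hB.le, ← integral_one_sub_cos_div_sq,
      ← setIntegral_union Set.Ioc_disjoint_Ioi_same measurableSet_Ioi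
        (hgi.mono_set Set.Ioc_subset_Ioi_self) (hgi.mono_set (Set.Ioi_subset_Ioi hB.le)),
      Set.Ioc_union_Ioi_eq_Ioi hB.le]
  have h0 : 0 ≤ ∫ u in Set.Ioi B, g u := integral_nonneg one_sub_cos_div_sq_nonneg
  have h1 : ∫ u in Set.Ioi B, g u ≤ 2 / B := by
    have hi : IntegrableOn (fun u : ℝ => 2 * u ^ (-2 : ℝ)) (Set.Ioi B) :=
      (integrableOn_Ioi_rpow_of_lt (by norm_num) hB).const_mul 2
    have : ∫ u in Set.Ioi B, g u ≤ ∫ u in Set.Ioi B, 2 * u ^ (-2 : ℝ) := by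
      refine setIntegral_mono_on (hgi.mono_set (Set.Ioi_subset_Ioi hB.le)) hi measurableSet_Ioi ?_
      intro u hu
      have hu : 0 < u := hB.trans hu
      rw [Real.rpow_neg hu.le, Real.rpow_two, hg, ← div_eq_mul_inv]
      have := Real.neg_one_le_cos u
      exact div_le_div_of_nonneg_right (by linarith) (by positivity)
    refine this.trans (le_of_eq ?_)
    rw [integral_const_mul, integral_Ioi_rpow_of_lt (by norm_num) hB]
    norm_num
    rw [Real.rpow_neg_one]; rfl
  have h2 : 0 ≤ (1 - Real.cos B) / B := div_nonneg (by linarith [Real.cos_le_one B]) hB.le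
  have h3 : (1 - Real.cos B) / B ≤ 2 / B :=
    div_le_div_of_nonneg_right (by linarith [Real.neg_one_le_cos B]) hB.le
  rw [abs_le]
  constructor <;> linarith

lemma one_le_potterWeight {v : ℝ} (hv : 0 < v) : 1 ≤ potterWeight v := by
  rw [potterWeight, Real.inv_rpow hv.le]
  have h : 0 < v ^ (1 / 2 : ℝ) := by positivity
  rcases le_total 1 (v ^ (1 / 2 : ℝ)) with h1 | h1
  · have := inv_pos.2 h; linarith
  · have := (one_le_inv₀ h).2 h1; linarith

lemma intervalIntegrable_potterWeight {B : ℝ} (hB : 0 ≤ B) :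
    IntervalIntegrable potterWeight volume 0 B := by
  have h1 : IntervalIntegrable (fun v : ℝ => v ^ (1 / 2 : ℝ) + v ^ (-(1 / 2) : ℝ)) volume 0 B :=
    (intervalIntegral.intervalIntegrable_rpow' (by norm_num)).add
      (intervalIntegral.intervalIntegrable_rpow' (by norm_num))
  refine h1.congr fun v hv => ?_
  rw [Set.uIoc_of_le hB] at hv
  simp only [potterWeight]
  rw [Real.inv_rpow hv.1.le, Real.rpow_neg hv.1.le]

/-- Pure algebra, with q and p the real and imaginary parts of (1 - φ(θ))⁻¹, k = 1/(θA(|w|)), c and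
s the cosine and sine of θw, j the indicator of u = θ|w| ≤ 1, τ = θ/a the damping, and m the Potter
weight. -/
lemma abs_damped_sub_le {u m ε q p k c j s τ : ℝ} (hm : 1 ≤ m)
    (hε1 : ε ≤ 1) (hk : 0 ≤ k) (hτ : 0 ≤ τ) (hq : |q| ≤ 4 * ε * (m * k))
    (hp : |p - k| ≤ 5 * ε * (m * k)) (hcj : |c - j| ≤ u ^ 2) (hc : |c| ≤ 1) (hsu : |s| ≤ u)
    (hs : |s| ≤ 1) :
    |(1 - τ) * (c * q + s * p) - (j * q + s * k)| ≤
      m * k * (ε * (4 * u ^ 2 + 5 * u) + 10 * τ) := by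
  have hmk : 0 ≤ m * k := by positivity
  have e : (1 - τ) * (c * q + s * p) - (j * q + s * k) =
      (c - j) * q + s * (p - k) - τ * (c * q + s * p) := by ring
  have h1 : |(c - j) * q| ≤ u ^ 2 * (4 * ε * (m * k)) := by
    rw [abs_mul]; exact mul_le_mul hcj hq (abs_nonneg _) (sq_nonneg _)
  have h2 : |s * (p - k)| ≤ u * (5 * ε * (m * k)) := by
    rw [abs_mul]; exact mul_le_mul hsu hp (abs_nonneg _) ((abs_nonneg _).trans hsu)
  have hεm : ε * (m * k) ≤ m * k := mul_le_of_le_one_left hmk hε1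
  have hkm : k ≤ m * k := le_mul_of_one_le_left hk hm
  have h3 : |c * q| ≤ 4 * (m * k) := by
    rw [abs_mul]
    have := mul_le_mul hc hq (abs_nonneg _) zero_le_one
    linarith
  have h4 : |s * p| ≤ 6 * (m * k) := by
    have hp' : |p| ≤ 6 * (m * k) := by
      have := abs_sub_abs_le_abs_sub p k
      rw [abs_of_nonneg hk] at this
      linarith
    rw [abs_mul]
    have := mul_le_mul hs hp' (abs_nonneg _) zero_le_one
    linarith
  have h5 : |τ * (c * q + s * p)| ≤ τ * (10 * (m * k)) := by
    rw [abs_mul, abs_of_nonneg hτ]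
    refine mul_le_mul_of_nonneg_left ?_ hτ
    have := abs_add_le (c * q) (s * p)
    linarith
  rw [e]
  have h6 := abs_sub ((c - j) * q + s * (p - k)) (τ * (c * q + s * p))
  have h7 := abs_add_le ((c - j) * q) (s * (p - k))
  calc _ ≤ u ^ 2 * (4 * ε * (m * k)) + u * (5 * ε * (m * k)) + τ * (10 * (m * k)) := by linarith
    _ = _ := by ring

variable {F : Measure ℝ} [IsProbabilityMeasure F]

/-- With the cosine replaced by this cut-off, the cosine part of the inversion integral becomes
exactly the resolvent mass on (0, 1/|w|). -/
lemma abs_cos_sub_indicator_le (u : ℝ) :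
    |Real.cos u - (if u ≤ 1 then 1 else 0)| ≤ u ^ 2 := by
  split_ifs with h
  · have h1 := one_sub_cos_le_half_sq u
    have h2 := Real.cos_le_one u
    rw [abs_sub_comm, abs_of_nonneg (by linarith)]
    have := sq_nonneg u
    linarith
  · rw [sub_zero]
    push Not at h
    have := Real.abs_cos_le_one u
    have := one_le_pow₀ h.le (n := 2)
    linarith

/-- For θ|w| ≤ B, (1 - φ)⁻¹ ≈ i/(θA(1/θ)) ≈ i/(θA(|w|)), the second step at the cost of the Potter
weight. The real part is small compared with this, so the cut-off of the cosine is cheap, while the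
sine part becomes w sinc(θw)/A(|w|). -/
lemma CondHa.abs_inversionIntegrand_sub_le (hHa : CondHa F) {ε : ℝ} (hε : 0 < ε) (hε1 : ε ≤ 1) :
    ∃ x₀ : ℝ, 1 ≤ x₀ ∧ ∀ a B w θ : ℝ, 0 < a → x₀ ≤ |w| → 0 < θ → x₀ ≤ θ⁻¹ → θ * |w| ≤ B →
      |inversionIntegrand F a w θ - ((if θ * |w| ≤ 1 then 1 else 0) * ((1 - charFun F θ)⁻¹).re +
          w * Real.sinc (θ * w) / truncMean F |w|)| ≤
        potterWeight (θ * |w|) * ((ε * (4 * B + 5) * |w| + 10 / a) / truncMean F |w|) := by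
  obtain ⟨x₁, hx₁, hpos, hsv⟩ := hHa.slowVariation hε
  obtain ⟨δ, hδ, h2⟩ := hHa.one_sub_charFun_asymp (ε := ε / 2) (by positivity)
  refine ⟨max x₁ δ⁻¹, hx₁.trans (le_max_left _ _), fun a B w θ ha hw hθ hθx hB => ?_⟩
  have hw1 : x₁ ≤ |w| := (le_max_left _ _).trans hw
  have hw0 : 0 < |w| := by linarith
  have hwne : w ≠ 0 := abs_pos.1 hw0
  have hθ1 : x₁ ≤ θ⁻¹ := (le_max_left _ _).trans hθx
  have hθδ : θ ≤ δ := (inv_le_inv₀ hδ hθ).1 ((le_max_right _ _).trans hθx)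
  obtain ⟨hAt, hn⟩ := h2 θ hθ hθδ
  have hAw := hpos _ hw1
  have h3 := (hsv |w| θ⁻¹ hw1 hθ1).1
  have hu : 0 < θ * |w| := by positivity
  have em : (|w| / θ⁻¹) ^ (1 / 2 : ℝ) + (θ⁻¹ / |w|) ^ (1 / 2 : ℝ) = potterWeight (θ * |w|) := by
    rw [potterWeight, div_inv_eq_mul, mul_comm |w| θ, mul_inv, div_eq_mul_inv θ⁻¹]
  rw [em] at h3
  have hm := one_le_potterWeight hu
  have h4 := norm_inv_sub_le_of_near (mul_pos hθ hAt) (by linarith) hn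
  set m := potterWeight (θ * |w|) with hmdef
  set D := (1 - charFun F θ)⁻¹ with hD
  set u := θ * |w| with hudef
  set k := (θ * truncMean F |w|)⁻¹ with hk
  have hk0 : 0 < k := by positivity
  have ek : (θ * truncMean F θ⁻¹)⁻¹ = k * (truncMean F |w| / truncMean F θ⁻¹) := by
    rw [hk]
    generalize truncMean F θ⁻¹ = y at *
    field_simp
  have h5 : |(θ * truncMean F θ⁻¹)⁻¹ - k| ≤ ε * (m * k) := by
    rw [ek, show k * (truncMean F |w| / truncMean F θ⁻¹) - k =
      k * (truncMean F |w| / truncMean F θ⁻¹ - 1) by ring, abs_mul, abs_of_pos hk0]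
    calc _ ≤ k * (ε * m) := mul_le_mul_of_nonneg_left h3 hk0.le
      _ = _ := by ring
  have hmk : 0 < m * k := by positivity
  have h6 : (θ * truncMean F θ⁻¹)⁻¹ ≤ 2 * (m * k) := by
    have h7 := (abs_le.1 h5).2
    have h8 : ε * (m * k) ≤ m * k := mul_le_of_le_one_left hmk.le hε1
    have h9 : k ≤ m * k := le_mul_of_one_le_left hk0.le hm
    linarith
  have h7 : ‖D - Complex.I * ((θ * truncMean F θ⁻¹)⁻¹ : ℝ)‖ ≤ 2 * ε * (m * k) := by
    refine h4.trans ?_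
    calc 2 * (ε / 2) * (θ * truncMean F θ⁻¹)⁻¹ ≤ 2 * (ε / 2) * (2 * (m * k)) := by gcongr
      _ = _ := by ring
  have hq : |D.re| ≤ 4 * ε * (m * k) := by
    have := (Complex.abs_re_le_norm _).trans h7
    rw [Complex.sub_re, Complex.mul_re, Complex.I_re, Complex.I_im, Complex.ofReal_im, zero_mul,
      mul_zero, sub_zero, sub_zero] at this
    have h8 : 0 ≤ ε * (m * k) := by positivity
    linarith
  have hp : |D.im - k| ≤ 5 * ε * (m * k) := by
    have := (Complex.abs_im_le_norm _).trans h7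
    rw [Complex.sub_im, Complex.mul_im, Complex.I_re, Complex.I_im, Complex.ofReal_re, zero_mul,
      one_mul, zero_add] at this
    have h8 : 0 ≤ ε * (m * k) := by positivity
    have h9 := abs_sub_le D.im (θ * truncMean F θ⁻¹)⁻¹ k
    linarith
  have hcos : Real.cos (θ * w) = Real.cos u := by
    rw [← Real.cos_abs (θ * w), abs_mul, abs_of_pos hθ]
  have hsu : |Real.sin (θ * w)| ≤ u := by
    have := Real.abs_sin_le_abs (x := θ * w)
    rwa [abs_mul, abs_of_pos hθ] at this
  have key := abs_damped_sub_le hm hε1 hk0.le (div_nonneg hθ.le ha.le) hq hp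
    (abs_cos_sub_indicator_le u) (Real.abs_cos_le_one u) hsu (Real.abs_sin_le_one (θ * w))
  have es : w * Real.sinc (θ * w) / truncMean F |w| = Real.sin (θ * w) * k := by
    rw [Real.sinc_of_ne_zero (mul_ne_zero hθ.ne' hwne), hk]
    generalize Real.sin (θ * w) = y
    field_simp
  rw [es, inversionIntegrand, hcos]
  refine key.trans ?_
  rw [mul_assoc]
  refine mul_le_mul_of_nonneg_left ?_ (by linarith)
  have e2 : k * (ε * (4 * u ^ 2 + 5 * u) + 10 * (θ / a)) =
      (ε * (4 * u + 5) * |w| + 10 / a) / truncMean F |w| := by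
    rw [hk, hudef]
    field_simp
  rw [e2]
  gcongr

lemma toReal_resolventMass (x : ℝ) (hx : 0 < x) :
    (resolventMass F x).toReal = ∫ θ in (0 : ℝ)..x⁻¹, ((1 - charFun F θ)⁻¹).re := by
  have hφc := continuous_charFun (μ := F)
  have hmeas : Measurable fun θ : ℝ => ((1 - charFun F θ)⁻¹).re := by fun_prop
  rw [intervalIntegral.integral_of_le (inv_pos.2 hx).le, integral_Ioc_eq_integral_Ioo,
    integral_eq_lintegral_of_nonneg_ae
      (Eventually.of_forall fun θ => re_one_sub_charFun_inv_nonneg F θ) hmeas.aestronglyMeasurable,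
    resolventMass]

lemma CondHa.inner_integral_asymp (hHa : CondHa F) (hHb : CondHb F)
    (hE : ∫⁻ x, ENNReal.ofReal |x| ∂F = ∞) {a B ε : ℝ} (ha : 0 < a)
    (hφ : ∀ θ, 0 < θ → θ ≤ a → charFun F θ ≠ 1) (hB : 1 ≤ B) (hε : 0 < ε) :
    ∃ x₀ : ℝ, 1 ≤ x₀ ∧ ∀ w : ℝ, x₀ ≤ |w| → B / |w| ≤ a ∧
      |(∫ θ in (0 : ℝ)..(B / |w|), inversionIntegrand F a w θ) -
        ((resolventMass F |w|).toReal +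
          (∫ u in (0 : ℝ)..(B / |w| * w), Real.sinc u) / truncMean F |w|)| ≤ ε / truncMean F |w| := by
  have hB0 : 0 < B := by linarith
  set M := ∫ u in (0 : ℝ)..B, potterWeight u with hM
  have hM0 : 0 ≤ M := intervalIntegral.integral_nonneg hB0.le fun u hu => potterWeight_nonneg hu.1
  -- After u = θ|w| the error is M(η(4B + 5) + 10/(a|w|))/A(|w|); this η makes its first part at
  -- most ε/2, and a large |w| the second.
  set η := min 1 (ε / (2 * (4 * B + 5) * (M + 1))) with hη
  have hη0 : 0 < η := by positivity
  obtain ⟨x₁, hx₁, h1⟩ := hHa.abs_inversionIntegrand_sub_le hη0 (min_le_left _ _)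
  obtain ⟨x₂, hx₂, h2, -⟩ := hHa.potter one_pos
  have hQ := hHa.integrableOn_re_resolvent hHb hφ
  refine ⟨max (max (x₁ * B) x₂) (max (B / a) (20 * (M + 1) / (a * ε))),
    hx₂.trans ((le_max_right _ _).trans (le_max_left _ _)), fun w hw => ?_⟩
  have hw1 : x₁ * B ≤ |w| := (le_max_left _ _).trans ((le_max_left _ _).trans hw)
  have hw2 : x₂ ≤ |w| := (le_max_right _ _).trans ((le_max_left _ _).trans hw)
  have hw3 : B / a ≤ |w| := (le_max_left _ _).trans ((le_max_right _ _).trans hw)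
  have hw4 : 20 * (M + 1) / (a * ε) ≤ |w| := (le_max_right _ _).trans ((le_max_right _ _).trans hw)
  have hw0 : 0 < |w| := by linarith
  have hwx : x₁ ≤ |w| := (le_mul_of_one_le_right (by linarith) hB).trans hw1
  have hA := h2 _ hw2
  have hBa : B / |w| ≤ a := by
    rw [div_le_iff₀ ha] at hw3; rw [div_le_iff₀ hw0]; linarith
  have hBw : 0 < B / |w| := by positivity
  refine ⟨hBa, ?_⟩
  have iG : IntervalIntegrable (inversionIntegrand F a w) volume 0 (B / |w|) :=
    (hHa.lintegral_fejer_renewal hHb hE ha hφ w).1.mono_set (by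
      rw [Set.uIcc_of_le hBw.le, Set.uIcc_of_le ha.le]; exact Set.Icc_subset_Icc_right hBa)
  have iQ : IntervalIntegrable
      (Set.indicator {θ | θ ≤ |w|⁻¹} fun θ => ((1 - charFun F θ)⁻¹).re) volume 0 (B / |w|) := by
    rw [intervalIntegrable_iff_integrableOn_Ioc_of_le hBw.le]
    exact (hQ.mono_set (Set.Ioc_subset_Ioc_right hBa)).indicator measurableSet_Iic
  have iS : IntervalIntegrable (fun θ => w * Real.sinc (θ * w) / truncMean F |w|) volume 0
      (B / |w|) := by
    have := Real.continuous_sinc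
    exact Continuous.intervalIntegrable (by fun_prop) _ _
  have eQ : ∫ θ in (0 : ℝ)..(B / |w|),
      Set.indicator {θ | θ ≤ |w|⁻¹} (fun θ => ((1 - charFun F θ)⁻¹).re) θ =
      (resolventMass F |w|).toReal := by
    rw [intervalIntegral.integral_indicator, toReal_resolventMass _ hw0]
    refine ⟨by positivity, ?_⟩
    rw [inv_eq_one_div]
    exact div_le_div_of_nonneg_right hB hw0.le
  have eS : ∫ θ in (0 : ℝ)..(B / |w|), w * Real.sinc (θ * w) / truncMean F |w| =
      (∫ u in (0 : ℝ)..(B / |w| * w), Real.sinc u) / truncMean F |w| := by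
    rw [intervalIntegral.integral_div, intervalIntegral.integral_const_mul,
      intervalIntegral.mul_integral_comp_mul_right, zero_mul]
  rw [← eQ, ← eS, ← intervalIntegral.integral_add iQ iS,
    ← intervalIntegral.integral_sub iG (iQ.add iS), ← Real.norm_eq_abs]
  set c := (η * (4 * B + 5) * |w| + 10 / a) / truncMean F |w| with hc
  have iP : IntervalIntegrable (fun θ => potterWeight (θ * |w|) * c) volume 0 (B / |w|) := by
    have := (intervalIntegrable_potterWeight hB0.le).comp_mul_right (c := |w|)
    rw [zero_div] at this
    exact this.mul_const c
  refine (intervalIntegral.norm_integral_le_of_norm_le hBw.le (Eventually.of_forall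
    fun θ hθ => ?_) iP).trans ?_
  · have hθB : θ * |w| ≤ B := (le_div_iff₀ hw0).1 hθ.2
    have hθx : x₁ ≤ θ⁻¹ := by
      rw [le_inv_comm₀ (by linarith) hθ.1]
      refine hθ.2.trans ?_
      rw [div_le_iff₀ hw0, ← div_eq_inv_mul, le_div_iff₀ (by linarith)]
      linarith
    refine le_trans (le_of_eq ?_) (h1 a B w θ ha hwx hθ.1 hθx hθB)
    rw [Real.norm_eq_abs]
    congr 3
    rw [Set.indicator_apply]
    simp only [Set.mem_ofPred_eq, inv_eq_one_div, le_div_iff₀ hw0, ite_mul, one_mul, zero_mul]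
  · rw [intervalIntegral.integral_mul_const, intervalIntegral.integral_comp_mul_right _ hw0.ne',
      zero_mul, div_mul_cancel₀ _ hw0.ne', ← hM, smul_eq_mul, hc, mul_div_assoc']
    refine div_le_div_of_nonneg_right ?_ hA.le
    have h3 : η * (4 * B + 5) * (M + 1) ≤ ε / 2 := by
      have : η ≤ ε / (2 * (4 * B + 5) * (M + 1)) := min_le_right _ _
      rw [le_div_iff₀ (by positivity)] at this
      linarith
    have h4 : 10 * (M + 1) / (a * |w|) ≤ ε / 2 := by
      rw [div_le_iff₀ (by positivity)] at hw4 ⊢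
      linarith
    calc |w|⁻¹ * M * (η * (4 * B + 5) * |w| + 10 / a)
        ≤ |w|⁻¹ * (M + 1) * (η * (4 * B + 5) * |w| + 10 / a) := by gcongr; linarith
      _ = η * (4 * B + 5) * (M + 1) + 10 * (M + 1) / (a * |w|) := by
        generalize |w| = x at *
        field_simp
      _ ≤ ε := by linarith

lemma abs_integral_sinc_sign_sub_le {B w : ℝ} (hB : 0 < B) (hw : w ≠ 0) :
    |(∫ u in (0 : ℝ)..(B / |w| * w), Real.sinc u) - (if 0 ≤ w then 1 else -1) * (Real.pi / 2)| ≤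
      2 / B := by
  have h := abs_integral_sinc_sub_le hB
  have hw0 := abs_pos.2 hw
  split_ifs with h0
  · rw [abs_of_nonneg h0, div_mul_cancel₀ _ hw, one_mul]; exact h
  · rw [abs_of_neg (not_le.1 h0), div_neg, neg_mul, div_mul_cancel₀ _ hw]
    have e : ∫ u in (0 : ℝ)..(-B), Real.sinc u = -∫ u in (0 : ℝ)..B, Real.sinc u := by
      have := intervalIntegral.integral_comp_neg (a := 0) (b := B) Real.sinc
      simp only [Real.sinc_neg, neg_zero] at this
      rw [this, intervalIntegral.integral_symm]
    rw [e, ← abs_neg]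
    convert h using 2
    ring

/-- The inner part is close to (π/2)(R + σ/A) with σ the sign of w, so division by π gives (R +
σ/A)/2, which is r₊ or r₋. The errors are small multiples of R and 1/A, hence of r₊. -/
theorem CondHa.fejer_renewal_asymp (hHa : CondHa F) (hHb : CondHb F)
    (hE : ∫⁻ x, ENNReal.ofReal |x| ∂F = ∞) {a ε : ℝ} (ha : 0 < a)
    (hφ : ∀ θ, 0 < θ → θ ≤ a → charFun F θ ≠ 1) (hε : 0 < ε) :
    ∃ x₀ : ℝ, 1 ≤ x₀ ∧ ∀ w : ℝ, x₀ ≤ |w| → ∃ v : ℝ, 0 ≤ v ∧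
      ∫⁻ y, ENNReal.ofReal (fejer a (y - w)) ∂(renewalMeasure F) = ENNReal.ofReal v ∧
      |v - renewalDensity F w| ≤ ε * rPlus F |w| := by
  have hpi := Real.pi_pos
  have hpi3 := Real.pi_gt_three
  set κ := min 1 (ε / 8) with hκ
  have hκ0 : 0 < κ := by positivity
  have hκ1 : κ ≤ 1 := min_le_left _ _
  have hκε : κ ≤ ε / 8 := min_le_right _ _
  obtain ⟨C, hC, hout⟩ := hHa.norm_outer_integral_le ha hφ
  have hlim : Tendsto (fun B : ℝ => C * B ^ (-(1 / 2) : ℝ)) atTop (𝓝 (C * 0)) :=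
    (tendsto_rpow_neg_atTop (by norm_num)).const_mul C
  rw [mul_zero] at hlim
  -- B is fixed first, to make the outer integral and the sinc tail small; only then are the
  -- thresholds for |w| taken.
  obtain ⟨B, hBC, hBpi, hBκ⟩ := ((hlim.eventually (gt_mem_nhds hκ0)).and
    ((eventually_ge_atTop Real.pi).and (eventually_ge_atTop (2 / κ)))).exists
  have hB0 : 0 < B := by linarith
  obtain ⟨x₁, hx₁, h1⟩ := hout B hBpi
  obtain ⟨x₂, hx₂, h2⟩ := hHa.inner_integral_asymp hHb hE ha hφ (by linarith : (1 : ℝ) ≤ B) hκ0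
  obtain ⟨x₃, hx₃, h3⟩ := hHa.resolventMass_bounds hκ0 hκ1
  obtain ⟨x₄, hx₄, h4⟩ := hHa.renewalDensity_props hHb hE
  refine ⟨max (max x₁ x₂) (max x₃ x₄), hx₁.trans ((le_max_left _ _).trans (le_max_left _ _)),
    fun w hw => ?_⟩
  have hw1 : x₁ ≤ |w| := (le_max_left _ _).trans ((le_max_left _ _).trans hw)
  have hw2 : x₂ ≤ |w| := (le_max_right _ _).trans ((le_max_left _ _).trans hw)
  have hw3 : x₃ ≤ |w| := (le_max_left _ _).trans ((le_max_right _ _).trans hw)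
  have hw4 : x₄ ≤ |w| := (le_max_right _ _).trans ((le_max_right _ _).trans hw)
  have hw0 : 0 < |w| := by linarith
  have hwne : w ≠ 0 := abs_pos.1 hw0
  obtain ⟨hii, hfor, hnn⟩ := hHa.lintegral_fejer_renewal hHb hE ha hφ w
  refine ⟨_, hnn, hfor, ?_⟩
  obtain ⟨hBa, hin⟩ := h2 w hw2
  obtain ⟨hA, hu3, hl3⟩ := h3 _ hw3
  obtain ⟨-, hRfin, hrp, hrm, hAR⟩ := h4 _ hw4
  have hBw : 0 < B / |w| := by positivity
  set R := (tailRatio F |w|).toReal with hR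
  set α := (truncMean F |w|)⁻¹ with hα
  have hα0 : 0 < α := inv_pos.2 hA
  have hT : renewalDensity F w = (R + (if 0 ≤ w then 1 else -1) * α) / 2 := by
    rw [renewalDensity]
    split_ifs with h0
    · rw [abs_of_nonneg h0] at hrp; rw [hrp, one_mul]
    · rw [rMinus_eq_abs, hrm]; ring
  have hm : |(resolventMass F |w|).toReal - Real.pi / 2 * R| ≤ κ * R + κ * α := by
    have hRe : tailRatio F |w| = ENNReal.ofReal R := (ENNReal.ofReal_toReal hRfin.ne).symm
    have hR0 : 0 ≤ R := ENNReal.toReal_nonneg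
    rw [hRe, ← ENNReal.ofReal_mul (by positivity), ← ENNReal.ofReal_add (by positivity)
      (by positivity)] at hu3
    have hmfin : resolventMass F |w| ≠ ∞ := ne_top_of_le_ne_top ENNReal.ofReal_ne_top hu3
    rw [hRe, ← ENNReal.ofReal_mul (by linarith), ← ENNReal.ofReal_toReal hmfin,
      ← ENNReal.ofReal_add ENNReal.toReal_nonneg (by positivity),
      ENNReal.ofReal_le_ofReal_iff (by positivity), div_eq_mul_inv κ] at hl3
    have hu4 := ENNReal.toReal_mono ENNReal.ofReal_ne_top hu3
    rw [ENNReal.toReal_ofReal (by positivity), div_eq_mul_inv κ] at hu4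
    rw [abs_le]
    constructor <;> linarith
  have hs := abs_integral_sinc_sign_sub_le hB0 hwne
  have hs' : 2 / B ≤ κ := by
    rw [div_le_iff₀ hκ0] at hBκ; rw [div_le_iff₀ hB0]; linarith
  have hsub1 : IntervalIntegrable (inversionIntegrand F a w) volume 0 (B / |w|) :=
    hii.mono_set (by
      rw [Set.uIcc_of_le hBw.le, Set.uIcc_of_le ha.le]; exact Set.Icc_subset_Icc_right hBa)
  have hsub2 : IntervalIntegrable (inversionIntegrand F a w) volume (B / |w|) a :=
    hii.mono_set (by
      rw [Set.uIcc_of_le hBa, Set.uIcc_of_le ha.le]; exact Set.Icc_subset_Icc_left hBw.le)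
  have ho : |∫ θ in (B / |w|)..a, inversionIntegrand F a w θ| ≤ κ * α := by
    have hci : IntervalIntegrable (fun θ : ℝ => Complex.exp (-((θ * w : ℝ) * Complex.I)) *
        fejerResolvent F a θ) volume (B / |w|) a := by
      refine ContinuousOn.intervalIntegrable ?_
      rw [Set.uIcc_of_le hBa]
      exact ContinuousOn.mul (by fun_prop) (continuousOn_fejerResolvent hBw hφ)
    have e : ∫ θ in (B / |w|)..a, inversionIntegrand F a w θ =
        (∫ θ in (B / |w|)..a, Complex.exp (-((θ * w : ℝ) * Complex.I)) *
          fejerResolvent F a θ).re := by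
      have := Complex.reCLM.intervalIntegral_comp_comm hci
      simp only [Complex.reCLM_apply] at this
      rw [← this]
      exact intervalIntegral.integral_congr fun θ _ => inversionIntegrand_eq F a w θ
    rw [e]
    refine (Complex.abs_re_le_norm _).trans ((h1 w hw1).trans ?_)
    rw [div_eq_mul_inv]
    exact mul_le_mul_of_nonneg_right hBC.le hα0.le
  rw [← intervalIntegral.integral_add_adjacent_intervals hsub1 hsub2, hT, hrp]
  rw [div_eq_mul_inv _ (truncMean F |w|), div_eq_mul_inv κ, ← hα] at hin
  set G := ∫ θ in (0 : ℝ)..(B / |w|), inversionIntegrand F a w θ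
  set O := ∫ θ in (B / |w|)..a, inversionIntegrand F a w θ
  set S := ∫ u in (0 : ℝ)..(B / |w| * w), Real.sinc u
  set m := (resolventMass F |w|).toReal
  set σ : ℝ := if 0 ≤ w then 1 else -1
  have hSα : |S * α - σ * (Real.pi / 2) * α| ≤ κ * α := by
    rw [← sub_mul, abs_mul, abs_of_pos hα0]
    exact mul_le_mul_of_nonneg_right (hs.trans hs') hα0.le
  have e : 1 / Real.pi * (G + O) - (R + σ * α) / 2 = 1 / Real.pi *
      ((G - (m + S * α)) + O + (m - Real.pi / 2 * R) + (S * α - σ * (Real.pi / 2) * α)) := by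
    field_simp; ring
  have hsum : |(G - (m + S * α)) + O + (m - Real.pi / 2 * R) + (S * α - σ * (Real.pi / 2) * α)| ≤
      4 * κ * α + κ * R := by
    have t1 := abs_add_le ((G - (m + S * α)) + O + (m - Real.pi / 2 * R))
      (S * α - σ * (Real.pi / 2) * α)
    have t2 := abs_add_le ((G - (m + S * α)) + O) (m - Real.pi / 2 * R)
    have t3 := abs_add_le (G - (m + S * α)) O
    linarith
  rw [e, abs_mul, abs_of_pos (by positivity)]
  have hpi1 : 1 / Real.pi ≤ 1 := by rw [div_le_one hpi]; linarith
  refine (mul_le_of_le_one_left (abs_nonneg _) hpi1).trans (hsum.trans ?_)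
  have hR0 : 0 ≤ R := by linarith
  have k1 : κ * R ≤ ε / 8 * R := mul_le_mul_of_nonneg_right hκε hR0
  have k2 : κ * α ≤ ε / 8 * α := mul_le_mul_of_nonneg_right hκε hα0.le
  have k3 : 0 ≤ ε * R := by positivity
  linarith

end Inner

end RelStableRenewal


namespace RelStableRenewal

/-! ### Removing the Fejér smoothing. -/

section Smoothing

lemma fejer_neg (a u : ℝ) : fejer a (-u) = fejer a u := by
  simp only [fejer, mul_neg, Real.cos_neg]

lemma lintegral_fejer {a : ℝ} (ha : 0 < a) : ∫⁻ u, ENNReal.ofReal (fejer a u) = 1 := by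
  have hpi := Real.pi_pos
  have habs : ∀ u, fejer a u = fejer a |u| := by
    intro u
    rcases abs_choice u with h | h <;> rw [h]
    rw [fejer_neg]
  have h1 : ∫ u, fejer a u = 1 := by
    rw [funext habs, integral_comp_abs (f := fejer a)]
    have : ∫ u in Set.Ioi (0 : ℝ), fejer a u =
        ∫ u in Set.Ioi (0 : ℝ), (Real.pi * a)⁻¹ * ((1 - Real.cos (a * u)) / u ^ 2) := by
      refine setIntegral_congr_fun measurableSet_Ioi fun u hu => ?_
      have hu : 0 < u := hu
      simp only [fejer_eq ha hu.ne']
      field_simp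
    rw [this, integral_const_mul, (integral_one_sub_cos_mul_div_sq a).2, abs_of_pos ha]
    field_simp
  have hi : Integrable (fejer a) := Integrable.of_integral_ne_zero (by rw [h1]; norm_num)
  rw [← ofReal_integral_eq_lintegral_ofReal hi (Eventually.of_forall (fejer_nonneg ha)), h1,
    ENNReal.ofReal_one]

lemma le_lintegral_fejer_Icc {a δ : ℝ} (ha : 0 < a) (hδ : 0 < δ) :
    ENNReal.ofReal (1 - 4 / (Real.pi * a * δ)) ≤
      ∫⁻ u in Set.Icc (-δ) δ, ENNReal.ofReal (fejer a u) := by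
  have hpi := Real.pi_pos
  set g : ℝ → ℝ := Set.indicator (Set.Ioi δ) fun u => 2 / (Real.pi * a) * u ^ (-2 : ℝ) with hg
  have hg0 : ∀ u, 0 ≤ g |u| := fun u => Set.indicator_nonneg (fun v hv => by
    have : 0 < v := hδ.trans hv
    positivity) _
  have h1 : ∫ u, g |u| = 4 / (Real.pi * a * δ) := by
    rw [integral_comp_abs (f := g), hg, setIntegral_indicator measurableSet_Ioi,
      Set.inter_eq_self_of_subset_right (Set.Ioi_subset_Ioi hδ.le), integral_const_mul,
      integral_Ioi_rpow_of_lt (by norm_num) hδ]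
    norm_num
    rw [Real.rpow_neg_one]
    field_simp
    norm_num
  have hi : Integrable fun u => g |u| := Integrable.of_integral_ne_zero (by rw [h1]; positivity)
  have h2 : ∫⁻ u, ENNReal.ofReal (g |u|) = ENNReal.ofReal (4 / (Real.pi * a * δ)) := by
    rw [← ofReal_integral_eq_lintegral_ofReal hi (Eventually.of_forall hg0), h1]
  have hm : Measurable fun u => ENNReal.ofReal (fejer a u) :=
    (continuous_fejer a).measurable.ennreal_ofReal
  have h3 : (1 : ℝ≥0∞) ≤ (∫⁻ u in Set.Icc (-δ) δ, ENNReal.ofReal (fejer a u)) +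
      ENNReal.ofReal (4 / (Real.pi * a * δ)) := by
    rw [← h2, ← lintegral_fejer ha, ← lintegral_indicator measurableSet_Icc,
      ← lintegral_add_left (hm.indicator measurableSet_Icc)]
    refine lintegral_mono fun u => ?_
    by_cases hu : u ∈ Set.Icc (-δ) δ
    · rw [Set.indicator_of_mem hu]; exact le_self_add
    · rw [Set.indicator_of_notMem hu, zero_add]
      rw [Set.mem_Icc, ← abs_le, not_le] at hu
      have hu0 : u ≠ 0 := abs_pos.1 (hδ.trans hu)
      refine ENNReal.ofReal_le_ofReal ?_
      rw [hg, Set.indicator_of_mem (by exact hu), Real.rpow_neg (abs_nonneg _), Real.rpow_two, sq_abs]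
      refine (fejer_le ha hu0).trans (le_of_eq ?_)
      field_simp
  rw [ENNReal.ofReal_sub _ (by positivity), ENNReal.ofReal_one]
  exact tsub_le_iff_right.2 h3

lemma le_fejer_of_sq_le {a u K : ℝ} (ha : 0 < a) (hu : u ^ 2 ≤ K) :
    (1 - Real.cos (a * u)) / (Real.pi * a * K) ≤ fejer a u := by
  have hpi := Real.pi_pos
  rcases eq_or_ne u 0 with rfl | hu0
  · simpa using fejer_nonneg ha 0
  · rw [fejer_eq ha hu0]
    have := Real.cos_le_one (a * u)
    have : 0 < u ^ 2 := by positivity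
    gcongr

/-- A single kernel has zeros, but shifting by π turns 1 - cos z into 1 + cos z, so the numerators
add up to 2. The constant comes from bounding both z² and (z - π)² by 2π²(1 + z²). -/
lemma le_fejer_one_add_fejer_one (z : ℝ) :
    1 / (Real.pi ^ 3 * (1 + z ^ 2)) ≤ fejer 1 z + fejer 1 (z - Real.pi) := by
  have hpi := Real.pi_gt_three
  have hpi2 : 9 ≤ Real.pi ^ 2 := by nlinarith
  have hz := sq_nonneg z
  have h0 : z ^ 2 ≤ Real.pi ^ 2 * z ^ 2 := by nlinarith
  have h1 := le_fejer_of_sq_le (K := 2 * Real.pi ^ 2 * (1 + z ^ 2)) one_pos (u := z) (by linarith)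
  have h2 := le_fejer_of_sq_le (K := 2 * Real.pi ^ 2 * (1 + z ^ 2)) one_pos (u := z - Real.pi) (by
    nlinarith [sq_nonneg (z + Real.pi)])
  rw [one_mul, mul_one] at h1 h2
  rw [Real.cos_sub_pi] at h2
  refine le_trans (le_of_eq ?_) (add_le_add h1 h2)
  field_simp
  ring

/-- The smoothed mass `∫ fejer a (y - w) U(dy)` around `w`. -/
noncomputable def smoothedMass (μ : Measure ℝ) (a w : ℝ) : ℝ≥0∞ :=
  ∫⁻ y, ENNReal.ofReal (fejer a (y - w)) ∂μ

lemma lintegral_smoothedMass (μ : Measure ℝ) [SFinite μ] (a w c d : ℝ) :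
    ∫⁻ s in Set.Icc c d, smoothedMass μ a (w + s) =
      ∫⁻ y, (∫⁻ s in Set.Icc c d, ENNReal.ofReal (fejer a (y - w - s))) ∂μ := by
  unfold smoothedMass
  rw [lintegral_lintegral_swap]
  · simp only [sub_sub]
  · exact ((continuous_fejer a).comp (continuous_snd.sub
      (continuous_const.add continuous_fst))).measurable.ennreal_ofReal.aemeasurable

/-- For y in the interval the widened window of shifts covers all kernel arguments in [-δ, δ], which
carry all but 4/(πaδ) of the kernel's mass. -/
lemma measure_Ioc_le_lintegral_smoothedMass (μ : Measure ℝ) [SFinite μ] {a δ h : ℝ} (ha : 0 < a)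
    (hδ : 0 < δ) (w : ℝ) :
    ENNReal.ofReal (1 - 4 / (Real.pi * a * δ)) * μ (Set.Ioc w (w + h)) ≤
      ∫⁻ s in Set.Icc (-δ) (h + δ), smoothedMass μ a (w + s) := by
  rw [lintegral_smoothedMass, ← setLIntegral_const]
  refine (setLIntegral_mono' measurableSet_Ioc fun y hy => ?_).trans (setLIntegral_le_lintegral _ _)
  refine (le_lintegral_fejer_Icc ha hδ).trans ?_
  rw [← lintegral_indicator measurableSet_Icc, ← lintegral_indicator measurableSet_Icc,
    ← lintegral_sub_left_eq_self _ (y - w)]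
  refine lintegral_mono fun s => ?_
  by_cases hs : y - w - s ∈ Set.Icc (-δ) δ
  · have hs' : s ∈ Set.Icc (-δ) (h + δ) := ⟨by linarith [hs.2, hy.1], by linarith [hs.1, hy.2]⟩
    rw [Set.indicator_of_mem hs, Set.indicator_of_mem hs']
  · rw [Set.indicator_of_notMem hs]; exact zero_le

lemma sq_bound_of_mem_Icc {z s δ h : ℝ} (hδ : 0 < δ) (hz : z ∉ Set.Ioc 0 h)
    (hs : s ∈ Set.Icc δ (h - δ)) :
    z - s ≠ 0 ∧ 1 + z ^ 2 ≤ (2 + (2 * h ^ 2 + 1) / δ ^ 2) * (z - s) ^ 2 := by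
  have h1 : δ ^ 2 ≤ (z - s) ^ 2 := by
    rw [sq_le_sq, abs_of_pos hδ]
    rcases le_or_gt z 0 with h0 | h0
    · rw [abs_of_neg (by linarith [hs.1])]; linarith [hs.1]
    · have : h < z := by
        by_contra hc
        exact hz ⟨h0, not_lt.1 hc⟩
      rw [abs_of_pos (by linarith [hs.2])]; linarith [hs.2]
  have h2 : 0 < δ ^ 2 := by positivity
  refine ⟨fun h0 => by rw [h0] at h1; linarith, ?_⟩
  have h3 : (2 * h ^ 2 + 1) ≤ (2 * h ^ 2 + 1) / δ ^ 2 * (z - s) ^ 2 := by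
    rw [div_mul_eq_mul_div, le_div_iff₀ h2]
    exact mul_le_mul_of_nonneg_left h1 (by positivity)
  have h4 : s ^ 2 ≤ h ^ 2 := by
    have := hs.1; have := hs.2
    exact pow_le_pow_left₀ (by linarith) (by linarith) 2
  have h5 : z ^ 2 ≤ 2 * (z - s) ^ 2 + 2 * s ^ 2 := by nlinarith [sq_nonneg (z - 2 * s)]
  rw [add_mul]
  linarith

/-- Over the shrunken window a point inside the interval contributes at most 1. A point outside, at
offset z = y - w, leaks O(1/(a(1 + z²))), which two kernels of fixed bandwidth 1 dominate; their
smoothed masses are already known. -/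
lemma exists_lintegral_smoothedMass_le (μ : Measure ℝ) [SFinite μ] {δ h : ℝ} (hδ : 0 < δ)
    (hδh : 2 * δ ≤ h) :
    ∃ C : ℝ, 0 < C ∧ ∀ a w : ℝ, 0 < a →
      ∫⁻ s in Set.Icc δ (h - δ), smoothedMass μ a (w + s) ≤ μ (Set.Ioc w (w + h)) +
        ENNReal.ofReal (C / a) * (smoothedMass μ 1 w + smoothedMass μ 1 (w + Real.pi)) := by
  have hpi := Real.pi_pos
  have hh : 0 < h := by linarith
  set D := 2 + (2 * h ^ 2 + 1) / δ ^ 2 with hD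
  have hD0 : 0 < D := by positivity
  refine ⟨2 * h * D * Real.pi ^ 2, by positivity, fun a w ha => ?_⟩
  have hm : ∀ c : ℝ, Measurable fun y => ENNReal.ofReal (fejer 1 (y - c)) := fun c =>
    ((continuous_fejer 1).comp (continuous_id.sub continuous_const)).measurable.ennreal_ofReal
  rw [lintegral_smoothedMass, smoothedMass, smoothedMass, ← lintegral_add_left (hm w),
    ← lintegral_const_mul _ (by exact (hm w).add (hm _)), ← lintegral_indicator_one measurableSet_Ioc,
    ← lintegral_add_left (measurable_one.indicator measurableSet_Ioc)]
  refine lintegral_mono fun y => ?_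
  by_cases hy : y ∈ Set.Ioc w (w + h)
  · rw [Set.indicator_of_mem hy]
    refine le_trans (le_trans (setLIntegral_le_lintegral _ _) (le_of_eq ?_)) le_self_add
    rw [lintegral_sub_left_eq_self (fun u => ENNReal.ofReal (fejer a u)) (y - w), lintegral_fejer ha]
    rfl
  · rw [Set.indicator_of_notMem hy, zero_add, ← sub_sub]
    set z := y - w with hz
    have hz' : z ∉ Set.Ioc 0 h := fun hc => hy ⟨by linarith [hc.1], by linarith [hc.2]⟩
    rw [← ENNReal.ofReal_add (fejer_nonneg one_pos _) (fejer_nonneg one_pos _),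
      ← ENNReal.ofReal_mul (by positivity)]
    have hb : ∀ s ∈ Set.Icc δ (h - δ),
        ENNReal.ofReal (fejer a (z - s)) ≤ ENNReal.ofReal (2 * D / (Real.pi * a * (1 + z ^ 2))) := by
      intro s hs
      obtain ⟨h0, h1⟩ := sq_bound_of_mem_Icc hδ hz' hs
      refine ENNReal.ofReal_le_ofReal ((fejer_le ha h0).trans ?_)
      have h2 : 0 < (z - s) ^ 2 := by positivity
      rw [div_le_div_iff₀ (by positivity) (by positivity)]
      calc 2 * (Real.pi * a * (1 + z ^ 2)) ≤ 2 * (Real.pi * a * (D * (z - s) ^ 2)) := by gcongr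
        _ = _ := by ring
    refine (setLIntegral_mono' measurableSet_Icc hb).trans ?_
    rw [setLIntegral_const, Real.volume_Icc, ← ENNReal.ofReal_mul (by positivity)]
    refine ENNReal.ofReal_le_ofReal ?_
    calc 2 * D / (Real.pi * a * (1 + z ^ 2)) * (h - δ - δ)
        ≤ 2 * D / (Real.pi * a * (1 + z ^ 2)) * h := by gcongr; linarith
      _ = 2 * h * D * Real.pi ^ 2 / a * (1 / (Real.pi ^ 3 * (1 + z ^ 2))) := by field_simp
      _ ≤ _ := mul_le_mul_of_nonneg_left (le_fejer_one_add_fejer_one z) (by positivity)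

end Smoothing

/-! ### The renewal asymptotics and the theorem. -/

section Main

variable {F : Measure ℝ} [IsProbabilityMeasure F]

/-- If φ(θ) = 1, the nonnegative variable 1 - cos(θX) has mean 0, so X lies in (2π/θ)ℤ almost
surely. -/
lemma charFun_ne_one_of_not_isArithmetic (hF : ¬ IsArithmetic F) {θ : ℝ} (hθ : 0 < θ) :
    charFun F θ ≠ 1 := by
  intro h
  refine hF ⟨2 * Real.pi / θ, by positivity, ?_⟩
  have h1 := one_sub_re_charFun F θ
  rw [h, Complex.one_re, sub_self] at h1
  have h2 := (integral_eq_zero_iff_of_nonneg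
    (fun y => sub_nonneg.2 (Real.cos_le_one (θ * y)))
    ((integrable_const (1 : ℝ)).sub (integrable_cos_mul F θ))).1 h1.symm
  filter_upwards [h2] with y hy
  obtain ⟨n, hn⟩ := (Real.cos_eq_one_iff (θ * y)).1 (sub_eq_zero.1 hy).symm
  refine ⟨n, ?_⟩
  have := Real.pi_pos
  rw [div_div_eq_mul_div, mul_comm y θ, ← hn]
  field_simp

/-- The mass of (w, w + h] is enclosed between averages of smoothed masses over windows of length h
- 2δ and h + 2δ; each smoothed mass is close to the density at w, by the smoothed asymptotics and
shift insensitivity. -/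
theorem CondHa.renewal_asymp (hHa : CondHa F) (hHb : CondHb F)
    (hE : ∫⁻ x, ENNReal.ofReal |x| ∂F = ∞) (hF : ¬ IsArithmetic F) {h ε : ℝ} (hh : 0 < h)
    (hε : 0 < ε) :
    ∃ x₀ : ℝ, 1 ≤ x₀ ∧ ∀ w : ℝ, x₀ ≤ |w| → 0 < rPlus F |w| ∧
      |(renewalMeasure F (Set.Ioc w (w + h))).toReal - h * renewalDensity F w| ≤
        ε * rPlus F |w| := by
  have hpi := Real.pi_pos
  set δ := min (h / 4) (ε / 4) with hδdef
  have hδ : 0 < δ := by positivity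
  have hδh : δ ≤ h / 4 := min_le_left _ _
  have hδε : δ ≤ ε / 4 := min_le_right _ _
  set κ := min (1 / 2) (ε / (32 * h + 32)) with hκdef
  have hκ : 0 < κ := by positivity
  have hκ1 : κ ≤ 1 / 2 := min_le_left _ _
  have hκε : κ * (32 * h + 32) ≤ ε := (le_div_iff₀ (by positivity)).1 (min_le_right _ _)
  have : SFinite (renewalMeasure F) := by unfold renewalMeasure; infer_instance
  obtain ⟨C, hC, hlow⟩ := exists_lintegral_smoothedMass_le (renewalMeasure F) (h := h) hδ (by linarith)
  -- The first entry leaves at most κ of the kernel outside [-δ, δ]; the second makes the leakage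
  -- coefficient C/a at most κ.
  set a := max (4 / (Real.pi * κ * δ)) (C / κ) with hadef
  have ha : 0 < a := lt_max_of_lt_right (by positivity)
  have ha1 : 4 / (Real.pi * a * δ) ≤ κ := by
    have : 4 / (Real.pi * κ * δ) ≤ a := le_max_left _ _
    rw [div_le_iff₀ (by positivity)] at this ⊢
    linarith
  have ha2 : C / a ≤ κ := by
    have : C / κ ≤ a := le_max_right _ _
    rw [div_le_iff₀ hκ] at this
    rw [div_le_iff₀ ha]
    linarith
  -- Large enough for every shift in play: the windows within [-δ, h + δ], and the shift by π of the
  -- second kernel of bandwidth 1.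
  set c := h + δ + Real.pi with hc
  have hc0 : 0 < c := by positivity
  obtain ⟨x₁, hx₁, h1⟩ := hHa.fejer_renewal_asymp hHb hE ha
    (fun θ h0 _ => charFun_ne_one_of_not_isArithmetic hF h0) hκ
  obtain ⟨x₂, hx₂, h2⟩ := hHa.fejer_renewal_asymp hHb hE one_pos
    (fun θ h0 _ => charFun_ne_one_of_not_isArithmetic hF h0) hκ
  obtain ⟨x₃, hx₃, h3⟩ := hHa.renewalDensity_shift hHb hE hc0 hκ
  refine ⟨max (max x₁ x₂ + c) x₃, hx₃.trans (le_max_right _ _), fun w hw => ?_⟩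
  obtain ⟨hb, hT0, hTb, hsh⟩ := h3 w ((le_max_right _ _).trans hw)
  refine ⟨hb, ?_⟩
  set b := rPlus F |w| with hbdef
  set T := renewalDensity F w with hT
  have hfar : ∀ s, |s| ≤ c → max x₁ x₂ ≤ |w + s| := by
    intro s hs
    have := abs_sub_abs_le_abs_sub w (-s)
    rw [abs_neg, sub_neg_eq_add] at this
    have := (le_max_left _ _).trans hw
    linarith
  have hval : ∀ {v s : ℝ}, |s| ≤ c →
      |v - renewalDensity F (w + s)| ≤ κ * rPlus F |w + s| → |v - T| ≤ 3 * κ * b := by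
    intro v s hs hv
    obtain ⟨e1, e2⟩ := hsh s hs
    have e3 := mul_le_mul_of_nonneg_left e2 hκ.le
    have := abs_sub_le v (renewalDensity F (w + s)) T
    linarith
  have hIa : ∀ s, |s| ≤ c → ENNReal.ofReal (T - 3 * κ * b) ≤ smoothedMass (renewalMeasure F) a (w + s) ∧
      smoothedMass (renewalMeasure F) a (w + s) ≤ ENNReal.ofReal (T + 3 * κ * b) := by
    intro s hs
    obtain ⟨v, -, e, hv⟩ := h1 (w + s) ((le_max_left _ _).trans (hfar s hs))
    rw [smoothedMass, e]
    have := abs_le.1 (hval hs hv)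
    exact ⟨ENNReal.ofReal_le_ofReal (by linarith), ENNReal.ofReal_le_ofReal (by linarith)⟩
  have hI1 : ∀ s, |s| ≤ c → smoothedMass (renewalMeasure F) 1 (w + s) ≤ ENNReal.ofReal (5 / 2 * b) := by
    intro s hs
    obtain ⟨v, -, e, hv⟩ := h2 (w + s) ((le_max_right _ _).trans (hfar s hs))
    rw [smoothedMass, e]
    have := abs_le.1 (hval hs hv)
    have : κ * b ≤ 1 / 2 * b := mul_le_mul_of_nonneg_right hκ1 hb.le
    exact ENNReal.ofReal_le_ofReal (by linarith)
  have hκb : 0 ≤ κ * b := by positivity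
  have hup : ENNReal.ofReal (1 - κ) * renewalMeasure F (Set.Ioc w (w + h)) ≤
      ENNReal.ofReal ((T + 3 * κ * b) * (h + 2 * δ)) := by
    calc _ ≤ ENNReal.ofReal (1 - 4 / (Real.pi * a * δ)) * renewalMeasure F (Set.Ioc w (w + h)) := by
          gcongr
      _ ≤ _ := measure_Ioc_le_lintegral_smoothedMass (renewalMeasure F) ha hδ w
      _ ≤ ∫⁻ s in Set.Icc (-δ) (h + δ), ENNReal.ofReal (T + 3 * κ * b) :=
          setLIntegral_mono' measurableSet_Icc fun s hs =>
            (hIa s (abs_le.2 ⟨by linarith [hs.1], by linarith [hs.2]⟩)).2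
      _ = _ := by
          rw [setLIntegral_const, Real.volume_Icc, ← ENNReal.ofReal_mul (by linarith)]
          congr 2; ring
  have hdn : ENNReal.ofReal ((T - 3 * κ * b) * (h - 2 * δ)) ≤
      renewalMeasure F (Set.Ioc w (w + h)) + ENNReal.ofReal (5 * κ * b) := by
    calc _ = ∫⁻ s in Set.Icc δ (h - δ), ENNReal.ofReal (T - 3 * κ * b) := by
          rw [setLIntegral_const, Real.volume_Icc, ← ENNReal.ofReal_mul' (by linarith)]
          congr 2; ring
      _ ≤ ∫⁻ s in Set.Icc δ (h - δ), smoothedMass (renewalMeasure F) a (w + s) :=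
          setLIntegral_mono' measurableSet_Icc fun s hs =>
            (hIa s (abs_le.2 ⟨by linarith [hs.1], by linarith [hs.2]⟩)).1
      _ ≤ _ := hlow a w ha
      _ ≤ renewalMeasure F (Set.Ioc w (w + h)) + ENNReal.ofReal κ *
          (ENNReal.ofReal (5 / 2 * b) + ENNReal.ofReal (5 / 2 * b)) := by
          have e0 := hI1 0 (by rw [abs_zero]; exact hc0.le)
          have e1 := hI1 Real.pi (by rw [abs_of_pos hpi]; linarith)
          rw [add_zero] at e0
          gcongr
      _ = _ := by
          rw [← ENNReal.ofReal_add (by positivity) (by positivity), ← ENNReal.ofReal_mul hκ.le]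
          congr 2; ring
  have hfin : renewalMeasure F (Set.Ioc w (w + h)) ≠ ∞ := by
    intro hc
    rw [hc, ENNReal.mul_top (by simp; linarith)] at hup
    exact absurd hup (by simp)
  set V := (renewalMeasure F (Set.Ioc w (w + h))).toReal with hV
  have hV0 : 0 ≤ V := ENNReal.toReal_nonneg
  rw [← ENNReal.ofReal_toReal hfin, ← hV] at hup hdn
  rw [← ENNReal.ofReal_mul (by linarith), ENNReal.ofReal_le_ofReal_iff (by
    have : 0 ≤ T + 3 * κ * b := by linarith
    positivity)] at hup
  rw [← ENNReal.ofReal_add hV0 (by positivity), ENNReal.ofReal_le_ofReal_iff (by positivity)] at hdn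
  have p1 : T * δ ≤ b * (ε / 4) := mul_le_mul hTb hδε hδ.le hb.le
  have p2 : (κ * b) * (h + 2 * δ) ≤ (κ * b) * (3 / 2 * h) := by gcongr; linarith
  have p3 : κ * b * (32 * h + 32) ≤ ε * b := by
    have := mul_le_mul_of_nonneg_right hκε hb.le
    linarith
  have p4 : 0 ≤ κ * b * h := by positivity
  have p5 : 0 ≤ κ * b * δ := by positivity
  have p6 : T * (h + 2 * δ) ≤ b * (3 / 2 * h) :=
    mul_le_mul hTb (by linarith) (by positivity) hb.le
  have p7 : κ * V ≤ κ * (8 * (b * h)) := by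
    refine mul_le_mul_of_nonneg_left ?_ hκ.le
    have q1 : κ * V ≤ 1 / 2 * V := mul_le_mul_of_nonneg_right hκ1 hV0
    have q2 : κ * (b * h) ≤ 1 / 2 * (b * h) := mul_le_mul_of_nonneg_right hκ1 (by positivity)
    linarith
  rw [abs_le]
  constructor
  · linarith
  · linarith

end Main

end RelStableRenewal

theorem mainTheorem1 (F : Measure ℝ) [IsProbabilityMeasure F]
    (hE : ∫⁻ x, ENNReal.ofReal |x| ∂F = ∞)
    (hHa : RelStableRenewal.CondHa F) :
    (RelStableRenewal.IsTransient F ↔ RelStableRenewal.CondHb F) ∧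
    (RelStableRenewal.IsTransient F → ¬ RelStableRenewal.IsArithmetic F →
      ∀ h : ℝ, 0 < h →
        (fun x : ℝ => (RelStableRenewal.renewalMeasure F (Set.Ioc x (x + h))).toReal / h)
            ~[atTop] (fun x : ℝ => RelStableRenewal.rPlus F x) ∧
        (fun x : ℝ => (RelStableRenewal.renewalMeasure F (Set.Ioc x (x + h))).toReal / h
              - RelStableRenewal.rMinus F x)
            =o[atBot] (fun x : ℝ => RelStableRenewal.rPlus F |x|)) := by
  refine ⟨⟨fun h => hHa.condHb_of_isTransient h, fun h => hHa.isTransient_of_condHb h hE⟩,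
    fun hT hF h hh => ⟨?_, ?_⟩⟩
  · rw [IsEquivalent, isLittleO_iff]
    intro c hc
    obtain ⟨x₀, hx₀, hw⟩ := hHa.renewal_asymp (hHa.condHb_of_isTransient hT) hE hF hh (mul_pos hc hh)
    filter_upwards [eventually_ge_atTop x₀] with x hx
    have hx0 : 0 ≤ x := by linarith
    obtain ⟨hb, hd⟩ := hw x (by rwa [abs_of_nonneg hx0])
    rw [RelStableRenewal.renewalDensity, if_pos hx0] at hd
    rw [abs_of_nonneg hx0] at hb hd
    rw [Pi.sub_apply, Real.norm_eq_abs, Real.norm_of_nonneg hb.le, div_sub' hh.ne', abs_div,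
      abs_of_pos hh, div_le_iff₀ hh]
    linarith
  · rw [isLittleO_iff]
    intro c hc
    obtain ⟨x₀, hx₀, hw⟩ := hHa.renewal_asymp (hHa.condHb_of_isTransient hT) hE hF hh (mul_pos hc hh)
    filter_upwards [eventually_le_atBot (-x₀)] with x hx
    have hx0 : ¬ 0 ≤ x := by linarith
    obtain ⟨hb, hd⟩ := hw x (by rw [abs_of_neg (not_le.1 hx0)]; linarith)
    rw [RelStableRenewal.renewalDensity, if_neg hx0] at hd
    rw [Real.norm_eq_abs, Real.norm_of_nonneg hb.le, div_sub' hh.ne', abs_div,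
      abs_of_pos hh, div_le_iff₀ hh]
    linarith
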